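/- **Setting.** Let $\mathcal X$ be a measurable space, $\mu_{\mathcal X}$ a probability on $\mathcal X$ and, given $X\sim\mu_{\mathcal X}$, let the augmentations $\xi,\xi'$ be drawn independently from a Markov kernel; $\mu_\Xi$ is the law of $\xi$. Let $\mathcal H$ be a real Hilbert space, $\phi:\mathcal X\to\mathcal H$, $f_\theta(x)=\langle\theta,\phi(x)\rangle$, $\Psi=\{f_\theta\}$, with $\phi\in L^2(\mu_\Xi)$. Let $S:\mathcal H\to L^2(\mu_\Xi)$, $S\theta=f_\theta$, $K=SS^\top$, $\langle f,Tg\rangle=\mathbb E[f(\xi)g(\xi')]$ and, for $\beta,\lambda>0$, $T_\lambda=(1-\beta)I+\beta T-\lambda K^{-1}$, a self-adjoint operator on the $L^2(\mu_\Xi)$-closure of $\Psi$ ($K^{-1}=+\infty$ on $\ker K$). For $\psi:\mathcal X\to\mathbb R^k$ and $\Theta\in\mathbb R^k\otimes\mathcal H$ put $$\mathcal L(\psi)=\beta\,\mathbb E\|\psi(\xi)-\psi(\xi')\|^2+\|\mathbb E[\psi(\xi)\psi(\xi)^\top]-I\|_F^2,\qquad \mathcal L_k(\Theta;\lambda)=\mathcal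 L(\Theta\phi)+2\lambda\|\Theta\|_2^2 .$$ Let $\Theta_*$ be a minimizer of $\mathcal L_k(\cdot;\lambda)$ over $\mathbb R^k\otimes\mathcal H$, $\hat\Theta\in\mathbb R^k\otimes\mathcal H$ arbitrary, $\psi=\hat\Theta\phi$. Downstream, $(X,Y)\sim\rho$ on $\mathcal X\times\mathbb R^d$ with marginal $\rho_{\mathcal X}$, $Y\in L^2(\rho)$, $\phi\in L^2(\rho_{\mathcal X})$, $f^*(x)=\mathbb E[Y\mid X=x]$, $f^*\in L^2(\rho_{\mathcal X})\cap L^2(\mu_\Xi)$, $\mathbb E[\|Y-f^*(X)\|^2\mid X]\le\epsilon^2$ a.s., $\mathcal R(f)=\mathbb E\|f(X)-Y\|^2$. Assume $\|\psi\|\le M<\infty$ $\rho_{\mathcal X}$-a.e. Let $\hat{\mathcal F}=\{x\mapsto W^\top\psi(x)\}$, and let $f_n=W_n^\top\psi$, where $W_n$ minimizes $\frac1n\sum_{i\le n}\|W^\top\psi(X_i)-Y_i\|^2+\gamma_n\|W\|^2$ on $n$ i.i.d. samples from $\rho$. Let $\Sigma=\mathbb E_{\rho_{\mathcal X}}[\psi\psi^\top]$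 and $k_e=\operatorname{Tr}(\Sigma(\Sigma+\gamma_n I)^{-1})$. $\Pi^{(\tau)}$ denotes $L^2(\tau)$-orthogonal projection (componentwise on $\mathbb R^d$-valued functions). **Claims.** The number $k_\lambda$ of positive eigenvalues of $T_\lambda$, with multiplicity, is finite. Let $\lambda_1\ge\dots\ge\lambda_{k_\lambda}>0$ be these eigenvalues, $f_1,\dots,f_{k_\lambda}\in\Psi$ corresponding eigenfunctions, orthonormal in $L^2(\mu_\Xi)$, $\mathcal F_l=\operatorname{span}(f_i)_{i\le l}$. Consider * (low expansion) $\|f\|^2_{L^2(\rho_{\mathcal X})}\le c_r\|f\|^2_{L^2(\mu_\Xi)}$ for all $f\in\Psi$, with $c_r>0$; * (robustness) for each $i\le k_\lambda$ the projections of $f^*$ on $f_i$ in $L^2(\mu_\Xi)$ and in $L^2(\rho_{\mathcal X})$ coincide; * (source) $f^*\in\mathcal F_{k_\lambda}$ (that is, $f^*$ is a combination of the $f_i$, $\mu_\Xi$-a.e. and $\rho_{\mathcal X}$-a.e.). In each case below there are $\gamma_n>0$ such that for every $\delta>0$ there is an $N$ (depending on all of the above data) such that for all $n>N$ the excess risk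 $\mathcal R(f_n)-\mathcal R(f^*)$ is integrable, $k_e\le k$, and the bound holds. 1. *(Simplified bound.)* Under low expansion, robustness and source, for every $k$, $$\mathbb E[\mathcal R(f_n)-\mathcal R(f^*)]\le\frac{2k_e\epsilon^2}n+\frac{\log(n)^{1+\delta}}n\|f^*\|_{L^2(\rho_{\mathcal X})}+c_r\|T_\lambda^{-1}f^*\|^2_{L^2(\mu_\Xi)}\big(\mathcal L_k(\hat\Theta;\lambda)-\mathcal L_k(\Theta_*;\lambda)\big)+(k_\lambda-k)_+\|f^*\|^2_{L^2(\rho_{\mathcal X})}.$$ 2. *(General profiles.)* Let $\zeta:\mathbb R\to\mathbb R$ be continuous and nondecreasing, $\zeta(0)=0$, $\|f\|_{L^2(\rho_{\mathcal X})}\le\zeta(\|f\|_{L^2(\mu_\Xi)})$ for $f\in\Psi$; let $\sigma$ be nondecreasing and bounded with $\|\Pi^{(\rho_{\mathcal X})}_{\mathcal F_l}f^*-\Pi^{(\mu_\Xi)}_{\mathcal F_l}f^*\|_{L^2(\rho_{\mathcal X})}\le\sigma(l)\|f^*\|_{L^2(\rho_{\mathcal X})}$ for all $l\le k_\lambda$;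 assume source. For $k\le k_\lambda$, with $a=\|(I-\Pi^{(\rho_{\mathcal X})}_{\hat{\mathcal F}})f^*\|_{L^\infty(\rho_{\mathcal X})}$ (where this is infinite, the term $64ka/n$ below may be omitted), $$\mathbb E[\mathcal R(f_n)-\mathcal R(f^*)]\le\frac{2k_e\epsilon^2}n+\frac{8M^2\log(n)^{1+\delta}}n\|f^*\|_{L^2(\rho_{\mathcal X})}+\frac{64ka}n+\inf_{l\le k}\Big\{2\|(\Pi^{(\rho_{\mathcal X})}_{\mathcal F_{k_\lambda}}-\Pi^{(\rho_{\mathcal X})}_{\mathcal F_l})f^*\|^2_{L^2(\rho_{\mathcal X})}+4\sigma(l)^2\|f^*\|^2_{L^2(\rho_{\mathcal X})}+4\sum_{j\le d}\zeta^2\Big(\|\tilde T_\lambda^{-1}\Pi^{(\mu_\Xi)}_{\mathcal F_l}f^*_j\|_{L^2(\mu_\Xi)}\big(\mathcal L_k(\hat\Theta;\lambda)-\mathcal L_k(\Theta_*;\lambda)\big)^{1/2}\Big)\Big\},$$ where $\tilde T_\lambda=\sum_{i\le k}(\lambda_i^2-\lambda_{k+1}^2)^{1/2}f_if_i^\top$,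 $\lambda_{k_\lambda+1}:=0$, and the infimum is over those $l$ with $\Pi^{(\mu_\Xi)}_{\mathcal F_l}f^*$ in the range of $\tilde T_\lambda$. 3. *(Without source.)* Let $k\le k_\lambda$, let $\hat\Theta_{\rm full}\in\mathbb R^{k_\lambda}\otimes\mathcal H$, and let $\hat\Theta$ be obtained from it by keeping the $k$ leading eigenfunctions of $S\hat\Theta_{\rm full}^\top\hat\Theta_{\rm full}S^\top$. Under low expansion and robustness, with $a$ as in 2 and $\Theta_*$ now a minimizer over $\mathbb R^{k_\lambda}\otimes\mathcal H$, $$\mathbb E[\mathcal R(f_n)-\mathcal R(f^*)]\le\frac{2k_e\epsilon^2}n+\frac{8M^2\log(n)^{1+\delta}}n\|f^*\|_{L^2(\rho_{\mathcal X})}+\frac{64ka}n+(k_\lambda-k)\|f^*\|^2_{L^2(\rho_{\mathcal X})}+2c_r\|T_\lambda^{-1}\Pi^{(\mu_\Xi)}_{\mathcal F_{k_\lambda}}f^*\|^2_{L^2(\mu_\Xi)}\big(\mathcal L_{k_\lambda}(\hat\Theta_{\rm full};\lambda)-\mathcal L_{k_\lambda}(\Theta_*;\lambda)\big)+2\|(I-\Pi^{(\mu_\Xi)}_{\mathcal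 F_{k_\lambda}})f^*\|^2_{L^2(\rho_{\mathcal X})}.$$ Moreover, for any $k$, if $\mathcal L_k(\hat\Theta;\lambda)\le\mathcal L_k(0;\lambda)$ and $\sup\|\phi\|\le\kappa$, then $\sup\|\psi\|\le\sqrt{k/(2\lambda)}\,\kappa$. -/

import Mathlib

open MeasureTheory ProbabilityTheory Filter
open scoped ENNReal RealInnerProductSpace

noncomputable section

/-! ### Augmentations -/

section Augmentations

variable {𝒳 : Type*} [MeasurableSpace 𝒳]

/-- The law of an augmented sample `ξ`: draw `X ~ μX`, then `ξ ~ aug X`. -/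
def augLaw (μX : Measure 𝒳) (aug : Kernel 𝒳 𝒳) : Measure 𝒳 := μX.bind aug

/-- The joint law of two augmentations `(ξ, ξ')` of the same input: draw `X ~ μX`, then `ξ` and
`ξ'` independently from `aug X`. -/
def pairLaw (μX : Measure 𝒳) (aug : Kernel 𝒳 𝒳) : Measure (𝒳 × 𝒳) := μX.bind (aug ×ₖ aug)

theorem pairLaw_fst (μX : Measure 𝒳) (aug : Kernel 𝒳 𝒳) [IsMarkovKernel aug] :
    MeasurePreserving Prod.fst (pairLaw μX aug) (augLaw μX aug) := by
  refine ⟨measurable_fst, ?_⟩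
  unfold pairLaw augLaw
  rw [Measure.map_comp _ _ measurable_fst, ← Kernel.fst_eq, Kernel.fst_prod]

theorem pairLaw_snd (μX : Measure 𝒳) (aug : Kernel 𝒳 𝒳) [IsMarkovKernel aug] :
    MeasurePreserving Prod.snd (pairLaw μX aug) (augLaw μX aug) := by
  refine ⟨measurable_snd, ?_⟩
  unfold pairLaw augLaw
  rw [Measure.map_comp _ _ measurable_snd, ← Kernel.snd_eq, Kernel.snd_prod]

/-- The operator `T` on `L²(μ_Ξ)`: `⟪f, T g⟫ = E_X E_{ξ, ξ'}[f(ξ) g(ξ') | X]`. -/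
def augOp (μX : Measure 𝒳) (aug : Kernel 𝒳 𝒳) [IsMarkovKernel aug] :
    Lp ℝ 2 (augLaw μX aug) →L[ℝ] Lp ℝ 2 (augLaw μX aug) :=
  (ContinuousLinearMap.adjoint
    (Lp.compMeasurePreservingₗᵢ ℝ Prod.fst (pairLaw_fst μX aug)).toContinuousLinearMap).comp
    (Lp.compMeasurePreservingₗᵢ ℝ Prod.snd (pairLaw_snd μX aug)).toContinuousLinearMap

end Augmentations

/-! ### The linear class of functions and the operators `S`, `K`, `T_λ` -/

section Operators

variable {𝒳 H : Type*} [MeasurableSpace 𝒳] [NormedAddCommGroup H] [InnerProductSpace ℝ H]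

/-- The embedding `S : H → L²(τ)`, `θ ↦ f_θ = ⟪θ, φ(·)⟫`. -/
def embed {τ : Measure 𝒳} {φ : 𝒳 → H} (hφ : MemLp φ 2 τ) : H →L[ℝ] Lp ℝ 2 τ :=
  LinearMap.mkContinuous
    { toFun := fun θ => (hφ.const_inner θ).toLp (fun x => ⟪θ, φ x⟫)
      map_add' := fun θ θ' => by
        rw [← MemLp.toLp_add]
        exact MemLp.toLp_congr _ _ (ae_of_all _ fun x => by simp [inner_add_left])
      map_smul' := fun c θ => by
        rw [RingHom.id_apply, ← MemLp.toLp_const_smul]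
        exact MemLp.toLp_congr _ _ (ae_of_all _ fun x => by simp [inner_smul_left]) }
    ‖hφ.toLp φ‖ (fun θ => by
      rw [mul_comm]
      refine Lp.norm_le_mul_norm_of_ae_le_mul ?_
      filter_upwards [MemLp.coeFn_toLp (hφ.const_inner (𝕜 := ℝ) θ), hφ.coeFn_toLp] with x h1 h2
      simp only [LinearMap.coe_mk, AddHom.coe_mk]
      rw [h1, h2]
      exact norm_inner_le_norm θ (φ x))

variable [CompleteSpace H]

/-- The operator `K = S Sᵀ` on `L²(τ)`. -/
def kernelOp {τ : Measure 𝒳} {φ : 𝒳 → H} (hφ : MemLp φ 2 τ) : Lp ℝ 2 τ →L[ℝ] Lp ℝ 2 τ :=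
  (embed hφ).comp (ContinuousLinearMap.adjoint (embed hφ))

/-- The closure in `L²(τ)` of the space `Ψ = {f_θ}`. -/
def classClosure {τ : Measure 𝒳} {φ : 𝒳 → H} (hφ : MemLp φ 2 τ) : Submodule ℝ (Lp ℝ 2 τ) :=
  (LinearMap.range (embed hφ : H →ₗ[ℝ] Lp ℝ 2 τ)).topologicalClosure

instance {τ : Measure 𝒳} {φ : 𝒳 → H} (hφ : MemLp φ 2 τ) : CompleteSpace (classClosure hφ) :=
  (Submodule.isClosed_topologicalClosure _).completeSpace_coe

/-- `K` is injective on the closure of `Ψ`, so that `K⁻¹` is well defined there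
(and is `+∞` on `ker K`, the orthogonal complement). -/
theorem kernelOp_injOn {τ : Measure 𝒳} {φ : 𝒳 → H} (hφ : MemLp φ 2 τ) {g : Lp ℝ 2 τ}
    (hg : g ∈ classClosure hφ) (h : kernelOp hφ g = 0) : g = 0 := by
  have h1 : ContinuousLinearMap.adjoint (embed hφ) g = 0 := by
    rw [← inner_self_eq_zero (𝕜 := ℝ), ContinuousLinearMap.adjoint_inner_left]
    have : embed hφ (ContinuousLinearMap.adjoint (embed hφ) g) = 0 := h
    rw [this, inner_zero_right]
  have h2 : g ∈ (classClosure hφ)ᗮ := by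
    unfold classClosure
    rw [Submodule.orthogonal_closure, Submodule.mem_orthogonal]
    rintro _ ⟨θ, rfl⟩
    change ⟪embed hφ θ, g⟫ = 0
    rw [← ContinuousLinearMap.adjoint_inner_right, h1, inner_zero_right]
  have h3 := Submodule.inner_right_of_mem_orthogonal hg h2
  exact inner_self_eq_zero.mp h3

/-- The graph of the (unbounded, self-adjoint) operator `T_λ = (1 - β) I + β T - λ K⁻¹` on the
closure of `Ψ` in `L²(μ_Ξ)`: the pairs `(f, T_λ f)` for `f = K g`, with `g` in that closure.
As `K⁻¹ = +∞` outside, `(1 - β) I + β T` acts through its compression to that closure. -/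
def regOpGraph (μX : Measure 𝒳) (aug : Kernel 𝒳 𝒳) [IsMarkovKernel aug] {φ : 𝒳 → H}
    (hφ : MemLp φ 2 (augLaw μX aug)) (β lam : ℝ) :
    Submodule ℝ (Lp ℝ 2 (augLaw μX aug) × Lp ℝ 2 (augLaw μX aug)) :=
  (classClosure hφ).map
    (((kernelOp hφ).prod
      ((((classClosure hφ).starProjection.comp
        ((1 - β) • ContinuousLinearMap.id ℝ _ + β • augOp μX aug)).comp (kernelOp hφ))
        - lam • ContinuousLinearMap.id ℝ _)) :
      Lp ℝ 2 (augLaw μX aug) →ₗ[ℝ] Lp ℝ 2 (augLaw μX aug) × Lp ℝ 2 (augLaw μX aug))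

/-- The graph of `T_λ` is the graph of a function. -/
theorem regOpGraph_functional (μX : Measure 𝒳) (aug : Kernel 𝒳 𝒳) [IsMarkovKernel aug]
    {φ : 𝒳 → H} (hφ : MemLp φ 2 (augLaw μX aug)) (β lam : ℝ)
    {h : Lp ℝ 2 (augLaw μX aug)} (hh : (0, h) ∈ regOpGraph μX aug hφ β lam) : h = 0 := by
  obtain ⟨g, hg, hgh⟩ := hh
  have h1 : kernelOp hφ g = 0 := congrArg Prod.fst hgh
  have h2 := kernelOp_injOn hφ hg h1
  have h3 := congrArg Prod.snd hgh
  rw [h2, map_zero] at h3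
  exact h3.symm

/-- The span of the eigenfunctions of `T_λ` with a positive eigenvalue. -/
def posEigenspace (μX : Measure 𝒳) (aug : Kernel 𝒳 𝒳) [IsMarkovKernel aug] {φ : 𝒳 → H}
    (hφ : MemLp φ 2 (augLaw μX aug)) (β lam : ℝ) : Submodule ℝ (Lp ℝ 2 (augLaw μX aug)) :=
  Submodule.span ℝ {f | ∃ t : ℝ, 0 < t ∧ (f, t • f) ∈ regOpGraph μX aug hφ β lam}

/-- `f_i = S θ_i`, `i < m`, are `L²(μ_Ξ)`-orthonormal eigenfunctions of `T_λ`, with positive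
eigenvalues `ev i` in decreasing order. (With `m` the dimension of the positive eigenspace
they are all of them; every eigenfunction lies in `Ψ`.) -/
structure IsPosEigensystem (μX : Measure 𝒳) (aug : Kernel 𝒳 𝒳) [IsMarkovKernel aug] {φ : 𝒳 → H}
    (hφ : MemLp φ 2 (augLaw μX aug)) (β lam : ℝ) {m : ℕ} (θ : Fin m → H) (ev : Fin m → ℝ) :
    Prop where
  orthonormal : Orthonormal ℝ (fun i => embed hφ (θ i))
  pos : ∀ i, 0 < ev i
  antitone : Antitone ev
  eigen : ∀ i, (embed hφ (θ i), ev i • embed hφ (θ i)) ∈ regOpGraph μX aug hφ β lam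

end Operators

/-! ### The pretraining loss -/

section Pretraining

variable {𝒳 H : Type*} [MeasurableSpace 𝒳] [NormedAddCommGroup H] [InnerProductSpace ℝ H]

/-- The representation `ψ = Θ φ : 𝒳 → ℝᵏ`. -/
def features (φ : 𝒳 → H) {k : ℕ} (Θ : Fin k → H) (x : 𝒳) : EuclideanSpace ℝ (Fin k) :=
  WithLp.toLp 2 (fun i => ⟪Θ i, φ x⟫)

/-- The VICReg loss
`L(ψ) = β E_X E_{ξ,ξ'}[‖ψ(ξ) - ψ(ξ')‖² | X] + ‖E_ξ[ψ(ξ) ψ(ξ)ᵀ] - I‖²` (Frobenius norm). -/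
def vicLoss (μX : Measure 𝒳) (aug : Kernel 𝒳 𝒳) (β : ℝ) {k : ℕ}
    (ψ : 𝒳 → EuclideanSpace ℝ (Fin k)) : ℝ :=
  β * ∫ p, ‖ψ p.1 - ψ p.2‖ ^ 2 ∂(pairLaw μX aug)
    + ∑ i, ∑ j, ((∫ x, ψ x i * ψ x j ∂(augLaw μX aug)) - if i = j then 1 else 0) ^ 2

/-- The regularized loss `L(SΘ; λ) = L(SΘ) + 2 λ ‖Θ‖²`, normalized so that it is minimized by the
leading eigenfunctions of `T_λ = (1 - β) I + β T - λ K⁻¹`. -/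
def regLoss (μX : Measure 𝒳) (aug : Kernel 𝒳 𝒳) (φ : 𝒳 → H) (β lam : ℝ) {k : ℕ}
    (Θ : Fin k → H) : ℝ :=
  vicLoss μX aug β (features φ Θ) + 2 * lam * ∑ i, ‖Θ i‖ ^ 2

/-- `Θ` is obtained from `Θ'` by keeping the `k` leading eigenfunctions of the learned operator
`S Θ'ᵀ Θ' Sᵀ`: an orthogonal matrix `U` makes the components of `S U Θ'` orthogonal (so that
they are eigenfunctions, with their squared norms as eigenvalues), in order of decreasing norm, and
`Θ` consists of the first `k` rows of `U Θ'`. -/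
def IsThresholding {τ : Measure 𝒳} {φ : 𝒳 → H} (hφ : MemLp φ 2 τ) {k m : ℕ} (hkm : k ≤ m)
    (Θ' : Fin m → H) (Θ : Fin k → H) : Prop :=
  ∃ U ∈ Matrix.orthogonalGroup (Fin m) ℝ,
    (∀ i j, i ≠ j →
      ⟪embed hφ (∑ a, U i a • Θ' a), embed hφ (∑ a, U j a • Θ' a)⟫ = 0) ∧
    Antitone (fun i => ‖embed hφ (∑ a, U i a • Θ' a)‖) ∧
    ∀ i : Fin k, Θ i = ∑ a, U (Fin.castLE hkm i) a • Θ' a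

end Pretraining

/-! ### Linear probing -/

section Probing

variable {𝒳 H : Type*} [MeasurableSpace 𝒳] [NormedAddCommGroup H] [InnerProductSpace ℝ H]
  {d k : ℕ}

/-- The linear probe `x ↦ Wᵀ Θ φ(x) = ∑ i, f_{Θ i}(x) W_i`, with values in `ℝᵈ`. -/
def probe (φ : 𝒳 → H) (Θ : Fin k → H) (W : Fin k → EuclideanSpace ℝ (Fin d)) (x : 𝒳) :
    EuclideanSpace ℝ (Fin d) :=
  ∑ i, ⟪Θ i, φ x⟫ • W i

theorem memLp_probe {τ : Measure 𝒳} {φ : 𝒳 → H} (hφ : MemLp φ 2 τ) (Θ : Fin k → H)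
    (W : Fin k → EuclideanSpace ℝ (Fin d)) : MemLp (probe φ Θ W) 2 τ := by
  have h : ∀ i ∈ Finset.univ, MemLp (fun x => ⟪Θ i, φ x⟫ • W i) 2 τ := fun i _ =>
    ((ContinuousLinearMap.id ℝ ℝ).smulRight (W i)).comp_memLp' (hφ.const_inner (Θ i))
  exact memLp_finsetSum Finset.univ h

/-- `W ↦ Wᵀ Θ φ` as a linear map into `L²(τ)`. -/
def probeLp {τ : Measure 𝒳} {φ : 𝒳 → H} (hφ : MemLp φ 2 τ) (Θ : Fin k → H) :
    (Fin k → EuclideanSpace ℝ (Fin d)) →ₗ[ℝ] Lp (EuclideanSpace ℝ (Fin d)) 2 τ where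
  toFun W := (memLp_probe hφ Θ W).toLp (probe φ Θ W)
  map_add' W W' := by
    rw [← MemLp.toLp_add]
    exact MemLp.toLp_congr _ _ (ae_of_all _ fun x => by
      simp [probe, smul_add, Finset.sum_add_distrib])
  map_smul' c W := by
    rw [RingHom.id_apply, ← MemLp.toLp_const_smul]
    exact MemLp.toLp_congr _ _ (ae_of_all _ fun x => by
      simp [probe, Finset.smul_sum, smul_comm c])

/-- The orthogonal projection in `L²(τ)` onto the space `{Wᵀ Θ φ}` of linear probes. -/
def probeProj {τ : Measure 𝒳} {φ : 𝒳 → H} (hφ : MemLp φ 2 τ) (Θ : Fin k → H) (d : ℕ) :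
    Lp (EuclideanSpace ℝ (Fin d)) 2 τ →L[ℝ] Lp (EuclideanSpace ℝ (Fin d)) 2 τ :=
  (LinearMap.range (probeLp (d := d) hφ Θ)).starProjection

/-- The coefficients `⟪f, f_{θ i}⟫_{L²(τ)} ∈ ℝᵈ` of an `ℝᵈ`-valued function `f`. -/
def coeffs (τ : Measure 𝒳) (φ : 𝒳 → H) (θ : Fin k → H) (f : 𝒳 → EuclideanSpace ℝ (Fin d))
    (i : Fin k) : EuclideanSpace ℝ (Fin d) :=
  ∫ x, ⟪θ i, φ x⟫ • f x ∂τ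

/-- The first `l` members of a finite family. -/
def firstOf {α : Type*} {m : ℕ} (θ : Fin m → α) (l : ℕ) (hl : l ≤ m) : Fin l → α :=
  fun i => θ (Fin.castLE hl i)

/-- The risk for the square loss. -/
def risk (ρ : Measure (𝒳 × EuclideanSpace ℝ (Fin d))) (f : 𝒳 → EuclideanSpace ℝ (Fin d)) : ℝ :=
  ∫ z, ‖f z.1 - z.2‖ ^ 2 ∂ρ

/-- `W` minimizes the regularized empirical risk
`(1/n) ∑ ‖Wᵀ ψ(X_i) - Y_i‖² + γ ‖W‖²` on the sample `z`, with `ψ = Θ φ`. -/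
def IsRidgeMinimizer (φ : 𝒳 → H) (Θ : Fin k → H) (γ : ℝ) {n : ℕ}
    (z : Fin n → 𝒳 × EuclideanSpace ℝ (Fin d)) (W : Fin k → EuclideanSpace ℝ (Fin d)) : Prop :=
  ∀ V : Fin k → EuclideanSpace ℝ (Fin d),
    (n : ℝ)⁻¹ * ∑ i, ‖probe φ Θ W (z i).1 - (z i).2‖ ^ 2 + γ * ∑ a, ‖W a‖ ^ 2 ≤
    (n : ℝ)⁻¹ * ∑ i, ‖probe φ Θ V (z i).1 - (z i).2‖ ^ 2 + γ * ∑ a, ‖V a‖ ^ 2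

/-- The covariance `Σ = E_τ[ψ(X) ψ(X)ᵀ]` of the representation `ψ = Θ φ`. -/
def featureCov (τ : Measure 𝒳) (φ : 𝒳 → H) (Θ : Fin k → H) : Matrix (Fin k) (Fin k) ℝ :=
  Matrix.of fun i j => ∫ x, ⟪Θ i, φ x⟫ * ⟪Θ j, φ x⟫ ∂τ

/-- The effective dimension `k_e = Tr(Σ (Σ + γ I)⁻¹)`. -/
def effDim (τ : Measure 𝒳) (φ : 𝒳 → H) (Θ : Fin k → H) (γ : ℝ) : ℝ :=
  (featureCov τ φ Θ * (featureCov τ φ Θ + γ • (1 : Matrix (Fin k) (Fin k) ℝ))⁻¹).trace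

/-- There is a choice of regularization `γ = γ_n > 0` such that for every `δ > 0`, from some sample
size on, the expected excess risk of the regularized empirical risk minimizer `f_n` on `n` i.i.d.
samples from `ρ` is finite and at most
`2 k_e ε² / n + A (log n)^(1+δ) / n + B / n + C`, where `k_e ≤ k`. -/
def ExcessRiskBound (ρ : Measure (𝒳 × EuclideanSpace ℝ (Fin d))) (φ : 𝒳 → H) (Θ : Fin k → H)
    (fstar : 𝒳 → EuclideanSpace ℝ (Fin d)) (ε A B C : ℝ) : Prop :=
  ∃ γ : ℕ → ℝ, (∀ n, 0 < γ n) ∧ ∀ δ : ℝ, 0 < δ → ∃ N : ℕ, ∀ n : ℕ, N < n →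
    ∀ W : (Fin n → 𝒳 × EuclideanSpace ℝ (Fin d)) → Fin k → EuclideanSpace ℝ (Fin d),
      (∀ z, IsRidgeMinimizer φ Θ (γ n) z (W z)) →
      effDim ρ.fst φ Θ (γ n) ≤ k ∧
      Integrable (fun z => risk ρ (probe φ Θ (W z)) - risk ρ fstar) (Measure.pi fun _ => ρ) ∧
      ∫ z, (risk ρ (probe φ Θ (W z)) - risk ρ fstar) ∂(Measure.pi fun _ => ρ) ≤
        2 * effDim ρ.fst φ Θ (γ n) * ε ^ 2 / n
          + A * Real.log n ^ (1 + δ) / n + B / n + C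

end Probing

/-! ### Assumptions on the downstream task -/

section Assumptions

variable {𝒳 H : Type*} [MeasurableSpace 𝒳] [NormedAddCommGroup H] [InnerProductSpace ℝ H]
  {d m : ℕ}

/-- Low expansion with constant `c`: `‖f‖²_{L²(ρ_𝒳)} ≤ c ‖f‖²_{L²(μ_Ξ)}` for all `f ∈ Ψ`. -/
def LowExpansion {μ ρX : Measure 𝒳} {φ : 𝒳 → H} (hμ : MemLp φ 2 μ) (hρ : MemLp φ 2 ρX)
    (c : ℝ) : Prop :=
  ∀ θ : H, ‖embed hρ θ‖ ^ 2 ≤ c * ‖embed hμ θ‖ ^ 2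

/-- Low expansion with profile `ζ`: `‖f‖_{L²(ρ_𝒳)} ≤ ζ(‖f‖_{L²(μ_Ξ)})` for all `f ∈ Ψ`. -/
def LowExpansionProfile {μ ρX : Measure 𝒳} {φ : 𝒳 → H} (hμ : MemLp φ 2 μ) (hρ : MemLp φ 2 ρX)
    (ζ : ℝ → ℝ) : Prop :=
  ∀ θ : H, ‖embed hρ θ‖ ≤ ζ ‖embed hμ θ‖

/-- For each `i` the projections of `f` on `f_i = f_{θ i}` in `L²(μ_Ξ)` (for unit `f_i`, this is
`⟪f, f_i⟫ f_i`) and in `L²(ρ_𝒳)` coincide. -/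
def RobustEigenfunctions (μ : Measure 𝒳) {ρX : Measure 𝒳} {φ : 𝒳 → H} (hρ : MemLp φ 2 ρX)
    (θ : Fin m → H) {f : 𝒳 → EuclideanSpace ℝ (Fin d)} (hf : MemLp f 2 ρX) : Prop :=
  ∀ i, probeProj hρ (fun _ : Fin 1 => θ i) d (hf.toLp f) =
    probeLp hρ (fun _ : Fin 1 => θ i) (fun _ => coeffs μ φ θ f i)

/-- For each `l`, the span of the first `l` eigenfunctions (orthonormal in `L²(μ_Ξ)`) is
`σ(l)`-robust to distribution shift conditionally to `f`:
`‖Π^{(ρ_𝒳)} f - Π^{(μ_Ξ)} f‖_{L²(ρ_𝒳)} ≤ σ(l) ‖f‖_{L²(ρ_𝒳)}`. -/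
def RobustProfile (μ : Measure 𝒳) {ρX : Measure 𝒳} {φ : 𝒳 → H} (hρ : MemLp φ 2 ρX)
    (θ : Fin m → H) {f : 𝒳 → EuclideanSpace ℝ (Fin d)} (hf : MemLp f 2 ρX) (σ : ℕ → ℝ) : Prop :=
  ∀ (l : ℕ) (hl : l ≤ m),
    ‖probeProj hρ (firstOf θ l hl) d (hf.toLp f)
      - probeLp hρ (firstOf θ l hl) (firstOf (coeffs μ φ θ f) l hl)‖ ≤ σ l * ‖hf.toLp f‖

/-- Source condition: `f` is a linear combination of the eigenfunctions `f_i = f_{θ i}`, as an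
element of `L²(μ_Ξ)` and of `L²(ρ_𝒳)`. -/
def SourceCondition (μ ρX : Measure 𝒳) (φ : 𝒳 → H) (θ : Fin m → H)
    (f : 𝒳 → EuclideanSpace ℝ (Fin d)) : Prop :=
  ∃ W : Fin m → EuclideanSpace ℝ (Fin d), f =ᵐ[μ] probe φ θ W ∧ f =ᵐ[ρX] probe φ θ W

/-- `‖T_λ⁻¹ Π f‖²_{L²(μ_Ξ)}`, with `Π` the projection on the span of the `f_i = f_{θ i}` and
`ev i` the eigenvalues. -/
def invNormSq {μ : Measure 𝒳} {φ : 𝒳 → H} (hμ : MemLp φ 2 μ) (θ : Fin m → H) (ev : Fin m → ℝ)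
    (f : 𝒳 → EuclideanSpace ℝ (Fin d)) : ℝ :=
  ‖probeLp hμ θ (fun i => (ev i)⁻¹ • coeffs μ φ θ f i)‖ ^ 2

/-- The eigenvalue `λ_{k+1}`, replaced by `0` if it is not positive. -/
def nextEig (ev : Fin m → ℝ) (k : ℕ) : ℝ := if h : k < m then ev ⟨k, h⟩ else 0

/-- `Π_{F_l} f` lies in the range of
`T̃_λ = ∑_{i ≤ k} (λ_i² - λ_{k+1}²)^{1/2} f_i f_iᵀ`. (Otherwise `T̃_λ⁻¹ Π_{F_l} f` is
infinite.) -/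
def TruncInvertible (μ : Measure 𝒳) (φ : 𝒳 → H) (θ : Fin m → H) (ev : Fin m → ℝ) (k l : ℕ)
    (f : 𝒳 → EuclideanSpace ℝ (Fin d)) : Prop :=
  ∀ i : Fin m, (i : ℕ) < l → ev i = nextEig ev k → coeffs μ φ θ f i = 0

/-- `‖T̃_λ⁻¹ Π_{F_l} f_j‖_{L²(μ_Ξ)}` for the `j`-th component `f_j` of `f`, with
`T̃_λ = ∑_{i ≤ k} (λ_i² - λ_{k+1}²)^{1/2} f_i f_iᵀ`. -/
def truncInvNorm {μ : Measure 𝒳} {φ : 𝒳 → H} (hμ : MemLp φ 2 μ) (θ : Fin m → H)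
    (ev : Fin m → ℝ) (k l : ℕ) (f : 𝒳 → EuclideanSpace ℝ (Fin d)) (j : Fin d) : ℝ :=
  ‖∑ i ∈ Finset.univ.filter (fun i : Fin m => (i : ℕ) < l),
    ((Real.sqrt (ev i ^ 2 - nextEig ev k ^ 2))⁻¹ * coeffs μ φ θ f i j) • embed hμ (θ i)‖

end Assumptions

end

noncomputable section

/-! Let Π be the L²(ρ_𝒳) projection onto the linear probes on ψ. The excess risk of a probe is its
squared distance to Πf* plus ‖f* - Πf*‖². Pretraining controls the second quantity, regression the
first, and the two are estimated independently.

Pretraining. Put A = (1-β)I + βT. A function Sθ is an eigenfunction of T_λ exactly when, for a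
suitable preimage θ, (SᵀAS - λ)θ = t SᵀSθ (`mem_regOpGraph_iff`); the unbounded operator is thus
replaced by a bounded quadratic form on H. That form is at most ‖A‖‖Sθ‖² - λ‖θ‖² and S is
Hilbert-Schmidt (`isCompactOperator_embed`), so its positive part is finite dimensional and its
Rayleigh quotient attains positive suprema. Consequently a complete positive eigensystem dominates
the form (`IsPosEigensystem.pencilForm_le`). Up to the constant k, the loss is ‖G‖² minus twice the
sum of the form over the features, G being their Gram matrix (`regLoss_eq_gramLoss`). This is a
low-rank approximation problem with optimal value -∑_{i≤k} λ_i². The quantitative Eckart-Young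
inequality `sum_gap_mul_norm_sq_le` says that the suboptimality of Θ bounds ∑_{i≤k} (λ_i² -
λ_{k+1}²)‖f_i - Pf_i‖², with P the projection on the span of the features. A weighted Cauchy-Schwarz
inequality turns this into the distance from combinations of the f_i to the probes, and low
expansion carries it from μ_Ξ to ρ_𝒳.

Regression. With γ_n = 1/(n+1) the ridge estimator is within C/n of Πf* in mean square, for a
constant C depending on all the data (`exists_integral_norm_probeLp_sq_le`). As Y is only square
integrable, ill-conditioned samples are handled by a leave-one-out decoupling
(`exists_integral_le_div`). Since N may depend on the data, the logarithmic term eventually exceeds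
C/n; the effective dimension and sup-norm terms then enter only through being nonnegative. If the
logarithmic term has coefficient 0, either f* = 0, and a large constant penalty makes the effective
dimension term sufficient, or ψ = 0, and there is nothing to estimate. -/

theorem eq_zero_of_forall_quadratic_nonneg {b c : ℝ}
    (h : ∀ s : ℝ, 0 ≤ 2 * s * b + s ^ 2 * c) : b = 0 := by
  have h1 := h 1
  have h2 := h (-1)
  -- The tests `s = 1` and `s = -1` add up to `0 ≤ c`; dividing by `c + 1` instead of `c` in the
  -- next test also covers `c = 0`.
  have hc : 0 < c + 1 := by linarith
  have h3 := h (-b / (c + 1))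
  have h4 : 2 * (-b / (c + 1)) * b + (-b / (c + 1)) ^ 2 * c = -(b ^ 2 * (c + 2)) / (c + 1) ^ 2 := by
    field_simp
    ring
  rw [h4, div_nonneg_iff] at h3
  have h5 : 0 < (c + 1) ^ 2 := by positivity
  have h6 : b ^ 2 * (c + 2) ≤ 0 := by
    rcases h3 with h3 | h3 <;> linarith [h3.1, h3.2]
  have h7 : b ^ 2 ≤ 0 := by nlinarith [sq_nonneg b]
  nlinarith [sq_nonneg b, pow_eq_zero_iff (two_ne_zero) |>.mp (le_antisymm h7 (sq_nonneg b))]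

/-! ### The eigenvalue problem as a quadratic form on `H`, and its low-rank approximation. -/

section Pencil

variable {H L : Type*} [NormedAddCommGroup H] [InnerProductSpace ℝ H]
  [NormedAddCommGroup L] [InnerProductSpace ℝ L]

/-- The bilinear form of `Sᵀ A S - lam I`. -/
def pencilForm (S : H →L[ℝ] L) (A : L →L[ℝ] L) (lam : ℝ) (θ η : H) : ℝ :=
  ⟪S θ, A (S η)⟫ - lam * ⟪θ, η⟫

/-- `θ` solves the generalized eigenvalue problem `(Sᵀ A S - lam I) θ = t Sᵀ S θ`. -/
def IsPencilEigen (S : H →L[ℝ] L) (A : L →L[ℝ] L) (lam t : ℝ) (θ : H) : Prop :=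
  ∀ η, pencilForm S A lam η θ = t * ⟪S η, S θ⟫

variable {S : H →L[ℝ] L} {A : L →L[ℝ] L} {lam : ℝ}

theorem pencilForm_comm (hA : ∀ f g, ⟪f, A g⟫ = ⟪g, A f⟫) (θ η : H) :
    pencilForm S A lam θ η = pencilForm S A lam η θ := by
  unfold pencilForm
  rw [hA, real_inner_comm θ η]

theorem pencilForm_add_left (a b c : H) :
    pencilForm S A lam (a + b) c = pencilForm S A lam a c + pencilForm S A lam b c := by
  simp only [pencilForm, map_add, inner_add_left]; ring

theorem pencilForm_add_right (a b c : H) :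
    pencilForm S A lam a (b + c) = pencilForm S A lam a b + pencilForm S A lam a c := by
  simp only [pencilForm, map_add, inner_add_right]; ring

theorem pencilForm_smul_left (r : ℝ) (a b : H) :
    pencilForm S A lam (r • a) b = r * pencilForm S A lam a b := by
  simp only [pencilForm, map_smul, real_inner_smul_left]; ring

theorem pencilForm_smul_right (r : ℝ) (a b : H) :
    pencilForm S A lam a (r • b) = r * pencilForm S A lam a b := by
  simp only [pencilForm, map_smul, real_inner_smul_right]; ring

theorem pencilForm_sum_left {ι : Type*} (s : Finset ι) (a : ι → H) (b : H) :
    pencilForm S A lam (∑ i ∈ s, a i) b = ∑ i ∈ s, pencilForm S A lam (a i) b := by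
  simp only [pencilForm, map_sum, sum_inner, Finset.sum_sub_distrib, Finset.mul_sum]

theorem pencilForm_sum_right {ι : Type*} (s : Finset ι) (a : H) (b : ι → H) :
    pencilForm S A lam a (∑ i ∈ s, b i) = ∑ i ∈ s, pencilForm S A lam a (b i) := by
  simp only [pencilForm, map_sum, inner_sum, Finset.sum_sub_distrib, Finset.mul_sum]

theorem pencilForm_self_le (θ : H) :
    pencilForm S A lam θ θ ≤ ‖A‖ * ‖S θ‖ ^ 2 - lam * ‖θ‖ ^ 2 := by
  unfold pencilForm
  rw [real_inner_self_eq_norm_sq]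
  have h1 : ⟪S θ, A (S θ)⟫ ≤ ‖S θ‖ * (‖A‖ * ‖S θ‖) :=
    (real_inner_le_norm _ _).trans (by gcongr; exact A.le_opNorm _)
  nlinarith

theorem IsPencilEigen.inner_eq_zero (hA : ∀ f g, ⟪f, A g⟫ = ⟪g, A f⟫) {t s : ℝ} {θ η : H}
    (hθ : IsPencilEigen S A lam t θ) (hη : IsPencilEigen S A lam s η) (hts : t ≠ s) :
    ⟪S θ, S η⟫ = 0 := by
  have h1 := hθ η
  have h2 := hη θ
  rw [pencilForm_comm hA, h2, real_inner_comm (S θ) (S η)] at h1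
  have h3 : (s - t) * ⟪S θ, S η⟫ = 0 := by linarith
  exact (mul_eq_zero.mp h3).resolve_left (sub_ne_zero.mpr hts.symm)

/-- Eigenvectors with different eigenvalues have orthogonal images under `S`, and for equal
eigenvalues `√t * √t = t`. Scaling each term by the root of its eigenvalue therefore turns the form
into a square `‖S ·‖²`, without choosing an orthogonal basis. -/
theorem pencilForm_nonneg_of_mem_span (hA : ∀ f g, ⟪f, A g⟫ = ⟪g, A f⟫) {θ : H}
    (hθ : θ ∈ Submodule.span ℝ {θ | ∃ t : ℝ, 0 < t ∧ IsPencilEigen S A lam t θ}) :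
    0 ≤ pencilForm S A lam θ θ := by
  obtain ⟨n, c, g, rfl⟩ := Submodule.mem_span_set'.mp hθ
  choose t ht hg using fun i => (g i).2
  have h : pencilForm S A lam (∑ i, c i • (g i : H)) (∑ i, c i • (g i : H))
      = ⟪S (∑ i, (c i * √(t i)) • (g i : H)), S (∑ i, (c i * √(t i)) • (g i : H))⟫ := by
    rw [pencilForm_sum_left, map_sum, sum_inner]
    refine Finset.sum_congr rfl fun i _ => ?_
    rw [pencilForm_sum_right, inner_sum]
    refine Finset.sum_congr rfl fun j _ => ?_
    rw [pencilForm_smul_left, pencilForm_smul_right, hg j, map_smul, map_smul,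
      real_inner_smul_left, real_inner_smul_right]
    by_cases hij : t i = t j
    · have : √(t i) * √(t j) = t j := by rw [hij]; exact Real.mul_self_sqrt (ht j).le
      calc _ = c i * c j * ⟪S (g i), S (g j)⟫ * t j := by ring
        _ = c i * c j * ⟪S (g i), S (g j)⟫ * (√(t i) * √(t j)) := by rw [this]
        _ = _ := by ring
    · rw [(hg i).inner_eq_zero hA (hg j) hij]; ring
  rw [h]
  exact real_inner_self_nonneg

theorem exists_subseq_tendsto_of_isCompactOperator (hS : IsCompactOperator S) {x : ℕ → H} {R : ℝ}
    (hx : ∀ n, ‖x n‖ ≤ R) :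
    ∃ y : L, ∃ f : ℕ → ℕ, StrictMono f ∧ Tendsto (fun n => S (x (f n))) atTop (nhds y) := by
  have hc := IsCompactOperator.isCompact_closure_image_closedBall (𝕜₁ := ℝ) (f := (S : H →ₗ[ℝ] L))
    hS R
  obtain ⟨y, -, f, hf, hy⟩ := hc.tendsto_subseq (x := fun n => S (x n))
    (fun n => subset_closure ⟨x n, by simpa using hx n, rfl⟩)
  exact ⟨y, f, hf, hy⟩

/-- On the span the form is nonnegative, hence `lam * ‖θ‖² ≤ ‖A‖ * ‖S θ‖²`. An infinite-dimensional
span would contain a bounded sequence with mutual distances at least 1; compactness of `S` makes the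
images of a subsequence Cauchy, which contradicts this inequality. -/
theorem finiteDimensional_span_pencilEigen (hA : ∀ f g, ⟪f, A g⟫ = ⟪g, A f⟫)
    (hS : IsCompactOperator S) (hlam : 0 < lam) :
    FiniteDimensional ℝ (Submodule.span ℝ {θ | ∃ t : ℝ, 0 < t ∧ IsPencilEigen S A lam t θ}) := by
  by_contra hfin
  obtain ⟨R, f, -, hfR, hfs⟩ := exists_seq_norm_le_one_le_norm_sub (𝕜 := ℝ) hfin
  obtain ⟨y, u, hu, hy⟩ := exists_subseq_tendsto_of_isCompactOperator hS (x := fun n => (f n : H))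
    (R := R) hfR
  have hcauchy := hy.cauchySeq
  have hlow : ∀ m n, m ≠ n → lam ≤ ‖A‖ * ‖S (f m) - S (f n)‖ ^ 2 := by
    intro m n hmn
    have h1 := pencilForm_nonneg_of_mem_span hA (f m - f n).2
    have h2 := pencilForm_self_le (S := S) (A := A) (lam := lam) ((f m - f n : _) : H)
    have h3 : 1 ≤ ‖((f m - f n : _) : H)‖ := hfs hmn
    rw [Submodule.coe_sub, map_sub] at h2
    rw [Submodule.coe_sub] at h3 h1
    have h4 : 1 ≤ ‖(f m : H) - f n‖ ^ 2 := one_le_pow₀ h3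
    nlinarith
  have hlim : Tendsto (fun n => ‖A‖ * ‖S (f (u (n + 1))) - S (f (u n))‖ ^ 2) atTop (nhds 0) := by
    have h := ((hy.comp (tendsto_add_atTop_nat 1)).sub hy).norm.pow 2 |>.const_mul ‖A‖
    simpa using h
  have := ge_of_tendsto' hlim fun n => hlow (u (n + 1)) (u n) (hu (Nat.lt_succ_self n)).ne'
  linarith

/-- Maximization of the Rayleigh quotient on the orthogonal complement of known eigenvectors. -/
theorem exists_pencilEigen_of_pos [CompleteSpace H] (hA : ∀ f g, ⟪f, A g⟫ = ⟪g, A f⟫)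
    (hS : IsCompactOperator S) (hlam : 0 < lam) {m : ℕ} {θ : Fin m → H} {ev : Fin m → ℝ}
    (horth : Orthonormal ℝ fun i => S (θ i)) (heig : ∀ i, IsPencilEigen S A lam (ev i) (θ i))
    {η : H} (hη : ∀ i, ⟪S η, S (θ i)⟫ = 0) (hpos : 0 < pencilForm S A lam η η) :
    ∃ t : ℝ, 0 < t ∧ ∃ ϑ : H, IsPencilEigen S A lam t ϑ ∧ S ϑ ≠ 0 ∧
      ∀ i, ⟪S ϑ, S (θ i)⟫ = 0 := by
  set Q : H → ℝ := fun x => pencilForm S A lam x x with hQ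
  set Z : Set ℝ := Q '' {x | (∀ i, ⟪S x, S (θ i)⟫ = 0) ∧ ‖S x‖ = 1} with hZ
  have hscale : ∀ (r : ℝ) x, Q (r • x) = r ^ 2 * Q x := by
    intro r x
    simp only [hQ, pencilForm_smul_left, pencilForm_smul_right]; ring
  have hbdd : BddAbove Z := by
    refine ⟨‖A‖, ?_⟩
    rintro _ ⟨x, ⟨-, hx⟩, rfl⟩
    have := pencilForm_self_le (S := S) (A := A) (lam := lam) x
    rw [hx] at this
    simp only [hQ]
    nlinarith [sq_nonneg ‖x‖]
  have hnorm : ∀ x, S x ≠ 0 → (∀ i, ⟪S x, S (θ i)⟫ = 0) → (‖S x‖⁻¹) ^ 2 * Q x ∈ Z := by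
    intro x hx hxi
    refine ⟨‖S x‖⁻¹ • x, ⟨fun i => ?_, ?_⟩, hscale _ _⟩
    · rw [map_smul, real_inner_smul_left, hxi, mul_zero]
    · rw [map_smul, norm_smul, norm_inv, norm_norm, inv_mul_cancel₀ (norm_ne_zero_iff.mpr hx)]
  -- Vectors in the kernel of `S` cannot be normalized by `‖S x‖`, but the form is nonpositive on
  -- them, so the supremum over normalized vectors still controls everything.
  have hker : ∀ x, S x = 0 → Q x ≤ 0 := by
    intro x hx
    have := pencilForm_self_le (S := S) (A := A) (lam := lam) x
    rw [hx] at this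
    simp only [hQ]
    simp at this
    nlinarith [sq_nonneg ‖x‖]
  have hη0 : S η ≠ 0 := fun h => absurd (hker η h) (not_le.mpr hpos)
  have hne : Z.Nonempty := ⟨_, hnorm η hη0 hη⟩
  set t := sSup Z with ht
  have htpos : 0 < t := by
    refine lt_of_lt_of_le ?_ (le_csSup hbdd (hnorm η hη0 hη))
    have : 0 < ‖S η‖ := norm_pos_iff.mpr hη0
    positivity
  have hmax : ∀ x, (∀ i, ⟪S x, S (θ i)⟫ = 0) → Q x ≤ t * ‖S x‖ ^ 2 := by
    intro x hx
    by_cases h0 : S x = 0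
    · simpa [h0] using hker x h0
    · have h1 := le_csSup hbdd (hnorm x h0 hx)
      have h2 : 0 < ‖S x‖ := norm_pos_iff.mpr h0
      rw [inv_pow, inv_mul_le_iff₀ (by positivity)] at h1
      rw [ht]; linarith
  obtain ⟨q, -, hqt, hqZ⟩ := exists_seq_tendsto_sSup hne hbdd
  choose x hx hxq using hqZ
  have hbound : ∃ R, ∀ n, ‖x n‖ ≤ R := by
    obtain ⟨c, hc⟩ := hqt.bddBelow_range
    refine ⟨√((‖A‖ - c) / lam), fun n => Real.le_sqrt_of_sq_le ?_⟩
    have h1 := pencilForm_self_le (S := S) (A := A) (lam := lam) (x n)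
    have h2 : c ≤ Q (x n) := by rw [hxq]; exact hc ⟨n, rfl⟩
    rw [(hx n).2] at h1
    rw [le_div_iff₀ hlam]
    simp only [hQ] at h2
    linarith
  obtain ⟨R, hR⟩ := hbound
  obtain ⟨y, u, hu, hy⟩ := exists_subseq_tendsto_of_isCompactOperator hS hR
  set w : ℕ → H := fun n => x (u n) with hw
  have hwQ : Tendsto (fun n => t - Q (w n)) atTop (nhds 0) := by
    have h := (hqt.comp hu.tendsto_atTop).const_sub t
    rw [← ht, sub_self] at h
    refine h.congr fun n => ?_
    simp only [Function.comp, hw, hxq]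
  -- Parallelogram law for `Q`: the sum `w n + w k` is bounded above by the supremum `t`, and the
  -- difference by `pencilForm_self_le`, whose term in `lam` is coercive. A maximizing sequence with
  -- convergent images is thus Cauchy in `H` itself.
  have hkey : ∀ n k, lam * ‖w n - w k‖ ^ 2 ≤
      2 * (t - Q (w n)) + 2 * (t - Q (w k)) + ‖A‖ * ‖S (w n) - S (w k)‖ ^ 2 := by
    intro n k
    have h1 := hmax (w n + w k) fun i => by
      rw [map_add, inner_add_left, (hx _).1, (hx _).1, add_zero]
    have h2 := pencilForm_self_le (S := S) (A := A) (lam := lam) (w n - w k)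
    have h3 : Q (w n + w k) + pencilForm S A lam (w n - w k) (w n - w k)
        = 2 * Q (w n) + 2 * Q (w k) := by
      simp only [hQ, pencilForm, map_add, map_sub, inner_add_left, inner_add_right,
        inner_sub_left, inner_sub_right]
      ring
    have h4 : ‖S (w n + w k)‖ ^ 2 + ‖S (w n) - S (w k)‖ ^ 2 = 4 := by
      have := parallelogram_law_with_norm ℝ (S (w n)) (S (w k))
      have e1 : ‖S (w n)‖ = 1 := (hx _).2
      have e2 : ‖S (w k)‖ = 1 := (hx _).2
      rw [e1, e2] at this
      rw [map_add]; linarith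
    rw [map_sub] at h2
    nlinarith [sq_nonneg ‖S (w n) - S (w k)‖, mul_nonneg htpos.le (sq_nonneg ‖S (w n) - S (w k)‖)]
  have hwc : CauchySeq w := by
    rw [Metric.cauchySeq_iff]
    intro ε hε
    have hδ : 0 < lam * ε ^ 2 / 8 := by positivity
    have hSc := Metric.cauchySeq_iff.mp hy.cauchySeq (√(lam * ε ^ 2 / (8 * (‖A‖ + 1))))
      (by positivity)
    obtain ⟨N1, hN1⟩ := hSc
    obtain ⟨N2, hN2⟩ := eventually_atTop.mp (hwQ.eventually (gt_mem_nhds hδ))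
    refine ⟨max N1 N2, fun n hn k hk => ?_⟩
    have h1 := hkey n k
    have h2 := hN2 n (le_trans (le_max_right _ _) hn)
    have h3 := hN2 k (le_trans (le_max_right _ _) hk)
    have h4 := hN1 n (le_trans (le_max_left _ _) hn) k (le_trans (le_max_left _ _) hk)
    rw [dist_eq_norm] at h4 ⊢
    have h5 : ‖S (w n) - S (w k)‖ ^ 2 < lam * ε ^ 2 / (8 * (‖A‖ + 1)) := by
      rw [← Real.lt_sqrt (norm_nonneg _)]; exact h4
    rw [lt_div_iff₀ (by positivity)] at h5
    have h6 : ‖A‖ * ‖S (w n) - S (w k)‖ ^ 2 ≤ lam * ε ^ 2 / 8 := by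
      nlinarith [sq_nonneg ‖S (w n) - S (w k)‖]
    have h7 : lam * ‖w n - w k‖ ^ 2 < lam * ε ^ 2 := by linarith [h1, h2, h3, h6]
    have h8 : ‖w n - w k‖ ^ 2 < ε ^ 2 := lt_of_mul_lt_mul_left h7 hlam.le
    exact lt_of_pow_lt_pow_left₀ 2 hε.le h8
  obtain ⟨ϑ, hϑ⟩ := cauchySeq_tendsto_of_complete hwc
  have hSϑ : Tendsto (fun n => S (w n)) atTop (nhds (S ϑ)) := (S.continuous.tendsto ϑ).comp hϑ
  have hn1 : ‖S ϑ‖ = 1 := by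
    refine tendsto_nhds_unique hSϑ.norm ?_
    simp only [hw, (hx _).2]
    exact tendsto_const_nhds
  have hort : ∀ i, ⟪S ϑ, S (θ i)⟫ = 0 := by
    intro i
    refine tendsto_nhds_unique (hSϑ.inner tendsto_const_nhds) ?_
    simp only [hw, (hx _).1]
    exact tendsto_const_nhds
  have hQc : Continuous Q := by
    simp only [hQ, pencilForm]; fun_prop
  have hQϑ : Q ϑ = t := by
    have h := ((hQc.tendsto ϑ).comp hϑ).const_sub t
    have := tendsto_nhds_unique h hwQ
    linarith
  -- First variation: `t * ‖S ·‖² - Q` is nonnegative along `ϑ + s • v` and vanishes at `s = 0`, so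
  -- its linear coefficient in `s` is zero.
  have hV : ∀ v, (∀ i, ⟪S v, S (θ i)⟫ = 0) → pencilForm S A lam v ϑ = t * ⟪S v, S ϑ⟫ := by
    intro v hv
    have : t * ⟪S v, S ϑ⟫ - pencilForm S A lam v ϑ = 0 := by
      refine eq_zero_of_forall_quadratic_nonneg (c := t * ‖S v‖ ^ 2 - Q v) fun s => ?_
      have h1 := hmax (ϑ + s • v) fun i => by
        rw [map_add, map_smul, inner_add_left, real_inner_smul_left, hort, hv]; ring
      have h2 : Q (ϑ + s • v) = Q ϑ + 2 * s * pencilForm S A lam v ϑ + s ^ 2 * Q v := by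
        simp only [hQ, pencilForm_add_left, pencilForm_add_right, pencilForm_smul_left,
          pencilForm_smul_right, pencilForm_comm hA ϑ v]
        ring
      have h3 : ‖S (ϑ + s • v)‖ ^ 2 = 1 + 2 * s * ⟪S v, S ϑ⟫ + s ^ 2 * ‖S v‖ ^ 2 := by
        rw [map_add, map_smul, norm_add_sq_real, real_inner_smul_right, norm_smul, hn1,
          real_inner_comm, mul_pow, Real.norm_eq_abs, sq_abs]
        ring
      rw [h2, h3, hQϑ] at h1
      linarith
    linarith
  refine ⟨t, htpos, ϑ, fun ζ => ?_, fun h => by rw [h, norm_zero] at hn1; exact zero_ne_one hn1,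
    hort⟩
  -- The first variation covers only directions orthogonal to the known eigenvectors. On the
  -- remaining component `p` both sides of the eigenvalue equation vanish.
  set p := ∑ i, ⟪S ζ, S (θ i)⟫ • θ i with hp
  have hSp : ∀ i, ⟪S p, S (θ i)⟫ = ⟪S ζ, S (θ i)⟫ := by
    intro i
    rw [hp, map_sum]
    simp only [map_smul]
    rw [horth.inner_left_fintype]
    rfl
  have hv := hV (ζ - p) fun i => by rw [map_sub, inner_sub_left, hSp, sub_self]
  have hpz : ⟪S p, S ϑ⟫ = 0 := by
    rw [hp, map_sum, sum_inner]
    refine Finset.sum_eq_zero fun i _ => ?_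
    rw [map_smul, real_inner_smul_left, real_inner_comm (S ϑ), hort, mul_zero]
  have hpB : pencilForm S A lam p ϑ = 0 := by
    rw [hp, pencilForm_sum_left]
    refine Finset.sum_eq_zero fun i _ => ?_
    rw [pencilForm_smul_left, pencilForm_comm hA, heig i, hort, mul_zero, mul_zero]
  have e1 : ζ = (ζ - p) + p := (sub_add_cancel _ _).symm
  rw [e1, pencilForm_add_left, map_add, inner_add_left, hv, hpz, hpB]
  ring

/-- Subtract from `η` its component `p` along the eigenvectors: the eigenvalue equation kills the
cross term, the form at `p` is the right-hand side, and the orthogonal remainder contributes a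
nonpositive amount. -/
theorem pencilForm_le_of_maximal (hA : ∀ f g, ⟪f, A g⟫ = ⟪g, A f⟫)
    {m : ℕ} {θ : Fin m → H} {ev : Fin m → ℝ}
    (horth : Orthonormal ℝ fun i => S (θ i)) (heig : ∀ i, IsPencilEigen S A lam (ev i) (θ i))
    (hmax : ∀ η, (∀ i, ⟪S η, S (θ i)⟫ = 0) → pencilForm S A lam η η ≤ 0) (η : H) :
    pencilForm S A lam η η ≤ ∑ i, ev i * ⟪S η, S (θ i)⟫ ^ 2 := by
  set p := ∑ i, ⟪S η, S (θ i)⟫ • θ i with hp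
  have hSp : ∀ i, ⟪S p, S (θ i)⟫ = ⟪S η, S (θ i)⟫ := by
    intro i
    rw [hp, map_sum]
    simp only [map_smul]
    rw [horth.inner_left_fintype]
    rfl
  have hz : ∀ i, ⟪S (η - p), S (θ i)⟫ = 0 := fun i => by
    rw [map_sub, inner_sub_left, hSp, sub_self]
  have hvp : pencilForm S A lam (η - p) p = 0 := by
    conv_lhs => rw [hp, pencilForm_sum_right]
    refine Finset.sum_eq_zero fun i _ => ?_
    rw [pencilForm_smul_right, heig i, ← hp, hz, mul_zero, mul_zero]
  have hpp : pencilForm S A lam p p = ∑ i, ev i * ⟪S η, S (θ i)⟫ ^ 2 := by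
    conv_lhs => rw [hp, pencilForm_sum_right]
    refine Finset.sum_congr rfl fun i _ => ?_
    rw [pencilForm_smul_right, heig i, ← hp, hSp]
    ring
  have e : pencilForm S A lam η η = pencilForm S A lam (η - p) (η - p)
      + 2 * pencilForm S A lam (η - p) p + pencilForm S A lam p p := by
    conv_lhs => rw [← sub_add_cancel η p]
    rw [pencilForm_add_left, pencilForm_add_right, pencilForm_add_right,
      pencilForm_comm hA p (η - p)]
    ring
  rw [e, hvp, hpp]
  linarith [hmax _ hz]

/-! ### A quantitative Eckart-Young inequality for the loss. -/

theorem sum_inner_mul_inner_nonneg {E F ι : Type*} [NormedAddCommGroup E] [InnerProductSpace ℝ E]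
    [NormedAddCommGroup F] [InnerProductSpace ℝ F] [Fintype ι] (x : ι → E) (y : ι → F) :
    0 ≤ ∑ a, ∑ b, ⟪x a, x b⟫ * ⟪y a, y b⟫ := by
  set V := Submodule.span ℝ (Set.range x)
  have hfin : FiniteDimensional ℝ V := FiniteDimensional.span_of_finite ℝ (Set.finite_range x)
  set u := stdOrthonormalBasis ℝ V
  set x' : ι → V := fun a => ⟨x a, Submodule.subset_span ⟨a, rfl⟩⟩
  have hx : ∀ a b, ⟪x a, x b⟫ = ∑ c, ⟪x' a, u c⟫ * ⟪u c, x' b⟫ := fun a b => by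
    rw [u.sum_inner_mul_inner]; rfl
  -- Schur's product argument: expanding the `x a` in an orthonormal basis of their span writes the
  -- double sum as a sum of squared norms of combinations of the `y a`.
  have h : ∑ a, ∑ b, ⟪x a, x b⟫ * ⟪y a, y b⟫
      = ∑ c, ⟪∑ a, ⟪u c, x' a⟫ • y a, ∑ a, ⟪u c, x' a⟫ • y a⟫ := by
    simp only [hx, Finset.sum_mul, sum_inner, inner_sum, real_inner_smul_left,
      real_inner_smul_right]
    refine ((Finset.sum_congr rfl fun a _ => Finset.sum_comm).trans Finset.sum_comm).trans ?_
    refine Finset.sum_congr rfl fun c _ => Finset.sum_congr rfl fun a _ =>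
      Finset.sum_congr rfl fun b _ => ?_
    rw [real_inner_comm (u c) (x' _), real_inner_comm (y a) (y b)]
    ring
  rw [h]
  exact Finset.sum_nonneg fun c _ => real_inner_self_nonneg

/-- The loss `‖G‖² - 2 ∑ a, ⟪Θ a, (Sᵀ A S - lam) Θ a⟫`, with `G` the Gram matrix of `S Θ`. -/
def gramLoss (S : H →L[ℝ] L) (A : L →L[ℝ] L) (lam : ℝ) {k : ℕ} (Θ : Fin k → H) : ℝ :=
  ∑ a, ∑ b, ⟪S (Θ a), S (Θ b)⟫ ^ 2 - 2 * ∑ a, pencilForm S A lam (Θ a) (Θ a)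

instance hasOrthogonalProjection_span_range {k : ℕ} (ψ : Fin k → L) :
    (Submodule.span ℝ (Set.range ψ)).HasOrthogonalProjection := by
  have : FiniteDimensional ℝ (Submodule.span ℝ (Set.range ψ)) :=
    FiniteDimensional.span_of_finite ℝ (Set.finite_range ψ)
  infer_instance

/-- Let `N = ∑ ψ_a ⊗ ψ_a`, whose range lies in `F`. Expand `‖ev_i P f_i - N f_i‖² ≥ 0` and sum over
`i`: the cross terms `⟪P f_i, N f_i⟫ = ∑ ⟪ψ_a, f_i⟫²` dominate the form through `hQ`, and `∑ ‖N
f_i‖²` is at most the squared Hilbert-Schmidt norm of `N`, which is that of the Gram matrix. -/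
theorem neg_sum_sq_le_gramLoss {m k : ℕ} {f : Fin m → L} {ev : Fin m → ℝ} (hf : Orthonormal ℝ f)
    (hQ : ∀ η, pencilForm S A lam η η ≤ ∑ i, ev i * ⟪S η, f i⟫ ^ 2) (Θ : Fin k → H) :
    -∑ i, ev i ^ 2 *
      ‖(Submodule.span ℝ (Set.range fun a => S (Θ a))).starProjection (f i)‖ ^ 2
      ≤ gramLoss S A lam Θ := by
  set ψ : Fin k → L := fun a => S (Θ a) with hψ
  set F := Submodule.span ℝ (Set.range ψ) with hF
  set N : L → L := fun g => ∑ a, ⟪ψ a, g⟫ • ψ a with hN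
  have hNF : ∀ g, N g ∈ F := fun g =>
    Submodule.sum_mem _ fun a _ => Submodule.smul_mem _ _ (Submodule.subset_span ⟨a, rfl⟩)
  have hinner : ∀ i, ⟪F.starProjection (f i), N (f i)⟫ = ∑ a, ⟪ψ a, f i⟫ ^ 2 := by
    intro i
    rw [Submodule.inner_starProjection_left_eq_right, Submodule.starProjection_eq_self_iff.mpr (hNF _)]
    simp only [hN, inner_sum, real_inner_smul_right]
    exact Finset.sum_congr rfl fun a _ => by rw [real_inner_comm (ψ a)]; ring
  have hNN : ∀ i, ‖N (f i)‖ ^ 2 = ∑ a, ∑ b, ⟪ψ a, ψ b⟫ * (⟪ψ a, f i⟫ * ⟪ψ b, f i⟫) := by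
    intro i
    rw [← real_inner_self_eq_norm_sq]
    simp only [hN, inner_sum, sum_inner, real_inner_smul_right, real_inner_smul_left]
    rw [Finset.sum_comm]
    exact Finset.sum_congr rfl fun a _ => Finset.sum_congr rfl fun b _ => by ring
  have hbessel : ∑ i, ‖N (f i)‖ ^ 2 ≤ ∑ a, ∑ b, ⟪ψ a, ψ b⟫ ^ 2 := by
    -- Bessel's inequality for `N`, as positivity of the Gram matrix of `ψ` paired with that of the
    -- components of `ψ` orthogonal to the `f i`.
    have h := sum_inner_mul_inner_nonneg ψ fun a => ψ a - ∑ i, ⟪ψ a, f i⟫ • f i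
    have hy : ∀ a b, ⟪ψ a - ∑ i, ⟪ψ a, f i⟫ • f i, ψ b - ∑ i, ⟪ψ b, f i⟫ • f i⟫
        = ⟪ψ a, ψ b⟫ - ∑ i, ⟪ψ a, f i⟫ * ⟪ψ b, f i⟫ := by
      intro a b
      rw [inner_sub_left, inner_sub_right, inner_sub_right, hf.inner_sum]
      simp only [inner_sum, sum_inner, real_inner_smul_right, real_inner_smul_left, conj_trivial,
        real_inner_comm (ψ b) (f _)]
      have : ∑ i, ⟪ψ b, f i⟫ * ⟪ψ a, f i⟫ = ∑ i, ⟪ψ a, f i⟫ * ⟪ψ b, f i⟫ :=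
        Finset.sum_congr rfl fun i _ => mul_comm _ _
      rw [this]; ring
    simp only [hy, mul_sub, Finset.sum_sub_distrib] at h
    have h2 : ∑ i, ‖N (f i)‖ ^ 2
        = ∑ a, ∑ b, ⟪ψ a, ψ b⟫ * ∑ i, ⟪ψ a, f i⟫ * ⟪ψ b, f i⟫ := by
      simp only [hNN, Finset.mul_sum]
      rw [Finset.sum_comm]
      refine Finset.sum_congr rfl fun a _ => ?_
      rw [Finset.sum_comm]
    rw [h2]
    simp only [pow_two]
    linarith
  have hsq : ∀ i, 0 ≤ ev i ^ 2 * ‖F.starProjection (f i)‖ ^ 2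
      - 2 * (ev i * ∑ a, ⟪ψ a, f i⟫ ^ 2) + ‖N (f i)‖ ^ 2 := by
    intro i
    have h := norm_sub_sq_real (ev i • F.starProjection (f i)) (N (f i))
    rw [norm_smul, real_inner_smul_left, hinner, mul_pow, Real.norm_eq_abs, sq_abs] at h
    rw [← h]
    positivity
  have hsum := Finset.sum_nonneg fun i (_ : i ∈ Finset.univ) => hsq i
  rw [Finset.sum_add_distrib, Finset.sum_sub_distrib, ← Finset.mul_sum] at hsum
  have hB : ∑ a, pencilForm S A lam (Θ a) (Θ a) ≤ ∑ i, ev i * ∑ a, ⟪ψ a, f i⟫ ^ 2 := by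
    refine (Finset.sum_le_sum fun a _ => hQ (Θ a)).trans_eq ?_
    rw [Finset.sum_comm]
    simp only [Finset.mul_sum, hψ]
  unfold gramLoss
  linarith

/-- `ev` extended by `0`. -/
def extendByZero {m : ℕ} (ev : Fin m → ℝ) (j : ℕ) : ℝ := if h : j < m then ev ⟨j, h⟩ else 0

theorem extendByZero_coe {m : ℕ} (ev : Fin m → ℝ) (i : Fin m) : extendByZero ev i = ev i := by
  simp [extendByZero]

theorem sum_extendByZero_sq {m : ℕ} (ev : Fin m → ℝ) (k : ℕ) :
    ∑ a : Fin k, extendByZero ev a ^ 2 = ∑ i : Fin m, if (i : ℕ) < k then ev i ^ 2 else 0 := by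
  rw [← Finset.sum_range fun j => extendByZero ev j ^ 2]
  have h : ∑ i : Fin m, (if (i : ℕ) < k then ev i ^ 2 else 0)
      = ∑ j ∈ Finset.range m, if j < k then extendByZero ev j ^ 2 else 0 := by
    rw [Finset.sum_range]
    simp only [extendByZero_coe]
  rw [h, ← Finset.sum_filter]
  symm
  refine Finset.sum_subset (fun j hj => ?_) fun j hj hj' => ?_
  · simp only [Finset.mem_filter, Finset.mem_range] at hj ⊢
    exact hj.2
  · simp only [Finset.mem_filter, Finset.mem_range] at hj hj'
    have : ¬ j < m := fun h => hj' ⟨h, hj⟩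
    simp [extendByZero, this]

/-- The scaled eigenvectors `√(ev i) • θ i` have diagonal Gram matrix with entries `ev i` and form
values `ev i ^ 2`; zeros fill the slots beyond `m`. This competitor bounds the minimum of the loss
from above. -/
theorem exists_gramLoss_eq {m : ℕ} {θ : Fin m → H} {ev : Fin m → ℝ} (hev : ∀ i, 0 < ev i)
    (horth : Orthonormal ℝ fun i => S (θ i)) (heig : ∀ i, IsPencilEigen S A lam (ev i) (θ i))
    (k : ℕ) : ∃ Θ : Fin k → H,
      gramLoss S A lam Θ = -∑ i : Fin m, if (i : ℕ) < k then ev i ^ 2 else 0 := by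
  refine ⟨fun a => if h : (a : ℕ) < m then √(ev ⟨a, h⟩) • θ ⟨a, h⟩ else 0, ?_⟩
  have hG : ∀ a b : Fin k, ⟪S (if h : (a : ℕ) < m then √(ev ⟨a, h⟩) • θ ⟨a, h⟩ else 0),
      S (if h : (b : ℕ) < m then √(ev ⟨b, h⟩) • θ ⟨b, h⟩ else 0)⟫
      = if a = b then extendByZero ev a else 0 := by
    intro a b
    by_cases ha : (a : ℕ) < m
    · by_cases hb : (b : ℕ) < m
      · rw [dif_pos ha, dif_pos hb, map_smul, map_smul, real_inner_smul_left, real_inner_smul_right,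
          orthonormal_iff_ite.mp horth]
        by_cases hab : a = b
        · subst hab
          simp only [if_true, mul_one, extendByZero, dif_pos ha]
          exact Real.mul_self_sqrt (hev _).le
        · have : (⟨a, ha⟩ : Fin m) ≠ ⟨b, hb⟩ := fun h => hab (Fin.ext (Fin.mk.inj_iff.mp h))
          simp [hab, this]
      · have : a ≠ b := fun h => hb (h ▸ ha)
        simp [this, hb]
    · simp only [dif_neg ha, map_zero, inner_zero_left, extendByZero, ite_self]
  have hB : ∀ a : Fin k, pencilForm S A lam
      (if h : (a : ℕ) < m then √(ev ⟨a, h⟩) • θ ⟨a, h⟩ else 0)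
      (if h : (a : ℕ) < m then √(ev ⟨a, h⟩) • θ ⟨a, h⟩ else 0) = extendByZero ev a ^ 2 := by
    intro a
    by_cases ha : (a : ℕ) < m
    · rw [dif_pos ha, pencilForm_smul_left, pencilForm_smul_right, heig ⟨a, ha⟩, extendByZero,
        dif_pos ha]
      have h1 : ⟪S (θ ⟨a, ha⟩), S (θ ⟨a, ha⟩)⟫ = 1 := by
        rw [real_inner_self_eq_norm_sq, horth.1, one_pow]
      rw [h1]
      have h2 := Real.mul_self_sqrt (hev ⟨a, ha⟩).le
      linear_combination ev ⟨a, ha⟩ * h2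
    · simp [dif_neg ha, extendByZero, pencilForm]
  unfold gramLoss
  simp only [hG, hB]
  have : ∀ a : Fin k, ∑ b, (if a = b then extendByZero ev a else 0) ^ 2 = extendByZero ev a ^ 2 := by
    intro a
    simp [ite_pow]
  simp only [this]
  rw [sum_extendByZero_sq]
  ring

/-- The sum is at most the trace of the projection, which is the dimension of the span: apply
Bessel's inequality to each vector of an orthonormal basis of it. -/
theorem sum_norm_sq_starProjection_le {m k : ℕ} {f : Fin m → L} (hf : Orthonormal ℝ f)
    (ψ : Fin k → L) :
    ∑ i, ‖(Submodule.span ℝ (Set.range ψ)).starProjection (f i)‖ ^ 2 ≤ k := by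
  set F := Submodule.span ℝ (Set.range ψ)
  have hfin : FiniteDimensional ℝ F := FiniteDimensional.span_of_finite ℝ (Set.finite_range ψ)
  set u := stdOrthonormalBasis ℝ F
  have h1 : ∀ i, ‖F.starProjection (f i)‖ ^ 2 = ∑ c, ‖⟪f i, (u c : L)⟫‖ ^ 2 := by
    intro i
    have : ‖F.starProjection (f i)‖ = ‖F.orthogonalProjectionOnto (f i)‖ := rfl
    rw [this, ← u.sum_sq_norm_inner_right]
    refine Finset.sum_congr rfl fun c _ => ?_
    rw [real_inner_comm, Submodule.inner_orthogonalProjectionOnto_eq_of_mem_right]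
  rw [Finset.sum_congr rfl fun i _ => h1 i, Finset.sum_comm]
  have h2 : ∀ c, ∑ i, ‖⟪f i, (u c : L)⟫‖ ^ 2 ≤ 1 := by
    intro c
    refine (hf.sum_inner_products_le (s := Finset.univ) (u c : L)).trans_eq ?_
    have : ‖(u c : L)‖ = 1 := u.orthonormal.1 c
    rw [this, one_pow]
  refine (Finset.sum_le_sum fun c _ => h2 c).trans ?_
  have h3 : Module.finrank ℝ F ≤ k := by
    exact (finrank_range_le_card (R := ℝ) ψ).trans_eq (Fintype.card_fin k)
  simpa using h3

/-- A quantitative version of the Eckart-Young theorem. -/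
theorem sum_gap_mul_norm_sq_le {m k : ℕ} {θ : Fin m → H} {ev : Fin m → ℝ} (hev : ∀ i, 0 < ev i)
    (hanti : Antitone ev) (horth : Orthonormal ℝ fun i => S (θ i))
    (heig : ∀ i, IsPencilEigen S A lam (ev i) (θ i))
    (hQ : ∀ η, pencilForm S A lam η η ≤ ∑ i, ev i * ⟪S η, S (θ i)⟫ ^ 2)
    (Θ Θs : Fin k → H) (hΘs : ∀ Θ' : Fin k → H, gramLoss S A lam Θs ≤ gramLoss S A lam Θ') :
    (∑ i : Fin m, if (i : ℕ) < k then (ev i ^ 2 - nextEig ev k ^ 2) *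
      ‖S (θ i) - (Submodule.span ℝ (Set.range fun a => S (Θ a))).starProjection (S (θ i))‖ ^ 2
      else 0) ≤ gramLoss S A lam Θ - gramLoss S A lam Θs := by
  set F := Submodule.span ℝ (Set.range fun a => S (Θ a))
  set p : Fin m → ℝ := fun i => ‖F.starProjection (S (θ i))‖ ^ 2 with hp
  have h1 := neg_sum_sq_le_gramLoss horth hQ Θ
  obtain ⟨Θ', hΘ'⟩ := exists_gramLoss_eq hev horth heig k
  have h2 := hΘs Θ'
  have h3 : ∑ i, p i ≤ k := sum_norm_sq_starProjection_le horth _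
  have hp0 : ∀ i, 0 ≤ p i := fun i => sq_nonneg _
  have hr : ∀ i, ‖S (θ i) - F.starProjection (S (θ i))‖ ^ 2 = 1 - p i := by
    intro i
    have h := F.norm_sq_eq_add_norm_sq_starProjection (S (θ i))
    rw [horth.1 i, Submodule.starProjection_orthogonal_val] at h
    simp only [hp]
    linarith
  rw [Finset.sum_congr rfl fun i _ => by rw [hr i]]
  set n0 := nextEig ev k with hn0
  have hn0' : 0 ≤ n0 := by
    rw [hn0]; unfold nextEig; split_ifs
    exacts [(hev _).le, le_rfl]
  have hge : ∀ i : Fin m, k ≤ (i : ℕ) → ev i ≤ n0 := by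
    intro i hi
    have hk : k < m := lt_of_le_of_lt hi i.2
    rw [hn0, nextEig, dif_pos hk]
    exact hanti hi
  -- There are `k` indices below `k` only if `k ≤ m`; for `k ≥ m` the factor `n0` is zero, so the
  -- identity holds in every case.
  have hcard : n0 ^ 2 * k = n0 ^ 2 * ∑ i : Fin m, if (i : ℕ) < k then (1 : ℝ) else 0 := by
    by_cases hk : k < m
    · congr 1
      rw [← Finset.sum_range fun j => if j < k then (1 : ℝ) else 0, ← Finset.sum_filter]
      have : (Finset.range m).filter (· < k) = Finset.range k := by
        ext j; simp; omega
      simp [this]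
    · simp [hn0, nextEig, hk]
  -- Beyond `k` the eigenvalues are at most `n0`, so projection mass placed there costs at most `n0
  -- ^ 2` per unit; the total mass `∑ p i ≤ k` then balances the indices on the two sides of `k`.
  have hterm : ∀ i : Fin m, (if (i : ℕ) < k then (ev i ^ 2 - n0 ^ 2) * (1 - p i) else 0)
      ≤ (if (i : ℕ) < k then ev i ^ 2 else 0) - ev i ^ 2 * p i
        - n0 ^ 2 * (if (i : ℕ) < k then (1 : ℝ) else 0) + n0 ^ 2 * p i := by
    intro i
    by_cases hi : (i : ℕ) < k
    · simp only [hi, if_true]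
      linarith
    · simp only [hi, if_false]
      have := hge i (not_lt.mp hi)
      have h4 : ev i ^ 2 ≤ n0 ^ 2 := pow_le_pow_left₀ (hev i).le this 2
      nlinarith [hp0 i, mul_le_mul_of_nonneg_right h4 (hp0 i)]
  refine (Finset.sum_le_sum fun i _ => hterm i).trans ?_
  rw [Finset.sum_add_distrib, Finset.sum_sub_distrib, Finset.sum_sub_distrib, ← Finset.mul_sum,
    ← Finset.mul_sum, ← hcard]
  have h5 : n0 ^ 2 * ∑ i, p i ≤ n0 ^ 2 * k := mul_le_mul_of_nonneg_left h3 (sq_nonneg _)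
  rw [hΘ'] at h2
  linarith

/-- Cauchy-Schwarz with weights: the residual of each `f i` is multiplied by `s i` and its
coefficient divided by it. A weight may vanish only where the coefficient does. -/
theorem norm_sub_starProjection_sq_le {m : ℕ} (F : Submodule ℝ L) [F.HasOrthogonalProjection]
    (f : Fin m → L) (c s : Fin m → ℝ) (hc : ∀ i, c i ≠ 0 → s i ≠ 0) :
    ‖∑ i, c i • f i - F.starProjection (∑ i, c i • f i)‖ ^ 2
      ≤ (∑ i, ((s i)⁻¹ * c i) ^ 2) * ∑ i, s i ^ 2 * ‖f i - F.starProjection (f i)‖ ^ 2 := by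
  have h1 : ∑ i, c i • f i - F.starProjection (∑ i, c i • f i)
      = ∑ i, c i • (f i - F.starProjection (f i)) := by
    simp only [map_sum, map_smul, smul_sub, Finset.sum_sub_distrib]
  have h2 : ‖∑ i, c i • (f i - F.starProjection (f i))‖
      ≤ ∑ i, |(s i)⁻¹ * c i| * (|s i| * ‖f i - F.starProjection (f i)‖) := by
    refine (norm_sum_le _ _).trans_eq (Finset.sum_congr rfl fun i _ => ?_)
    rw [norm_smul, Real.norm_eq_abs, ← mul_assoc, ← abs_mul]
    congr 2
    by_cases h : c i = 0
    · simp [h]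
    · field_simp [hc i h]
  rw [h1]
  refine (pow_le_pow_left₀ (norm_nonneg _) h2 2).trans ?_
  refine (Finset.sum_mul_sq_le_sq_mul_sq _ _ _).trans_eq ?_
  simp only [sq_abs, mul_pow]

end Pencil

/-! ### The embedding `S` and its compactness. -/

section Embed

variable {𝒳 H : Type*} [MeasurableSpace 𝒳] [NormedAddCommGroup H] [InnerProductSpace ℝ H]
  {τ : Measure 𝒳}

theorem coeFn_embed {φ : 𝒳 → H} (hφ : MemLp φ 2 τ) (θ : H) :
    embed hφ θ =ᵐ[τ] fun x => ⟪θ, φ x⟫ :=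
  MemLp.coeFn_toLp (hφ.const_inner (𝕜 := ℝ) θ)

theorem inner_embed {φ : 𝒳 → H} (hφ : MemLp φ 2 τ) (θ η : H) :
    ⟪embed hφ θ, embed hφ η⟫ = ∫ x, ⟪θ, φ x⟫ * ⟪η, φ x⟫ ∂τ := by
  rw [L2.inner_def]
  refine integral_congr_ae ?_
  filter_upwards [coeFn_embed hφ θ, coeFn_embed hφ η] with x h1 h2
  rw [h1, h2, real_inner_eq_re_inner, RCLike.inner_apply]
  simp [mul_comm]

theorem norm_embed_le {φ : 𝒳 → H} (hφ : MemLp φ 2 τ) : ‖embed hφ‖ ≤ ‖hφ.toLp φ‖ :=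
  LinearMap.mkContinuous_norm_le _ (norm_nonneg _) _

theorem embed_congr {φ φ' : 𝒳 → H} (hφ : MemLp φ 2 τ) (hφ' : MemLp φ' 2 τ) (h : φ =ᵐ[τ] φ') :
    embed hφ = embed hφ' := by
  ext1 θ
  refine Lp.ext ?_
  filter_upwards [coeFn_embed hφ θ, coeFn_embed hφ' θ, h] with x h1 h2 h3
  rw [h1, h2, h3]

theorem embed_add {φ φ' : 𝒳 → H} (hφ : MemLp φ 2 τ) (hφ' : MemLp φ' 2 τ) :
    embed (hφ.add hφ') = embed hφ + embed hφ' := by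
  ext1 θ
  refine Lp.ext ?_
  filter_upwards [coeFn_embed hφ θ, coeFn_embed hφ' θ, coeFn_embed (hφ.add hφ') θ,
    Lp.coeFn_add (embed hφ θ) (embed hφ' θ)] with x h1 h2 h3 h4
  rw [add_apply, h3, h4, Pi.add_apply, Pi.add_apply, h1, h2, inner_add_right]

theorem embed_sub {φ φ' : 𝒳 → H} (hφ : MemLp φ 2 τ) (hφ' : MemLp φ' 2 τ) :
    embed (hφ.sub hφ') = embed hφ - embed hφ' := by
  rw [eq_sub_iff_add_eq, ← embed_add]
  exact embed_congr _ _ (ae_of_all _ fun x => by simp)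

theorem continuous_embed_Lp : Continuous fun f : Lp H 2 τ => embed (Lp.memLp f) := by
  refine LipschitzWith.continuous (K := 1) (LipschitzWith.of_dist_le_mul fun f g => ?_)
  rw [dist_eq_norm, dist_eq_norm, NNReal.coe_one, one_mul, ← embed_sub]
  refine (norm_embed_le _).trans_eq ?_
  rw [MemLp.toLp_sub (Lp.memLp f) (Lp.memLp g), Lp.toLp_coeFn, Lp.toLp_coeFn]

/-- `S` is Hilbert-Schmidt, hence compact. -/
theorem isCompactOperator_embed {φ : 𝒳 → H} (hφ : MemLp φ 2 τ) : IsCompactOperator (embed hφ) := by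
  have key : ∀ f : Lp H 2 τ, IsCompactOperator (embed (Lp.memLp f)) := by
    -- For an indicator times a vector the operator has rank one. Sums preserve compactness, and so
    -- do limits of the feature map in `L²`, because the operator norm is at most the `L²` norm of
    -- the feature map.
    refine Lp.induction (by norm_num) _ (fun c s hs hμs => ?_) (fun f g hf hg _ h1 h2 => ?_) ?_
    · set e := ContinuousLinearMap.smulRight (1 : ℝ →L[ℝ] ℝ)
        (indicatorConstLp 2 hs hμs.ne (1 : ℝ))
      have h1 : embed (Lp.memLp (Lp.simpleFunc.indicatorConst 2 hs hμs.ne c : Lp H 2 τ))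
          = e.comp (innerSL ℝ c) := by
        ext1 θ
        refine Lp.ext ?_
        have e1 : ((Lp.simpleFunc.indicatorConst 2 hs hμs.ne c : Lp H 2 τ) : 𝒳 → H)
            =ᵐ[τ] s.indicator fun _ => c := by
          rw [Lp.simpleFunc.coe_indicatorConst]
          exact indicatorConstLp_coeFn
        filter_upwards [coeFn_embed (Lp.memLp
            (Lp.simpleFunc.indicatorConst 2 hs hμs.ne c : Lp H 2 τ)) θ, e1,
          indicatorConstLp_coeFn (p := 2) (hs := hs) (hμs := hμs.ne) (c := (1 : ℝ)),
          Lp.coeFn_smul (⟪c, θ⟫) (indicatorConstLp 2 hs hμs.ne (1 : ℝ))] with x h1 h2 h3 h4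
        rw [h1, h2]
        simp only [e, ContinuousLinearMap.comp_apply, ContinuousLinearMap.smulRight_apply,
          one_apply_eq_self, innerSL_apply_apply]
        rw [h4, Pi.smul_apply, h3]
        by_cases hx : x ∈ s <;> simp [hx, real_inner_comm]
      rw [h1]
      exact (isCompactOperator_of_locallyCompactSpace_rng e).comp_clm _
    · have h := h1.add h2
      have e : embed (Lp.memLp (hf.toLp f + hg.toLp g))
          = embed (Lp.memLp (hf.toLp f)) + embed (Lp.memLp (hg.toLp g)) := by
        rw [← embed_add]
        exact embed_congr _ _ (Lp.coeFn_add _ _)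
      rw [e]
      exact h
    · exact isClosed_setOfPred_isCompactOperator.preimage continuous_embed_Lp
  rw [embed_congr hφ (Lp.memLp (hφ.toLp φ)) hφ.coeFn_toLp.symm]
  exact key _

theorem embed_mem_classClosure {φ : 𝒳 → H} {hφ : MemLp φ 2 τ} (θ : H) :
    embed hφ θ ∈ classClosure hφ :=
  Submodule.le_topologicalClosure _ ⟨θ, rfl⟩

end Embed

/-! ### Symmetry of the augmentation operator. -/

section Aug

variable {𝒳 : Type*} [MeasurableSpace 𝒳] (μX : Measure 𝒳) (aug : Kernel 𝒳 𝒳) [IsMarkovKernel aug]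

theorem pairLaw_swap : MeasurePreserving Prod.swap (pairLaw μX aug) (pairLaw μX aug) := by
  refine ⟨measurable_swap, ?_⟩
  unfold pairLaw
  rw [Measure.map_comp _ _ measurable_swap, Kernel.map_prod_swap]

theorem inner_augOp (f g : Lp ℝ 2 (augLaw μX aug)) :
    ⟪f, augOp μX aug g⟫ =
      ⟪Lp.compMeasurePreservingₗᵢ ℝ Prod.fst (pairLaw_fst μX aug) f,
        Lp.compMeasurePreservingₗᵢ ℝ Prod.snd (pairLaw_snd μX aug) g⟫ := by
  unfold augOp
  rw [ContinuousLinearMap.comp_apply, ContinuousLinearMap.adjoint_inner_right]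
  rfl

/-- The two augmentations are exchangeable: the swap preserves their joint law and interchanges the
pullbacks along the two coordinates. -/
theorem inner_augOp_comm (f g : Lp ℝ 2 (augLaw μX aug)) :
    ⟪f, augOp μX aug g⟫ = ⟪g, augOp μX aug f⟫ := by
  rw [inner_augOp, inner_augOp, real_inner_comm]
  set sw := Lp.compMeasurePreservingₗᵢ (E := ℝ) (p := 2) ℝ Prod.swap (pairLaw_swap μX aug)
  rw [← LinearIsometry.inner_map_map sw]
  have h1 : sw (Lp.compMeasurePreservingₗᵢ ℝ Prod.fst (pairLaw_fst μX aug) f)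
      = Lp.compMeasurePreservingₗᵢ ℝ Prod.snd (pairLaw_snd μX aug) f :=
    (Lp.compMeasurePreserving_comp_apply _ _ _).symm
  have h2 : sw (Lp.compMeasurePreservingₗᵢ ℝ Prod.snd (pairLaw_snd μX aug) g)
      = Lp.compMeasurePreservingₗᵢ ℝ Prod.fst (pairLaw_fst μX aug) g :=
    (Lp.compMeasurePreserving_comp_apply _ _ _).symm
  rw [h1, h2]

/-- The bounded part `(1 - β) I + β T` of `T_λ`. -/
def boundedPart (β : ℝ) : Lp ℝ 2 (augLaw μX aug) →L[ℝ] Lp ℝ 2 (augLaw μX aug) :=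
  (1 - β) • ContinuousLinearMap.id ℝ _ + β • augOp μX aug

theorem inner_boundedPart (β : ℝ) (f g : Lp ℝ 2 (augLaw μX aug)) :
    ⟪f, boundedPart μX aug β g⟫ = (1 - β) * ⟪f, g⟫ + β * ⟪f, augOp μX aug g⟫ := by
  simp [boundedPart, inner_add_right, real_inner_smul_right]

theorem inner_boundedPart_comm (β : ℝ) (f g : Lp ℝ 2 (augLaw μX aug)) :
    ⟪f, boundedPart μX aug β g⟫ = ⟪g, boundedPart μX aug β f⟫ := by
  rw [inner_boundedPart, inner_boundedPart, inner_augOp_comm, real_inner_comm]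

end Aug

/-! ### The pretraining loss in terms of the quadratic form. -/

section Loss

variable {𝒳 H : Type*} [MeasurableSpace 𝒳] [NormedAddCommGroup H] [InnerProductSpace ℝ H]
  (μX : Measure 𝒳) (aug : Kernel 𝒳 𝒳) [IsMarkovKernel aug] {φ : 𝒳 → H}
  (hφ : MemLp φ 2 (augLaw μX aug))

theorem integral_sq_sub_pairLaw (θ : H) :
    Integrable (fun p : 𝒳 × 𝒳 => (⟪θ, φ p.1⟫ - ⟪θ, φ p.2⟫) ^ 2) (pairLaw μX aug) ∧
    ∫ p, (⟪θ, φ p.1⟫ - ⟪θ, φ p.2⟫) ^ 2 ∂(pairLaw μX aug)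
      = 2 * ⟪embed hφ θ, embed hφ θ⟫ - 2 * ⟪embed hφ θ, augOp μX aug (embed hφ θ)⟫ := by
  set i1 := Lp.compMeasurePreservingₗᵢ (E := ℝ) (p := 2) ℝ Prod.fst (pairLaw_fst μX aug)
  set i2 := Lp.compMeasurePreservingₗᵢ (E := ℝ) (p := 2) ℝ Prod.snd (pairLaw_snd μX aug)
  have hae : ⇑(i1 (embed hφ θ) - i2 (embed hφ θ)) =ᵐ[pairLaw μX aug]
      fun p => ⟪θ, φ p.1⟫ - ⟪θ, φ p.2⟫ := by
    filter_upwards [Lp.coeFn_sub (i1 (embed hφ θ)) (i2 (embed hφ θ)),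
      Lp.coeFn_compMeasurePreserving (embed hφ θ) (pairLaw_fst μX aug),
      Lp.coeFn_compMeasurePreserving (embed hφ θ) (pairLaw_snd μX aug),
      (pairLaw_fst μX aug).quasiMeasurePreserving.ae_eq_comp (coeFn_embed hφ θ),
      (pairLaw_snd μX aug).quasiMeasurePreserving.ae_eq_comp (coeFn_embed hφ θ)]
      with p h1 h2 h3 h4 h5
    rw [h1, Pi.sub_apply]
    change (Lp.compMeasurePreserving Prod.fst (pairLaw_fst μX aug) (embed hφ θ) : 𝒳 × 𝒳 → ℝ) p
      - (Lp.compMeasurePreserving Prod.snd (pairLaw_snd μX aug) (embed hφ θ) : 𝒳 × 𝒳 → ℝ) p = _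
    rw [h2, h3, h4, h5]
    rfl
  have hmem := (Lp.memLp (i1 (embed hφ θ) - i2 (embed hφ θ))).ae_eq hae
  refine ⟨hmem.integrable_sq, ?_⟩
  have h1 : ‖i1 (embed hφ θ) - i2 (embed hφ θ)‖ ^ 2
      = ∫ p, (⟪θ, φ p.1⟫ - ⟪θ, φ p.2⟫) ^ 2 ∂(pairLaw μX aug) := by
    rw [← real_inner_self_eq_norm_sq, L2.inner_def]
    refine integral_congr_ae ?_
    filter_upwards [hae] with p hp
    rw [hp, real_inner_self_eq_norm_sq, Real.norm_eq_abs, sq_abs]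
  rw [← h1, norm_sub_sq_real, inner_augOp, LinearIsometry.norm_map, LinearIsometry.norm_map,
    real_inner_self_eq_norm_sq]
  ring

theorem norm_sq_features {𝒳 : Type*} {φ : 𝒳 → H} {k : ℕ} (Θ : Fin k → H) (x : 𝒳) :
    ‖features φ Θ x‖ ^ 2 = ∑ a, ⟪Θ a, φ x⟫ ^ 2 := by
  rw [EuclideanSpace.norm_sq_eq]
  simp [features]

/-- The invariance term equals `2β ∑ (‖f_a‖² - ⟪f_a, T f_a⟫)`, and `‖G - I‖² = ‖G‖² - 2 tr G + k`.
Together with the penalty, everything but `‖G‖²` and `k` is `-2` times the form; the factor 2 in the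
penalty is what matches `lam` with the `λ` of `T_λ`. -/
theorem regLoss_eq_gramLoss (β lam : ℝ) {k : ℕ} (Θ : Fin k → H) :
    regLoss μX aug φ β lam Θ = k + gramLoss (embed hφ) (boundedPart μX aug β) lam Θ := by
  have h1 : ∫ p, ‖features φ Θ p.1 - features φ Θ p.2‖ ^ 2 ∂(pairLaw μX aug)
      = ∑ a, (2 * ⟪embed hφ (Θ a), embed hφ (Θ a)⟫
        - 2 * ⟪embed hφ (Θ a), augOp μX aug (embed hφ (Θ a))⟫) := by
    have : ∀ p : 𝒳 × 𝒳, ‖features φ Θ p.1 - features φ Θ p.2‖ ^ 2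
        = ∑ a, (⟪Θ a, φ p.1⟫ - ⟪Θ a, φ p.2⟫) ^ 2 := fun p => by
      rw [EuclideanSpace.norm_sq_eq]
      simp [features]
    simp only [this]
    rw [integral_finsetSum _ fun a _ => (integral_sq_sub_pairLaw μX aug hφ (Θ a)).1]
    exact Finset.sum_congr rfl fun a _ => (integral_sq_sub_pairLaw μX aug hφ (Θ a)).2
  have h2 : ∀ i j : Fin k, ∫ x, features φ Θ x i * features φ Θ x j ∂(augLaw μX aug)
      = ⟪embed hφ (Θ i), embed hφ (Θ j)⟫ := fun i j => (inner_embed hφ _ _).symm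
  have h3 : ∑ i, ∑ j, (⟪embed hφ (Θ i), embed hφ (Θ j)⟫ - if i = j then (1 : ℝ) else 0) ^ 2
      = ∑ i, ∑ j, ⟪embed hφ (Θ i), embed hφ (Θ j)⟫ ^ 2
        - 2 * ∑ i, ⟪embed hφ (Θ i), embed hφ (Θ i)⟫ + k := by
    have : ∀ i j : Fin k, (⟪embed hφ (Θ i), embed hφ (Θ j)⟫ - if i = j then (1 : ℝ) else 0) ^ 2
        = ⟪embed hφ (Θ i), embed hφ (Θ j)⟫ ^ 2
          - 2 * (if i = j then ⟪embed hφ (Θ i), embed hφ (Θ j)⟫ else 0)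
          + if i = j then 1 else 0 := by
      intro i j
      split_ifs <;> ring
    simp only [this, Finset.sum_add_distrib, Finset.sum_sub_distrib, ← Finset.mul_sum,
      Finset.sum_ite_eq, Finset.mem_univ, if_true]
    simp
  unfold regLoss vicLoss gramLoss pencilForm
  simp only [h1, h2, h3, inner_boundedPart, Finset.sum_sub_distrib, Finset.sum_add_distrib,
    ← Finset.mul_sum]
  simp only [real_inner_self_eq_norm_sq]
  ring

theorem vicLoss_nonneg (μX : Measure 𝒳) (aug : Kernel 𝒳 𝒳) {β : ℝ} (hβ : 0 ≤ β) {k : ℕ}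
    (ψ : 𝒳 → EuclideanSpace ℝ (Fin k)) :
    0 ≤ vicLoss μX aug β ψ :=
  add_nonneg (mul_nonneg hβ (integral_nonneg fun _ => sq_nonneg _))
    (Finset.sum_nonneg fun _ _ => Finset.sum_nonneg fun _ _ => sq_nonneg _)

/-- The loss at zero is `k` and the unpenalized loss is nonnegative, so `∑ ‖Θ i‖² ≤ k / (2λ)`;
Cauchy-Schwarz does the rest. -/
theorem norm_features_le (μX : Measure 𝒳) (aug : Kernel 𝒳 𝒳) {β lam κ : ℝ} (hβ : 0 ≤ β)
    (hlam : 0 < lam) {k : ℕ} {Θ : Fin k → H}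
    (hκ : ∀ x, ‖φ x‖ ≤ κ)
    (hΘ : regLoss μX aug φ β lam Θ ≤ regLoss μX aug φ β lam (0 : Fin k → H)) (x : 𝒳) :
    ‖features φ Θ x‖ ≤ √(k / (2 * lam)) * κ := by
  have h0 : regLoss μX aug φ β lam (0 : Fin k → H) = k := by
    unfold regLoss vicLoss
    simp [features]
  have h1 : ∑ i, ‖Θ i‖ ^ 2 ≤ k / (2 * lam) := by
    rw [le_div_iff₀ (by positivity)]
    rw [h0] at hΘ
    unfold regLoss at hΘ
    linarith [vicLoss_nonneg μX aug hβ (features φ Θ)]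
  have hκ0 : 0 ≤ κ := (norm_nonneg _).trans (hκ x)
  refine le_of_sq_le_sq ?_ (by positivity)
  rw [norm_sq_features, mul_pow, Real.sq_sqrt (by positivity)]
  have h2 : ∀ a, ⟪Θ a, φ x⟫ ^ 2 ≤ ‖Θ a‖ ^ 2 * κ ^ 2 := by
    intro a
    rw [← mul_pow, ← sq_abs]
    refine pow_le_pow_left₀ (abs_nonneg _) ((abs_real_inner_le_norm _ _).trans ?_) 2
    gcongr
    exact hκ x
  refine (Finset.sum_le_sum fun a _ => h2 a).trans ?_
  rw [← Finset.sum_mul]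
  gcongr

end Loss

/-! ### Eigenfunctions of `T_λ`, and what the loss gap says about them. -/

section Graph

variable {𝒳 H : Type*} [MeasurableSpace 𝒳] [NormedAddCommGroup H] [InnerProductSpace ℝ H]
  [CompleteSpace H] {μX : Measure 𝒳} {aug : Kernel 𝒳 𝒳} [IsMarkovKernel aug] {φ : 𝒳 → H}
  {hφ : MemLp φ 2 (augLaw μX aug)} {β lam : ℝ}

/-- If `f = K g`, take `θ = Sᵀ g`. Conversely the eigenvalue equation forces `g = λ⁻¹ P (A S θ - t S
θ)`, and the pencil equation tested against all `η` says precisely that `Sᵀ g = θ`. -/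
theorem mem_regOpGraph_iff (hlam : lam ≠ 0) {t : ℝ} {f : Lp ℝ 2 (augLaw μX aug)} :
    (f, t • f) ∈ regOpGraph μX aug hφ β lam ↔
      ∃ θ, embed hφ θ = f ∧ IsPencilEigen (embed hφ) (boundedPart μX aug β) lam t θ := by
  set S := embed hφ
  set A := boundedPart μX aug β
  set P := (classClosure hφ).starProjection with hP
  have hSP : ∀ η g, ⟪S η, P g⟫ = ⟪S η, g⟫ := fun η g => by
    rw [hP, ← Submodule.inner_starProjection_left_eq_right,
      Submodule.starProjection_eq_self_iff.mpr (embed_mem_classClosure η)]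
  have hmem : ∀ g : Lp ℝ 2 (augLaw μX aug), g ∈ classClosure hφ →
      ∀ h : Lp ℝ 2 (augLaw μX aug), (kernelOp hφ g, P (A (kernelOp hφ g)) - lam • g) = (f, h) →
      (f, h) ∈ regOpGraph μX aug hφ β lam := fun g hg h e => ⟨g, hg, e⟩
  constructor
  · rintro ⟨g, hg, e⟩
    have e1 : S (ContinuousLinearMap.adjoint S g) = f := congrArg Prod.fst e
    have e2 : P (A (S (ContinuousLinearMap.adjoint S g))) - lam • g = t • f := congrArg Prod.snd e
    refine ⟨ContinuousLinearMap.adjoint S g, e1, fun η => ?_⟩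
    unfold pencilForm
    rw [ContinuousLinearMap.adjoint_inner_right, ← hSP η (A _), ← real_inner_smul_right,
      ← inner_sub_right, e2, real_inner_smul_right, e1]
  · rintro ⟨θ, rfl, hθ⟩
    set g := lam⁻¹ • P (A (S θ) - t • S θ) with hg
    have hgm : g ∈ classClosure hφ :=
      Submodule.smul_mem _ _ (Submodule.starProjection_apply_mem _ _)
    have hadj : ContinuousLinearMap.adjoint S g = θ := by
      refine ext_inner_left ℝ fun η => ?_
      have h := hθ η
      unfold pencilForm at h
      rw [ContinuousLinearMap.adjoint_inner_right, hg, real_inner_smul_right, hSP, inner_sub_right,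
        real_inner_smul_right]
      field_simp
      linarith
    have hK : kernelOp hφ g = S θ := congrArg S hadj
    refine hmem g hgm _ ?_
    rw [hK, hg, smul_smul, mul_inv_cancel₀ hlam, one_smul, map_sub, map_smul,
      Submodule.starProjection_eq_self_iff.mpr (embed_mem_classClosure θ), sub_sub_cancel]

theorem posEigenspace_eq_map (hlam : lam ≠ 0) :
    posEigenspace μX aug hφ β lam = (Submodule.span ℝ
      {θ | ∃ t : ℝ, 0 < t ∧ IsPencilEigen (embed hφ) (boundedPart μX aug β) lam t θ}).map
        (embed hφ : H →ₗ[ℝ] Lp ℝ 2 (augLaw μX aug)) := by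
  unfold posEigenspace
  rw [Submodule.map_span]
  congr 1
  ext f
  constructor
  · rintro ⟨t, ht, h⟩
    obtain ⟨θ, rfl, hθ⟩ := (mem_regOpGraph_iff hlam).mp h
    exact ⟨θ, ⟨t, ht, hθ⟩, rfl⟩
  · rintro ⟨θ, ⟨t, ht, hθ⟩, rfl⟩
    exact ⟨t, ht, (mem_regOpGraph_iff hlam).mpr ⟨θ, rfl, hθ⟩⟩

theorem finiteDimensional_posEigenspace (hlam : 0 < lam) :
    FiniteDimensional ℝ (posEigenspace μX aug hφ β lam) := by
  rw [posEigenspace_eq_map hlam.ne']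
  have := finiteDimensional_span_pencilEigen (inner_boundedPart_comm μX aug β)
    (isCompactOperator_embed hφ) hlam
  infer_instance

/-- `S` may have a kernel, so `θ i` is just some preimage of the eigenfunction; the pencil equation
holds for the particular preimage `Sᵀ g`. -/
theorem IsPosEigensystem.exists_pencilEigen (hlam : lam ≠ 0) {m : ℕ} {θ : Fin m → H}
    {ev : Fin m → ℝ} (h : IsPosEigensystem μX aug hφ β lam θ ev) :
    ∃ θ' : Fin m → H, (∀ i, embed hφ (θ' i) = embed hφ (θ i)) ∧
      ∀ i, IsPencilEigen (embed hφ) (boundedPart μX aug β) lam (ev i) (θ' i) := by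
  choose θ' h1 h2 using fun i => (mem_regOpGraph_iff hlam).mp (h.eigen i)
  exact ⟨θ', h1, h2⟩

theorem IsPosEigensystem.span_eq (hlam : 0 < lam) {m : ℕ} {θ : Fin m → H} {ev : Fin m → ℝ}
    (h : IsPosEigensystem μX aug hφ β lam θ ev)
    (hm : m = Module.finrank ℝ (posEigenspace μX aug hφ β lam)) :
    Submodule.span ℝ (Set.range fun i => embed hφ (θ i)) = posEigenspace μX aug hφ β lam := by
  have := finiteDimensional_posEigenspace (μX := μX) (aug := aug) (hφ := hφ) (β := β) hlam
  refine Submodule.eq_of_le_of_finrank_eq (Submodule.span_le.mpr ?_) ?_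
  · rintro _ ⟨i, rfl⟩
    exact Submodule.subset_span ⟨ev i, h.pos i, h.eigen i⟩
  · rw [finrank_span_eq_card h.orthonormal.linearIndependent, Fintype.card_fin, hm]

/-- A positive value of the form orthogonally to the system would produce one more positive
eigenfunction orthogonal to it. But `m` orthonormal eigenfunctions already span the positive
eigenspace. -/
theorem IsPosEigensystem.pencilForm_le (hlam : 0 < lam) {m : ℕ} {θ : Fin m → H} {ev : Fin m → ℝ}
    (h : IsPosEigensystem μX aug hφ β lam θ ev)
    (hm : m = Module.finrank ℝ (posEigenspace μX aug hφ β lam)) (η : H) :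
    pencilForm (embed hφ) (boundedPart μX aug β) lam η η
      ≤ ∑ i, ev i * ⟪embed hφ η, embed hφ (θ i)⟫ ^ 2 := by
  obtain ⟨θ', h1, h2⟩ := h.exists_pencilEigen hlam.ne'
  have horth : Orthonormal ℝ fun i => embed hφ (θ' i) := by simpa only [h1] using h.orthonormal
  simp only [← h1]
  refine pencilForm_le_of_maximal (inner_boundedPart_comm μX aug β) horth h2 (fun η hη => ?_) η
  by_contra hpos
  obtain ⟨t, ht, ϑ, hϑ, hne, hperp⟩ := exists_pencilEigen_of_pos (inner_boundedPart_comm μX aug β)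
    (isCompactOperator_embed hφ) hlam horth h2 hη (not_le.mp hpos)
  have hmem : embed hφ ϑ ∈ Submodule.span ℝ (Set.range fun i => embed hφ (θ i)) := by
    rw [h.span_eq hlam hm]
    exact Submodule.subset_span ⟨t, ht, (mem_regOpGraph_iff hlam.ne').mpr ⟨ϑ, rfl, hϑ⟩⟩
  have hzero : ∀ v ∈ Submodule.span ℝ (Set.range fun i => embed hφ (θ i)),
      ⟪embed hφ ϑ, v⟫ = 0 := by
    intro v hv
    induction hv using Submodule.span_induction with
    | mem x hx => obtain ⟨i, rfl⟩ := hx; have := hperp i; rwa [h1] at this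
    | zero => exact inner_zero_right _
    | add x y _ _ hx hy => rw [inner_add_right, hx, hy, add_zero]
    | smul c x _ hx => rw [real_inner_smul_right, hx, mul_zero]
  exact hne (inner_self_eq_zero.mp (hzero _ hmem))

/-- Near-minimizers of the regularized loss span approximately the leading eigenspaces. -/
theorem IsPosEigensystem.exists_norm_sub_sq_le (hlam : 0 < lam) {m : ℕ} {θ : Fin m → H}
    {ev : Fin m → ℝ} (h : IsPosEigensystem μX aug hφ β lam θ ev)
    (hm : m = Module.finrank ℝ (posEigenspace μX aug hφ β lam)) {k : ℕ} (Θ Θs : Fin k → H)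
    (hΘs : ∀ Θ' : Fin k → H, regLoss μX aug φ β lam Θs ≤ regLoss μX aug φ β lam Θ')
    (c : Fin m → ℝ) (hc : ∀ i, c i ≠ 0 → (i : ℕ) < k ∧ ev i ≠ nextEig ev k) :
    ∃ g : Fin k → ℝ, ‖embed hφ (∑ i, c i • θ i - ∑ a, g a • Θ a)‖ ^ 2 ≤
      (∑ i, ((√(ev i ^ 2 - nextEig ev k ^ 2))⁻¹ * c i) ^ 2)
        * (regLoss μX aug φ β lam Θ - regLoss μX aug φ β lam Θs) := by
  obtain ⟨θ', h1, h2⟩ := h.exists_pencilEigen hlam.ne'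
  have hQ := h.pencilForm_le hlam hm
  have horth : Orthonormal ℝ fun i => embed hφ (θ' i) := by simpa only [h1] using h.orthonormal
  simp only [← h1] at hQ
  simp only [regLoss_eq_gramLoss μX aug hφ, add_le_add_iff_left] at hΘs
  have hgap := sum_gap_mul_norm_sq_le h.pos h.antitone horth h2 hQ Θ Θs hΘs
  simp only [h1] at hgap
  set F := Submodule.span ℝ (Set.range fun a => embed hφ (Θ a)) with hF
  have hge : ∀ i : Fin m, (i : ℕ) < k → nextEig ev k ^ 2 ≤ ev i ^ 2 ∧ 0 ≤ nextEig ev k := by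
    intro i hi
    unfold nextEig
    split_ifs with hk
    · exact ⟨pow_le_pow_left₀ (h.pos _).le (h.antitone (show i ≤ ⟨k, hk⟩ from hi.le)) 2,
        (h.pos _).le⟩
    · exact ⟨by simpa using sq_nonneg (ev i), le_rfl⟩
  -- The weights are the roots of the spectral gaps in `sum_gap_mul_norm_sq_le`. The condition on
  -- `c` excludes every index where this weight is zero, ties with the next eigenvalue included.
  set s : Fin m → ℝ := fun i => if (i : ℕ) < k then √(ev i ^ 2 - nextEig ev k ^ 2) else 0 with hs
  have hcs : ∀ i, c i ≠ 0 → s i ≠ 0 := by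
    intro i hi
    obtain ⟨hik, hne⟩ := hc i hi
    simp only [hs, hik, if_true]
    have h3 := (hge i hik).1
    refine (Real.sqrt_pos.mpr (sub_pos.mpr (lt_of_le_of_ne h3 fun e => hne ?_))).ne'
    exact ((pow_left_inj₀ (hge i hik).2 (h.pos i).le two_ne_zero).mp e).symm
  have hmain := norm_sub_starProjection_sq_le F (fun i => embed hφ (θ i)) c s hcs
  have hmem := F.starProjection_apply_mem (∑ i, c i • embed hφ (θ i))
  obtain ⟨g, hg⟩ := (Submodule.mem_span_range_iff_exists_fun ℝ).mp hmem
  refine ⟨g, ?_⟩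
  have e1 : embed hφ (∑ i, c i • θ i - ∑ a, g a • Θ a)
      = ∑ i, c i • embed hφ (θ i) - F.starProjection (∑ i, c i • embed hφ (θ i)) := by
    rw [← hg]
    simp only [map_sub, map_sum, map_smul]
  rw [e1]
  refine hmain.trans ?_
  have e2 : ∑ i, ((s i)⁻¹ * c i) ^ 2
      = ∑ i, ((√(ev i ^ 2 - nextEig ev k ^ 2))⁻¹ * c i) ^ 2 := by
    refine Finset.sum_congr rfl fun i _ => ?_
    by_cases hi : c i = 0
    · simp [hi]
    · simp only [hs, (hc i hi).1, if_true]
  rw [e2, regLoss_eq_gramLoss μX aug hφ, regLoss_eq_gramLoss μX aug hφ, add_sub_add_left_eq_sub]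
  refine mul_le_mul_of_nonneg_left ?_ (Finset.sum_nonneg fun i _ => sq_nonneg _)
  refine le_trans (le_of_eq (Finset.sum_congr rfl fun i _ => ?_)) hgap
  by_cases hi : (i : ℕ) < k
  · simp only [hs, hi, if_true]
    rw [Real.sq_sqrt (sub_nonneg.mpr (hge i hi).1)]
  · simp [hs, hi]

end Graph

/-! ### Expectations over i.i.d. samples: conditioning and decoupling. -/

section ProductSample

variable {Ω : Type*} [MeasurableSpace Ω] {ρ : Measure Ω} [IsProbabilityMeasure ρ] {d n r : ℕ}

theorem integral_sq_sum_pi {X : Ω → ℝ} (hX : MemLp X 2 ρ) (h0 : ∫ x, X x ∂ρ = 0) :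
    Integrable (fun z : Fin n → Ω => (∑ i, X (z i)) ^ 2) (Measure.pi fun _ => ρ) ∧
    ∫ z, (∑ i, X (z i)) ^ 2 ∂(Measure.pi fun _ : Fin n => ρ) = n * ∫ x, X x ^ 2 ∂ρ := by
  have hm : ∀ i ∈ (Finset.univ : Finset (Fin n)),
      MemLp (fun z : Fin n → Ω => X (z i)) 2 (Measure.pi fun _ => ρ) :=
    fun i _ => hX.comp_measurePreserving (measurePreserving_eval (fun _ : Fin n => ρ) i)
  have hs : MemLp (fun z : Fin n → Ω => ∑ i, X (z i)) 2 (Measure.pi fun _ => ρ) :=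
    memLp_finsetSum Finset.univ hm
  refine ⟨hs.integrable_sq, ?_⟩
  have h1 := variance_sum_pi (ι := Fin n) (μ := fun _ => ρ) (X := fun _ => X) fun _ => hX
  have e1 : (∑ i, fun z : Fin n → Ω => X (z i)) = fun z => ∑ i, X (z i) := by
    ext z; simp
  have h2 : ∫ z, ∑ i, X (z i) ∂(Measure.pi fun _ : Fin n => ρ) = 0 := by
    rw [integral_finsetSum _ fun i hi => (hm i hi).integrable (by norm_num)]
    refine Finset.sum_eq_zero fun i _ => ?_
    rw [integral_comp_eval (μ := fun _ : Fin n => ρ) (f := X) hX.aestronglyMeasurable, h0]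
  rw [e1, variance_of_integral_eq_zero hs.aestronglyMeasurable.aemeasurable h2,
    variance_of_integral_eq_zero hX.aestronglyMeasurable.aemeasurable h0] at h1
  rw [h1]
  simp

theorem integral_norm_sq_sum_pi {f : Ω → EuclideanSpace ℝ (Fin d)} (hf : MemLp f 2 ρ)
    (h0 : ∫ x, f x ∂ρ = 0) :
    Integrable (fun z : Fin n → Ω => ‖∑ i, f (z i)‖ ^ 2) (Measure.pi fun _ => ρ) ∧
    ∫ z, ‖∑ i, f (z i)‖ ^ 2 ∂(Measure.pi fun _ : Fin n => ρ) = n * ∫ x, ‖f x‖ ^ 2 ∂ρ := by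
  have hc : ∀ c : Fin d, MemLp (fun x => f x c) 2 ρ := fun c =>
    (EuclideanSpace.proj (𝕜 := ℝ) c).comp_memLp' hf
  have hc0 : ∀ c : Fin d, ∫ x, f x c ∂ρ = 0 := fun c => by
    have := (EuclideanSpace.proj (𝕜 := ℝ) c : EuclideanSpace ℝ (Fin d) →L[ℝ] ℝ).integral_comp_comm
      (hf.integrable (by norm_num))
    rw [h0, map_zero] at this
    exact this
  have e1 : ∀ z : Fin n → Ω, ‖∑ i, f (z i)‖ ^ 2 = ∑ c, (∑ i, f (z i) c) ^ 2 := fun z => by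
    rw [EuclideanSpace.norm_sq_eq]
    simp
  have e2 : ∀ x, ‖f x‖ ^ 2 = ∑ c, f x c ^ 2 := fun x => by
    rw [EuclideanSpace.norm_sq_eq]
    simp
  simp only [e1, e2]
  refine ⟨integrable_finsetSum _ fun c _ => (integral_sq_sum_pi (hc c) (hc0 c)).1, ?_⟩
  rw [integral_finsetSum _ fun c _ => (integral_sq_sum_pi (hc c) (hc0 c)).1,
    integral_finsetSum _ fun c _ => (hc c).integrable_sq, Finset.mul_sum]
  exact Finset.sum_congr rfl fun c _ => (integral_sq_sum_pi (hc c) (hc0 c)).2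

/-- The event that, leaving out the `i`-th sample, the empirical second moments of the features
`u a` are far from the identity. -/
def badEvent (u : Fin r → Ω → ℝ) (n : ℕ) (i : Fin n) : Set (Fin n → Ω) :=
  {z | ∃ a b, (n : ℝ) / (4 * (r + 1)) ≤
    |∑ j ∈ Finset.univ.erase i, (u a (z j) * u b (z j) - if a = b then 1 else 0)|}

theorem measurableSet_badEvent {u : Fin r → Ω → ℝ} (hu : ∀ a, Measurable (u a)) (i : Fin n) :
    MeasurableSet (badEvent u n i) := by
  simp only [badEvent, Set.ofPred_exists]
  refine MeasurableSet.iUnion fun a => MeasurableSet.iUnion fun b => ?_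
  exact measurableSet_le measurable_const (by fun_prop)

/-- Dropping the `i`-th sample only lowers the sum of squares. The other `n - 1` samples give `n -
1` times the identity plus entrywise errors of at most `n / (4 (r + 1))`, which change the quadratic
form by at most `n / 4`; and `n - 1 - n / 4 ≥ n / 2` as `4 ≤ n`. -/
theorem le_sum_norm_sq_of_notMem_badEvent {Ω : Type*} {u : Fin r → Ω → ℝ} {i : Fin n} (hn : 4 ≤ n)
    {z : Fin n → Ω} (hz : z ∉ badEvent u n i) (D : Fin r → EuclideanSpace ℝ (Fin d)) :
    (n : ℝ) / 2 * ∑ a, ‖D a‖ ^ 2 ≤ ∑ j, ‖∑ a, u a (z j) • D a‖ ^ 2 := by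
  set T := Finset.univ.erase i with hT
  set s : Fin r → Fin r → ℝ := fun a b =>
    ∑ j ∈ T, (u a (z j) * u b (z j) - if a = b then 1 else 0) with hs
  have hs' : ∀ a b, |s a b| ≤ (n : ℝ) / (4 * (r + 1)) := by
    intro a b
    by_contra hcon
    exact hz ⟨a, b, (not_le.mp hcon).le⟩
  have hcard : (T.card : ℝ) = n - 1 := by
    rw [hT, Finset.card_erase_of_mem (Finset.mem_univ _), Finset.card_univ, Fintype.card_fin,
      Nat.cast_sub (by omega), Nat.cast_one]
  have h1 : ∑ j ∈ T, ‖∑ a, u a (z j) • D a‖ ^ 2 ≤ ∑ j, ‖∑ a, u a (z j) • D a‖ ^ 2 :=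
    Finset.sum_le_sum_of_subset_of_nonneg (Finset.subset_univ _) fun _ _ _ => sq_nonneg _
  have h2 : ∑ j ∈ T, ‖∑ a, u a (z j) • D a‖ ^ 2
      = (n - 1) * ∑ a, ‖D a‖ ^ 2 + ∑ a, ∑ b, s a b * ⟪D a, D b⟫ := by
    have e1 : ∀ j, ‖∑ a, u a (z j) • D a‖ ^ 2
        = ∑ a, ‖D a‖ ^ 2 + ∑ a, ∑ b,
          (u a (z j) * u b (z j) - if a = b then 1 else 0) * ⟪D a, D b⟫ := by
      intro j
      simp only [sub_mul, Finset.sum_sub_distrib, ite_mul, one_mul, zero_mul, Finset.sum_ite_eq,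
        Finset.mem_univ, if_true, real_inner_self_eq_norm_sq, add_sub_cancel]
      rw [← real_inner_self_eq_norm_sq]
      simp only [sum_inner, inner_sum, real_inner_smul_left, real_inner_smul_right]
      rw [Finset.sum_comm]
      refine Finset.sum_congr rfl fun a _ => Finset.sum_congr rfl fun b _ => ?_
      ring
    simp only [e1, Finset.sum_add_distrib, Finset.sum_const, nsmul_eq_mul, hcard]
    congr 1
    rw [Finset.sum_comm]
    refine Finset.sum_congr rfl fun a _ => ?_
    rw [Finset.sum_comm]
    refine Finset.sum_congr rfl fun b _ => ?_
    rw [hs, Finset.sum_mul]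
  have h3 : |∑ a, ∑ b, s a b * ⟪D a, D b⟫| ≤ (n : ℝ) / 4 * ∑ a, ‖D a‖ ^ 2 := by
    calc |∑ a, ∑ b, s a b * ⟪D a, D b⟫|
        ≤ ∑ a, ∑ b, (n : ℝ) / (4 * (r + 1)) * (‖D a‖ * ‖D b‖) := by
          refine (Finset.abs_sum_le_sum_abs _ _).trans (Finset.sum_le_sum fun a _ => ?_)
          refine (Finset.abs_sum_le_sum_abs _ _).trans (Finset.sum_le_sum fun b _ => ?_)
          rw [abs_mul]
          exact mul_le_mul (hs' a b) (abs_real_inner_le_norm _ _) (abs_nonneg _) (by positivity)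
      _ = (n : ℝ) / (4 * (r + 1)) * (∑ a, ‖D a‖) ^ 2 := by
          rw [pow_two, Finset.sum_mul_sum, Finset.mul_sum]
          simp only [Finset.mul_sum]
      _ ≤ (n : ℝ) / (4 * (r + 1)) * (r * ∑ a, ‖D a‖ ^ 2) := by
          gcongr
          simpa using sq_sum_le_card_mul_sum_sq (s := Finset.univ) (f := fun a => ‖D a‖)
      _ = (r / (r + 1)) * ((n : ℝ) / 4 * ∑ a, ‖D a‖ ^ 2) := by
          field_simp
      _ ≤ 1 * ((n : ℝ) / 4 * ∑ a, ‖D a‖ ^ 2) := by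
          gcongr
          rw [div_le_one (by positivity)]
          linarith
      _ = _ := one_mul _
  have h4 := (abs_le.mp h3).1
  have h5 : (4 : ℝ) ≤ n := by exact_mod_cast hn
  have h6 : 0 ≤ ∑ a, ‖D a‖ ^ 2 := Finset.sum_nonneg fun _ _ => sq_nonneg _
  nlinarith [mul_le_mul_of_nonneg_right h5 h6]

/-- The event does not involve the `i`-th sample, so it is independent of `g (z i)` and the
expectation factorizes with `g` merely integrable. This is why one sample is left out: no moment of
the response beyond the second is needed. -/
theorem integral_indicator_badEvent_mul {u : Fin r → Ω → ℝ} (hu : ∀ a, Measurable (u a))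
    (i : Fin n) {g : Ω → ℝ} (hg : Integrable g ρ) :
    Integrable (fun z : Fin n → Ω => (badEvent u n i).indicator 1 z * g (z i))
      (Measure.pi fun _ => ρ) ∧
    ∫ z, (badEvent u n i).indicator 1 z * g (z i) ∂(Measure.pi fun _ : Fin n => ρ)
      = (Measure.pi fun _ : Fin n => ρ).real (badEvent u n i) * ∫ x, g x ∂ρ := by
  set T : Finset (Fin n) := Finset.univ.erase i
  set B : Set (T → Ω) := {y | ∃ a b, (n : ℝ) / (4 * (r + 1)) ≤
    |∑ j, (u a (y j) * u b (y j) - if a = b then 1 else 0)|} with hB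
  have hBm : MeasurableSet B := by
    simp only [hB, Set.ofPred_exists]
    refine MeasurableSet.iUnion fun a => MeasurableSet.iUnion fun b => ?_
    exact measurableSet_le measurable_const (by fun_prop)
  have hBi : ∀ z : Fin n → Ω, (badEvent u n i).indicator (1 : (Fin n → Ω) → ℝ) z
      = B.indicator 1 fun j : T => z j := by
    intro z
    have : z ∈ badEvent u n i ↔ (fun j : T => z j) ∈ B := by
      simp only [badEvent, hB, Set.mem_ofPred_eq]
      refine exists_congr fun a => exists_congr fun b => ?_
      rw [← Finset.sum_coe_sort T]
    by_cases h : z ∈ badEvent u n i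
    · rw [Set.indicator_of_mem h, Set.indicator_of_mem (this.mp h)]; rfl
    · rw [Set.indicator_of_notMem h, Set.indicator_of_notMem (mt this.mpr h)]
  have hind : iIndepFun (fun (j : Fin n) (z : Fin n → Ω) => z j) (Measure.pi fun _ => ρ) :=
    iIndepFun_pi (X := fun _ x => x) fun _ => aemeasurable_id
  have h1 := hind.indepFun_finset T {i} (by simp [T]) fun j => measurable_pi_apply j
  have hev : Measurable fun y : ({i} : Finset (Fin n)) → Ω => y ⟨i, Finset.mem_singleton_self i⟩ :=
    measurable_pi_apply _
  have h2 := h1.comp (φ := B.indicator (1 : (T → Ω) → ℝ)) (measurable_one.indicator hBm) hev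
  have hgi : Integrable (fun z : Fin n → Ω => g (z i)) (Measure.pi fun _ => ρ) :=
    integrable_comp_eval (μ := fun _ : Fin n => ρ) hg
  have hbm := measurableSet_badEvent hu i
  constructor
  · refine hgi.mono ?_ (ae_of_all _ fun z => ?_)
    · exact (measurable_one.indicator hbm).aestronglyMeasurable.mul hgi.aestronglyMeasurable
    · rw [norm_mul]
      refine mul_le_of_le_one_left (norm_nonneg _) ?_
      by_cases h : z ∈ badEvent u n i <;> simp [h]
  · have hi : (Measure.pi fun _ : Fin n => ρ).map (fun z => z i) = ρ :=
      (measurePreserving_eval (fun _ : Fin n => ρ) i).map_eq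
    have hmX : Measurable ((B.indicator (1 : (T → Ω) → ℝ)) ∘ fun (z : Fin n → Ω) (j : T) => z j) :=
      (measurable_one.indicator hBm).comp (measurable_pi_lambda _ fun j => measurable_pi_apply _)
    have h3 := h2.integral_fun_comp_mul_comp (f := id) (g := g) hmX.aemeasurable
      (measurable_pi_apply i).aemeasurable aestronglyMeasurable_id
      (by change AEStronglyMeasurable g (Measure.map (fun z : Fin n → Ω => z i) _)
          rw [hi]; exact hg.aestronglyMeasurable)
    have e3 : ∫ z, (badEvent u n i).indicator (1 : (Fin n → Ω) → ℝ) z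
        ∂(Measure.pi fun _ : Fin n => ρ)
        = (Measure.pi fun _ : Fin n => ρ).real (badEvent u n i) := integral_indicator_one hbm
    rw [← e3]
    simp only [hBi]
    rw [← integral_comp_eval (μ := fun _ : Fin n => ρ) (i := i) hg.aestronglyMeasurable]
    exact h3

/-- The exponent in the probability bound for `badEvent`. -/
def badRate (r : ℕ) (B : ℝ) : ℝ := 1 / (32 * (r + 1) ^ 2 * (B ^ 2 + 1) ^ 2)

/-- Hoeffding's inequality for the centred products `u_a u_b - δ_ab`, bounded by `B² + 1`, and a
union bound over the `2 r²` one-sided deviations. -/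
theorem measureReal_badEvent_le {u : Fin r → Ω → ℝ} (hu : ∀ a, Measurable (u a)) {B : ℝ}
    (hB : ∀ a, ∀ᵐ x ∂ρ, |u a x| ≤ B)
    (horth : ∀ a b, ∫ x, u a x * u b x ∂ρ = if a = b then 1 else 0) (hn : 2 ≤ n) (i : Fin n) :
    (Measure.pi fun _ : Fin n => ρ).real (badEvent u n i)
      ≤ 2 * r ^ 2 * Real.exp (-(badRate r B * n)) := by
  set T : Finset (Fin n) := Finset.univ.erase i with hT
  set P : Measure (Fin n → Ω) := Measure.pi fun _ => ρ with hP
  set ε : ℝ := (n : ℝ) / (4 * (r + 1)) with hε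
  have hε0 : 0 ≤ ε := by positivity
  set K : ℝ := B ^ 2 + 1 with hK
  have hK0 : 0 < K := by positivity
  have hcard : (T.card : ℝ) = n - 1 := by
    rw [hT, Finset.card_erase_of_mem (Finset.mem_univ _), Finset.card_univ, Fintype.card_fin,
      Nat.cast_sub (by omega), Nat.cast_one]
  have hn' : (2 : ℝ) ≤ n := by exact_mod_cast hn
  have htail : ∀ v : Ω → ℝ, Measurable v → (∀ᵐ x ∂ρ, |v x| ≤ K) → ∫ x, v x ∂ρ = 0 →
      P.real {z | ε ≤ ∑ j ∈ T, v (z j)} ≤ Real.exp (-(badRate r B * n)) := by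
    intro v hv hvK hv0
    have hind : iIndepFun (fun (j : Fin n) (z : Fin n → Ω) => v (z j)) P :=
      iIndepFun_pi (X := fun _ => v) fun _ => hv.aemeasurable
    have hsub : ∀ j ∈ T, HasSubgaussianMGF (fun z : Fin n → Ω => v (z j))
        ((‖K - -K‖₊ / 2) ^ 2) P := by
      intro j _
      refine hasSubgaussianMGF_of_mem_Icc_of_integral_eq_zero
        (hv.comp (measurable_pi_apply j)).aemeasurable ?_ ?_
      · have := (Measure.quasiMeasurePreserving_eval (fun _ : Fin n => ρ) j).ae hvK
        filter_upwards [this] with z hz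
        exact abs_le.mp hz
      · rw [← hv0]
        exact integral_comp_eval (μ := fun _ : Fin n => ρ) (f := v) hv.aestronglyMeasurable
    refine (HasSubgaussianMGF.measure_sum_ge_le_of_iIndepFun hind hsub hε0).trans ?_
    refine Real.exp_le_exp.mpr ?_
    have hc : ((∑ _j ∈ T, (‖K - -K‖₊ / 2) ^ 2 : NNReal) : ℝ) = (n - 1) * K ^ 2 := by
      push_cast
      rw [Finset.sum_const, nsmul_eq_mul, hcard, Real.norm_of_nonneg (by linarith)]
      ring
    -- With `ε = n / (4 (r + 1))` the Hoeffding exponent is `ε² / (2 (n - 1) K²)`, and `n / (n - 1)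
    -- ≥ 1` leaves `badRate r B * n`.
    rw [hc, neg_div, neg_le_neg_iff, le_div_iff₀ (by nlinarith [pow_pos hK0 2]), badRate, hε, ← hK]
    have hr : (0 : ℝ) < r + 1 := by positivity
    have e : 1 / (32 * ((r : ℝ) + 1) ^ 2 * K ^ 2) * n * (2 * ((n - 1) * K ^ 2))
        = n * (n - 1) / (16 * (r + 1) ^ 2) := by
      field_simp; ring
    rw [e, div_pow, mul_pow]
    norm_num
    gcongr
    nlinarith
  have hsub : badEvent u n i ⊆ ⋃ a : Fin r, ⋃ b : Fin r,
      ({z | ε ≤ ∑ j ∈ T, (u a (z j) * u b (z j) - if a = b then 1 else 0)} ∪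
        {z | ε ≤ ∑ j ∈ T, -(u a (z j) * u b (z j) - if a = b then 1 else 0)}) := by
    rintro z ⟨a, b, hab⟩
    simp only [Set.mem_iUnion]
    refine ⟨a, b, ?_⟩
    rcases le_abs.mp hab with h | h
    · exact Or.inl h
    · refine Or.inr ?_
      rw [Set.mem_ofPred_eq, Finset.sum_neg_distrib]
      exact h
  have hab : ∀ a b : Fin r, Measurable (fun x => u a x * u b x - if a = b then (1 : ℝ) else 0) ∧
      (∀ᵐ x ∂ρ, |u a x * u b x - if a = b then (1 : ℝ) else 0| ≤ K) ∧
      ∫ x, (u a x * u b x - if a = b then (1 : ℝ) else 0) ∂ρ = 0 := by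
    intro a b
    have hbd : ∀ᵐ x ∂ρ, |u a x * u b x| ≤ B ^ 2 := by
      filter_upwards [hB a, hB b] with x h1 h2
      rw [abs_mul, pow_two]
      exact mul_le_mul h1 h2 (abs_nonneg _) ((abs_nonneg _).trans h1)
    have hm : Measurable fun x => u a x * u b x := (hu a).mul (hu b)
    refine ⟨hm.sub_const _, ?_, ?_⟩
    · filter_upwards [hbd] with x hx
      refine (abs_sub _ _).trans (add_le_add hx ?_)
      split_ifs <;> simp
    · rw [integral_sub (Integrable.of_bound hm.aestronglyMeasurable (B ^ 2) hbd)
        (integrable_const _), horth]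
      simp
  refine (measureReal_mono hsub).trans ?_
  refine (measureReal_iUnion_fintype_le _).trans ?_
  have hterm : ∀ a : Fin r, P.real (⋃ b : Fin r,
      ({z | ε ≤ ∑ j ∈ T, (u a (z j) * u b (z j) - if a = b then 1 else 0)} ∪
        {z | ε ≤ ∑ j ∈ T, -(u a (z j) * u b (z j) - if a = b then 1 else 0)}))
      ≤ ∑ _b : Fin r, 2 * Real.exp (-(badRate r B * n)) := by
    intro a
    refine (measureReal_iUnion_fintype_le _).trans (Finset.sum_le_sum fun b _ => ?_)
    refine (measureReal_union_le _ _).trans ?_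
    obtain ⟨h1, h2, h3⟩ := hab a b
    have e1 := htail _ h1 h2 h3
    have e2 := htail (fun x => -(u a x * u b x - if a = b then (1 : ℝ) else 0)) h1.neg
      (by simpa only [abs_neg] using h2) (by rw [integral_neg, h3, neg_zero])
    linarith
  refine (Finset.sum_le_sum fun a _ => hterm a).trans_eq ?_
  simp only [Finset.sum_const, Finset.card_univ, Fintype.card_fin, nsmul_eq_mul]
  ring

/-- A risk controlled by the noise on well-conditioned samples, and crudely in general, is
`O(1/n)` in expectation. -/
theorem exists_integral_le_div {u : Fin r → Ω → ℝ} (hu : ∀ a, Measurable (u a)) {B : ℝ}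
    (hB : ∀ a, ∀ᵐ x ∂ρ, |u a x| ≤ B)
    (horth : ∀ a b, ∫ x, u a x * u b x ∂ρ = if a = b then 1 else 0)
    {R : Ω → EuclideanSpace ℝ (Fin d)} (hR : MemLp R 2 ρ)
    (hRu : ∀ a, ∫ x, u a x • R x ∂ρ = 0) {τ w : ℝ} (hτ : 0 ≤ τ) (hw : 0 ≤ w) :
    ∃ C : ℝ, ∀ n : ℕ, 4 ≤ n → ∀ h : (Fin n → Ω) → ℝ,
      AEStronglyMeasurable h (Measure.pi fun _ => ρ) → (∀ z, 0 ≤ h z) →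
      (∀ᵐ z ∂(Measure.pi fun _ : Fin n => ρ),
        ((∀ D : Fin r → EuclideanSpace ℝ (Fin d),
          (n : ℝ) / 2 * ∑ a, ‖D a‖ ^ 2 ≤ ∑ j, ‖∑ a, u a (z j) • D a‖ ^ 2) →
          h z ≤ 4 * ∑ a, ‖(n : ℝ)⁻¹ • ∑ j, u a (z j) • R (z j)‖ ^ 2 + 2 * w / n) ∧
        h z ≤ τ * (∑ j, ‖R (z j)‖ ^ 2 + w)) →
      Integrable h (Measure.pi fun _ => ρ) ∧ ∫ z, h z ∂(Measure.pi fun _ => ρ) ≤ C / n := by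
  set κ := badRate r B with hκ
  have hκ0 : 0 < κ := by rw [hκ]; unfold badRate; positivity
  have hRsq : Integrable (fun x => ‖R x‖ ^ 2) ρ := hR.integrable_norm_pow two_ne_zero
  have huR : ∀ a, MemLp (fun x => u a x • R x) 2 ρ := fun a => by
    refine MemLp.of_le_mul (c := B) hR ((hu a).aestronglyMeasurable.smul hR.aestronglyMeasurable) ?_
    filter_upwards [hB a] with x hx
    rw [norm_smul, Real.norm_eq_abs]
    gcongr
  refine ⟨4 * ∑ a, ∫ x, ‖u a x • R x‖ ^ 2 ∂ρ + 2 * w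
    + 4 * r ^ 2 / κ ^ 2 * ∫ x, (τ * ‖R x‖ ^ 2 + τ * w) ∂ρ, ?_⟩
  intro n hn h hm h0 hae
  have hn0 : (0 : ℝ) < n := by exact_mod_cast (by omega : 0 < n)
  set P : Measure (Fin n → Ω) := Measure.pi fun _ => ρ with hP
  have hg : Integrable (fun x => τ * ‖R x‖ ^ 2 + τ * w) ρ :=
    (hRsq.const_mul τ).add (integrable_const _)
  set G : (Fin n → Ω) → ℝ := fun z =>
    (4 * ∑ a, (n : ℝ)⁻¹ ^ 2 * ‖∑ j, u a (z j) • R (z j)‖ ^ 2 + 2 * w / n)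
      + ∑ i, (badEvent u n i).indicator 1 z * (τ * ‖R (z i)‖ ^ 2 + τ * w) with hG
  have hI1 : Integrable (fun z : Fin n → Ω =>
      4 * ∑ a, (n : ℝ)⁻¹ ^ 2 * ‖∑ j, u a (z j) • R (z j)‖ ^ 2) P :=
    (integrable_finsetSum _ fun a _ =>
      (integral_norm_sq_sum_pi (huR a) (hRu a)).1.const_mul _).const_mul _
  have hI2 : ∀ i, Integrable (fun z : Fin n → Ω =>
      (badEvent u n i).indicator 1 z * (τ * ‖R (z i)‖ ^ 2 + τ * w)) P :=
    fun i => (integral_indicator_badEvent_mul hu i hg).1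
  have hGI : Integrable G P :=
    (hI1.add (integrable_const _)).add (integrable_finsetSum _ fun i _ => hI2 i)
  have hhG : ∀ᵐ z ∂P, h z ≤ G z := by
    filter_upwards [hae] with z hz
    have hnn : ∀ i, 0 ≤ (badEvent u n i).indicator (1 : (Fin n → Ω) → ℝ) z
        * (τ * ‖R (z i)‖ ^ 2 + τ * w) := fun i =>
      mul_nonneg (Set.indicator_nonneg (fun _ _ => zero_le_one) _) (by positivity)
    -- One good index is enough for the noise bound. If there is none, all the indicators are 1 and
    -- the sum in `G` dominates the crude bound, each `‖R (z i)‖²` being paired with its own event.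
    by_cases hbad : ∃ i, z ∉ badEvent u n i
    · obtain ⟨i, hi⟩ := hbad
      have h1 := hz.1 (le_sum_norm_sq_of_notMem_badEvent hn hi)
      simp only [norm_smul, mul_pow, norm_inv, RCLike.norm_natCast] at h1
      simp only [hG]
      have h2 := Finset.sum_nonneg fun i (_ : i ∈ Finset.univ) => hnn i
      linarith
    · push Not at hbad
      have h1 : ∀ i, (badEvent u n i).indicator (1 : (Fin n → Ω) → ℝ) z = 1 := fun i =>
        Set.indicator_of_mem (hbad i) _
      simp only [hG, h1, one_mul, Finset.sum_add_distrib, ← Finset.mul_sum]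
      have h2 : 0 ≤ ∑ a, (n : ℝ)⁻¹ ^ 2 * ‖∑ j, u a (z j) • R (z j)‖ ^ 2 :=
        Finset.sum_nonneg fun _ _ => by positivity
      rw [← Finset.mul_sum] at h2
      have h3 : 0 ≤ 2 * w / n := by positivity
      have h4 : τ * w ≤ τ * ∑ _i : Fin n, w := by
        rw [Finset.sum_const, Finset.card_univ, Fintype.card_fin, nsmul_eq_mul]
        have : (1 : ℝ) ≤ n := by exact_mod_cast (by omega : 1 ≤ n)
        nlinarith [mul_nonneg hτ hw]
      linarith [hz.2]
  have hhI : Integrable h P := by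
    refine hGI.mono' hm ?_
    filter_upwards [hhG] with z hz
    rwa [Real.norm_of_nonneg (h0 z)]
  refine ⟨hhI, (integral_mono_ae hhI hGI hhG).trans ?_⟩
  have e1 : ∫ z, (4 * ∑ a, (n : ℝ)⁻¹ ^ 2 * ‖∑ j, u a (z j) • R (z j)‖ ^ 2) ∂P
      = (n : ℝ)⁻¹ * (4 * ∑ a, ∫ x, ‖u a x • R x‖ ^ 2 ∂ρ) := by
    rw [integral_const_mul, integral_finsetSum _ fun a _ =>
      (integral_norm_sq_sum_pi (huR a) (hRu a)).1.const_mul _]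
    simp only [integral_const_mul]
    rw [Finset.sum_congr rfl fun a _ => by rw [(integral_norm_sq_sum_pi (huR a) (hRu a)).2]]
    rw [← Finset.mul_sum, ← Finset.mul_sum]
    field_simp
  have e2 : ∫ z, ∑ i, (badEvent u n i).indicator 1 z * (τ * ‖R (z i)‖ ^ 2 + τ * w) ∂P
      ≤ n * (2 * r ^ 2 * Real.exp (-(κ * n)) * ∫ x, (τ * ‖R x‖ ^ 2 + τ * w) ∂ρ) := by
    rw [integral_finsetSum _ fun i _ => hI2 i]
    have : ∀ i : Fin n, ∫ z, (badEvent u n i).indicator 1 z * (τ * ‖R (z i)‖ ^ 2 + τ * w) ∂P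
        ≤ 2 * r ^ 2 * Real.exp (-(κ * n)) * ∫ x, (τ * ‖R x‖ ^ 2 + τ * w) ∂ρ := by
      intro i
      rw [(integral_indicator_badEvent_mul hu i hg).2]
      refine mul_le_mul_of_nonneg_right (measureReal_badEvent_le hu hB horth (by omega) i)
        (integral_nonneg fun x => by positivity)
    refine (Finset.sum_le_sum fun i _ => this i).trans_eq ?_
    simp
  -- Quadratic decay is all that is needed: the sum over samples costs a factor `n`, and `1 / n`
  -- remains.
  have e3 : Real.exp (-(κ * n)) ≤ 2 / (κ * n) ^ 2 := by
    have h1 := Real.quadratic_le_exp_of_nonneg (by positivity : 0 ≤ κ * n)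
    rw [Real.exp_neg, ← one_div, div_le_div_iff₀ (Real.exp_pos _) (by positivity)]
    nlinarith [mul_pos hκ0 hn0]
  have hJ : 0 ≤ ∫ x, (τ * ‖R x‖ ^ 2 + τ * w) ∂ρ := integral_nonneg fun x => by positivity
  have e4 : n * (2 * r ^ 2 * Real.exp (-(κ * n)) * ∫ x, (τ * ‖R x‖ ^ 2 + τ * w) ∂ρ)
      ≤ (4 * r ^ 2 / κ ^ 2 * ∫ x, (τ * ‖R x‖ ^ 2 + τ * w) ∂ρ) / n := by
    calc n * (2 * r ^ 2 * Real.exp (-(κ * n)) * ∫ x, (τ * ‖R x‖ ^ 2 + τ * w) ∂ρ)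
        ≤ n * (2 * r ^ 2 * (2 / (κ * n) ^ 2) * ∫ x, (τ * ‖R x‖ ^ 2 + τ * w) ∂ρ) := by gcongr
      _ = _ := by field_simp; ring
  have hI3 : Integrable (fun z : Fin n → Ω =>
      4 * ∑ a, (n : ℝ)⁻¹ ^ 2 * ‖∑ j, u a (z j) • R (z j)‖ ^ 2 + 2 * w / n) P :=
    hI1.add (integrable_const _)
  simp only [hG]
  rw [integral_add hI3 (integrable_finsetSum _ fun i _ => hI2 i),
    integral_add hI1 (integrable_const _), e1, integral_const, probReal_univ, one_smul, add_div,
    add_div]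
  refine add_le_add (add_le_add (le_of_eq ?_) le_rfl) (e2.trans e4)
  rw [inv_mul_eq_div]

end ProductSample

/-! ### Bounds on the effective dimension. -/

section EffectiveDimension

theorem trace_mul_inv_add_smul_one {k : ℕ} {A : Matrix (Fin k) (Fin k) ℝ} (hA : A.PosSemidef)
    {γ : ℝ} (hγ : 0 < γ) :
    (A * (A + γ • (1 : Matrix (Fin k) (Fin k) ℝ))⁻¹).trace
      = ∑ i, hA.isHermitian.eigenvalues i / (hA.isHermitian.eigenvalues i + γ) := by
  set ev := hA.isHermitian.eigenvalues
  set U : Matrix (Fin k) (Fin k) ℝ := hA.isHermitian.eigenvectorUnitary.1 with hU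
  have hUU : U * star U = 1 := (Matrix.mem_unitaryGroup_iff).mp hA.isHermitian.eigenvectorUnitary.2
  have hUU' : star U * U = 1 := (Matrix.mem_unitaryGroup_iff').mp hA.isHermitian.eigenvectorUnitary.2
  have hspec : A = U * Matrix.diagonal ev * star U := by
    have := hA.isHermitian.spectral_theorem
    simpa [Unitary.conjStarAlgAut_apply, Function.comp_def] using this
  have hev : ∀ i, 0 ≤ ev i := hA.eigenvalues_nonneg
  have hinv : (A + γ • (1 : Matrix (Fin k) (Fin k) ℝ))⁻¹
      = U * Matrix.diagonal (fun i => (ev i + γ)⁻¹) * star U := by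
    refine Matrix.inv_eq_right_inv ?_
    have e1 : A + γ • (1 : Matrix (Fin k) (Fin k) ℝ)
        = U * Matrix.diagonal (fun i => ev i + γ) * star U := by
      have : Matrix.diagonal (fun i => ev i + γ)
          = Matrix.diagonal ev + γ • (1 : Matrix (Fin k) (Fin k) ℝ) := by
        rw [Matrix.smul_one_eq_diagonal, Matrix.diagonal_add]
      rw [this, mul_add, add_mul, ← hspec, mul_smul_comm, smul_mul_assoc, mul_one, hUU]
    rw [e1]
    calc U * Matrix.diagonal (fun i => ev i + γ) * star U
          * (U * Matrix.diagonal (fun i => (ev i + γ)⁻¹) * star U)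
        = U * (Matrix.diagonal (fun i => ev i + γ) * (star U * U)
          * Matrix.diagonal (fun i => (ev i + γ)⁻¹)) * star U := by simp only [mul_assoc]
      _ = 1 := by
        rw [hUU', mul_one, Matrix.diagonal_mul_diagonal]
        have : (fun i => (ev i + γ) * (ev i + γ)⁻¹) = 1 := by
          ext i
          exact mul_inv_cancel₀ (by have := hev i; positivity)
        rw [this]
        simp [hUU]
  rw [hinv]
  conv_lhs => rw [hspec]
  have e2 : U * Matrix.diagonal ev * star U * (U * Matrix.diagonal (fun i => (ev i + γ)⁻¹) * star U)
      = U * (Matrix.diagonal ev * Matrix.diagonal (fun i => (ev i + γ)⁻¹) * star U) := by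
    calc _ = U * (Matrix.diagonal ev * (star U * U)
          * Matrix.diagonal (fun i => (ev i + γ)⁻¹) * star U) := by simp only [mul_assoc]
      _ = _ := by rw [hUU', mul_one]
  rw [e2, Matrix.trace_mul_comm, mul_assoc, hUU', mul_one, Matrix.diagonal_mul_diagonal,
    Matrix.trace_diagonal]
  rfl

variable {𝒳 H : Type*} [MeasurableSpace 𝒳] [NormedAddCommGroup H] [InnerProductSpace ℝ H]
  {τ : Measure 𝒳} {φ : 𝒳 → H} {k : ℕ}

theorem posSemidef_featureCov (hφ : MemLp φ 2 τ) (Θ : Fin k → H) :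
    (featureCov τ φ Θ).PosSemidef := by
  have : featureCov τ φ Θ = Matrix.gram ℝ fun a => embed hφ (Θ a) := by
    ext i j
    rw [Matrix.gram_apply, inner_embed]
    rfl
  rw [this]
  exact Matrix.posSemidef_gram ..

theorem effDim_nonneg (hφ : MemLp φ 2 τ) (Θ : Fin k → H) {γ : ℝ} (hγ : 0 < γ) :
    0 ≤ effDim τ φ Θ γ := by
  unfold effDim
  rw [trace_mul_inv_add_smul_one (posSemidef_featureCov hφ Θ) hγ]
  refine Finset.sum_nonneg fun i _ => ?_
  have := (posSemidef_featureCov hφ Θ).eigenvalues_nonneg i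
  positivity

theorem effDim_le (hφ : MemLp φ 2 τ) (Θ : Fin k → H) {γ : ℝ} (hγ : 0 < γ) :
    effDim τ φ Θ γ ≤ k := by
  unfold effDim
  rw [trace_mul_inv_add_smul_one (posSemidef_featureCov hφ Θ) hγ]
  refine (Finset.sum_le_sum (g := fun _ => (1 : ℝ)) fun i _ => ?_).trans_eq (by simp)
  have := (posSemidef_featureCov hφ Θ).eigenvalues_nonneg i
  rw [div_le_one (by positivity)]
  linarith

/-- Every eigenvalue is at most the trace. This lower bound on the effective dimension serves the
case `f* = 0`, where no other term pays for the variance. -/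
theorem trace_div_le_effDim (hφ : MemLp φ 2 τ) (Θ : Fin k → H) {γ : ℝ} (hγ : 0 < γ) :
    (featureCov τ φ Θ).trace / ((featureCov τ φ Θ).trace + γ) ≤ effDim τ φ Θ γ := by
  have hA := posSemidef_featureCov hφ Θ
  unfold effDim
  rw [trace_mul_inv_add_smul_one hA hγ]
  have htr : (featureCov τ φ Θ).trace = ∑ i, hA.isHermitian.eigenvalues i := by
    rw [hA.isHermitian.trace_eq_sum_eigenvalues]
    simp
  rw [htr, Finset.sum_div]
  refine Finset.sum_le_sum fun i _ => ?_
  have h0 := hA.eigenvalues_nonneg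
  have h1 := Finset.single_le_sum (fun j _ => h0 j) (Finset.mem_univ i)
  have := h0 i
  gcongr

theorem trace_featureCov (hφ : MemLp φ 2 τ) (Θ : Fin k → H) :
    (featureCov τ φ Θ).trace = ∫ x, ∑ a, ⟪Θ a, φ x⟫ ^ 2 ∂τ := by
  rw [integral_finsetSum _ fun a _ => (hφ.const_inner (𝕜 := ℝ) (Θ a)).integrable_sq]
  simp [Matrix.trace, featureCov, pow_two]

end EffectiveDimension

/-! ### Linear probes and their `L²` geometry. -/

section Probe

variable {𝒳 H : Type*} [MeasurableSpace 𝒳] [NormedAddCommGroup H] [InnerProductSpace ℝ H]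
  {τ : Measure 𝒳} {φ : 𝒳 → H} {d k : ℕ}

theorem norm_toLp_sq {f : 𝒳 → EuclideanSpace ℝ (Fin d)} (hf : MemLp f 2 τ) :
    ‖hf.toLp f‖ ^ 2 = ∫ x, ‖f x‖ ^ 2 ∂τ := by
  rw [← real_inner_self_eq_norm_sq, L2.inner_def]
  refine integral_congr_ae ?_
  filter_upwards [hf.coeFn_toLp] with x hx
  rw [hx, real_inner_self_eq_norm_sq]

theorem inner_toLp {f g : 𝒳 → EuclideanSpace ℝ (Fin d)} (hf : MemLp f 2 τ) (hg : MemLp g 2 τ) :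
    ⟪hf.toLp f, hg.toLp g⟫ = ∫ x, ⟪f x, g x⟫ ∂τ := by
  rw [L2.inner_def]
  refine integral_congr_ae ?_
  filter_upwards [hf.coeFn_toLp, hg.coeFn_toLp] with x hx hy
  rw [hx, hy]

theorem probe_add {𝒳 : Type*} {φ : 𝒳 → H} (Θ : Fin k → H) (V W : Fin k → EuclideanSpace ℝ (Fin d))
    (x : 𝒳) :
    probe φ Θ (V + W) x = probe φ Θ V x + probe φ Θ W x := by
  simp [probe, smul_add, Finset.sum_add_distrib]

theorem probe_smul {𝒳 : Type*} {φ : 𝒳 → H} (Θ : Fin k → H) (c : ℝ)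
    (V : Fin k → EuclideanSpace ℝ (Fin d)) (x : 𝒳) :
    probe φ Θ (c • V) x = c • probe φ Θ V x := by
  simp [probe, Finset.smul_sum, smul_comm c]

theorem probe_sub {𝒳 : Type*} {φ : 𝒳 → H} (Θ : Fin k → H) (V W : Fin k → EuclideanSpace ℝ (Fin d))
    (x : 𝒳) :
    probe φ Θ (V - W) x = probe φ Θ V x - probe φ Θ W x := by
  simp [probe, smul_sub, Finset.sum_sub_distrib]

theorem probe_apply {𝒳 : Type*} {φ : 𝒳 → H} (Θ : Fin k → H) (V : Fin k → EuclideanSpace ℝ (Fin d))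
    (x : 𝒳) (j : Fin d) :
    probe φ Θ V x j = ⟪∑ a, V a j • Θ a, φ x⟫ := by
  simp [probe, sum_inner, real_inner_smul_left, mul_comm]

theorem norm_sq_eq_sum_norm_embed_sq (hφ : MemLp φ 2 τ) {f : Lp (EuclideanSpace ℝ (Fin d)) 2 τ}
    {η : Fin d → H} (hf : ∀ᵐ x ∂τ, ∀ j, f x j = ⟪η j, φ x⟫) :
    ‖f‖ ^ 2 = ∑ j, ‖embed hφ (η j)‖ ^ 2 := by
  have h1 : ‖f‖ ^ 2 = ∫ x, ∑ j, ⟪η j, φ x⟫ ^ 2 ∂τ := by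
    rw [← real_inner_self_eq_norm_sq, L2.inner_def]
    refine integral_congr_ae ?_
    filter_upwards [hf] with x hx
    simp only [real_inner_self_eq_norm_sq, EuclideanSpace.norm_sq_eq, hx, Real.norm_eq_abs, sq_abs]
  rw [h1, integral_finsetSum _ fun j _ => (hφ.const_inner (𝕜 := ℝ) _).integrable_sq]
  refine Finset.sum_congr rfl fun j _ => ?_
  rw [← real_inner_self_eq_norm_sq, inner_embed]
  simp only [pow_two]

theorem norm_probeLp_sq (hφ : MemLp φ 2 τ) (Θ : Fin k → H)
    (V : Fin k → EuclideanSpace ℝ (Fin d)) :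
    ‖probeLp hφ Θ V‖ ^ 2 = ∑ j, ‖embed hφ (∑ a, V a j • Θ a)‖ ^ 2 := by
  refine norm_sq_eq_sum_norm_embed_sq hφ ?_
  filter_upwards [(memLp_probe hφ Θ V).coeFn_toLp] with x hx j
  erw [hx]
  exact probe_apply Θ V x j

theorem norm_probe_sq_le {𝒳 : Type*} {φ : 𝒳 → H} (Θ : Fin k → H)
    (V : Fin k → EuclideanSpace ℝ (Fin d)) (x : 𝒳) :
    ‖probe φ Θ V x‖ ^ 2 ≤ (∑ a, ⟪Θ a, φ x⟫ ^ 2) * ∑ a, ‖V a‖ ^ 2 := by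
  have h1 : ‖probe φ Θ V x‖ ≤ ∑ a, |⟪Θ a, φ x⟫| * ‖V a‖ :=
    (norm_sum_le _ _).trans_eq (Finset.sum_congr rfl fun a _ => by
      rw [norm_smul, Real.norm_eq_abs])
  refine (pow_le_pow_left₀ (norm_nonneg _) h1 2).trans ?_
  refine (Finset.sum_mul_sq_le_sq_mul_sq _ _ _).trans_eq ?_
  simp only [sq_abs]

theorem norm_probeLp_sq_le (hφ : MemLp φ 2 τ) (Θ : Fin k → H)
    (V : Fin k → EuclideanSpace ℝ (Fin d)) :
    ‖probeLp hφ Θ V‖ ^ 2 ≤ (featureCov τ φ Θ).trace * ∑ a, ‖V a‖ ^ 2 := by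
  have h1 : ‖probeLp hφ Θ V‖ ^ 2 = ∫ x, ‖probe φ Θ V x‖ ^ 2 ∂τ :=
    norm_toLp_sq (memLp_probe hφ Θ V)
  rw [h1, trace_featureCov hφ, ← integral_mul_const]
  refine integral_mono ((memLp_probe hφ Θ V).integrable_norm_pow two_ne_zero) ?_
    fun x => norm_probe_sq_le Θ V x
  exact (integrable_finsetSum _ fun a _ =>
    (hφ.const_inner (𝕜 := ℝ) (Θ a)).integrable_sq).mul_const _

theorem trace_featureCov_nonneg (hφ : MemLp φ 2 τ) (Θ : Fin k → H) :
    0 ≤ (featureCov τ φ Θ).trace := by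
  rw [trace_featureCov hφ]
  exact integral_nonneg fun x => Finset.sum_nonneg fun a _ => sq_nonneg _

theorem exists_probeProj_eq (hφ : MemLp φ 2 τ) (Θ : Fin k → H)
    (f : Lp (EuclideanSpace ℝ (Fin d)) 2 τ) : ∃ W, probeLp hφ Θ W = probeProj hφ Θ d f :=
  Submodule.starProjection_apply_mem (LinearMap.range (probeLp (d := d) hφ Θ)) f

theorem inner_sub_probeProj (hφ : MemLp φ 2 τ) (Θ : Fin k → H)
    (f : Lp (EuclideanSpace ℝ (Fin d)) 2 τ) (V : Fin k → EuclideanSpace ℝ (Fin d)) :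
    ⟪probeLp hφ Θ V, f - probeProj hφ Θ d f⟫ = 0 := by
  rw [real_inner_comm]
  exact Submodule.starProjection_inner_eq_zero f _ ⟨V, rfl⟩

/-- Pythagoras; this is the separation of estimation and approximation errors. -/
theorem norm_probeLp_sub_sq (hφ : MemLp φ 2 τ) (Θ : Fin k → H)
    (f : Lp (EuclideanSpace ℝ (Fin d)) 2 τ) {Ws : Fin k → EuclideanSpace ℝ (Fin d)}
    (hWs : probeLp hφ Θ Ws = probeProj hφ Θ d f) (W : Fin k → EuclideanSpace ℝ (Fin d)) :
    ‖probeLp hφ Θ W - f‖ ^ 2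
      = ‖probeLp hφ Θ (W - Ws)‖ ^ 2 + ‖f - probeProj hφ Θ d f‖ ^ 2 := by
  have e : probeLp hφ Θ W - f = probeLp hφ Θ (W - Ws) - (f - probeProj hφ Θ d f) := by
    rw [map_sub, hWs]; abel
  rw [e, norm_sub_sq_real, inner_sub_probeProj]
  ring

theorem norm_sub_probeProj_le (hφ : MemLp φ 2 τ) (Θ : Fin k → H)
    (f : Lp (EuclideanSpace ℝ (Fin d)) 2 τ) (W : Fin k → EuclideanSpace ℝ (Fin d)) :
    ‖f - probeProj hφ Θ d f‖ ≤ ‖f - probeLp hφ Θ W‖ := by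
  obtain ⟨Ws, hWs⟩ := exists_probeProj_eq hφ Θ f
  refine le_of_sq_le_sq ?_ (norm_nonneg _)
  rw [norm_sub_rev f (probeLp hφ Θ W), norm_probeLp_sub_sq hφ Θ f hWs W]
  linarith [sq_nonneg ‖probeLp hφ Θ (W - Ws)‖]

/-- `L²(τ)`-orthonormal coordinates on the span of bounded features. -/
theorem exists_orthonormal_coordinates [IsProbabilityMeasure τ] (hφ : MemLp φ 2 τ) (Θ : Fin k → H)
    {M : ℝ} (hM : ∀ᵐ x ∂τ, ‖features φ Θ x‖ ≤ M) :
    ∃ (r : ℕ) (e : Fin r → 𝒳 → ℝ) (α : Fin r → Fin k → ℝ) (l : Fin k → Fin r → ℝ) (B : ℝ),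
      (∀ c, Measurable (e c)) ∧ (∀ c, ∀ᵐ x ∂τ, |e c x| ≤ B) ∧
      (∀ a b, ∫ x, e a x * e b x ∂τ = if a = b then 1 else 0) ∧
      (∀ c, ∀ᵐ x ∂τ, e c x = ∑ a, α c a * ⟪Θ a, φ x⟫) ∧
      (∀ a, ∀ᵐ x ∂τ, ⟪Θ a, φ x⟫ = ∑ c, l a c * e c x) := by
  set F := Submodule.span ℝ (Set.range fun a => embed hφ (Θ a)) with hF
  have hfin : FiniteDimensional ℝ F := FiniteDimensional.span_of_finite ℝ (Set.finite_range _)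
  -- Coordinates are taken on the span, not on the features: these may be dependent, in which case
  -- the covariance is singular and there are fewer than `k` coordinates.
  set u := stdOrthonormalBasis ℝ F
  choose α hα using fun c => (Submodule.mem_span_range_iff_exists_fun ℝ).mp (u c).2
  set v : Fin (Module.finrank ℝ F) → H := fun c => ∑ a, α c a • Θ a with hv
  have huv : ∀ c, (u c : Lp ℝ 2 τ) = embed hφ (v c) := fun c => by
    rw [← hα c, hv]
    simp only [map_sum, map_smul]
  -- The coordinates are replaced by measurable modifications, as `badEvent` is measurable only for
  -- measurable `u`; hence the relations with `φ` hold almost everywhere.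
  have hm : ∀ c, AEMeasurable (fun x => ⟪v c, φ x⟫) τ := fun c =>
    (hφ.const_inner (𝕜 := ℝ) (v c)).aestronglyMeasurable.aemeasurable
  have hmk : ∀ c, ∀ᵐ x ∂τ, (hm c).mk _ x = ⟪v c, φ x⟫ := fun c => (hm c).ae_eq_mk.symm
  have hvα : ∀ c x, ⟪v c, φ x⟫ = ∑ a, α c a * ⟪Θ a, φ x⟫ := fun c x => by
    simp only [hv, sum_inner, real_inner_smul_left]
  refine ⟨_, fun c => (hm c).mk _, α, fun a c => ⟪(u c : Lp ℝ 2 τ), embed hφ (Θ a)⟫,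
    ∑ c, ∑ a, |α c a| * M, fun c => (hm c).measurable_mk, fun c => ?_, fun a b => ?_, fun c => ?_,
    fun a => ?_⟩
  · filter_upwards [hmk c, hM] with x h1 h2
    have hM0 : 0 ≤ M := (norm_nonneg _).trans h2
    rw [h1, hvα]
    have h3 : ∀ a, |⟪Θ a, φ x⟫| ≤ M := fun a => by
      have := PiLp.norm_apply_le (features φ Θ x) a
      exact this.trans h2
    calc |∑ a, α c a * ⟪Θ a, φ x⟫| ≤ ∑ a, |α c a| * M := by
          refine (Finset.abs_sum_le_sum_abs _ _).trans (Finset.sum_le_sum fun a _ => ?_)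
          rw [abs_mul]
          gcongr
          exact h3 a
      _ ≤ _ := Finset.single_le_sum (f := fun c => ∑ a, |α c a| * M)
          (fun c _ => Finset.sum_nonneg fun a _ => by positivity) (Finset.mem_univ c)
  · have h1 : ∫ x, (hm a).mk _ x * (hm b).mk _ x ∂τ = ⟪(u a : Lp ℝ 2 τ), (u b : Lp ℝ 2 τ)⟫ := by
      rw [huv, huv, inner_embed]
      refine integral_congr_ae ?_
      filter_upwards [hmk a, hmk b] with x h1 h2
      rw [h1, h2]
    rw [h1]
    exact orthonormal_iff_ite.mp u.orthonormal a b
  · filter_upwards [hmk c] with x h1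
    rw [h1, hvα]
  · have hmem : embed hφ (Θ a) ∈ F := Submodule.subset_span ⟨a, rfl⟩
    have h1 := congrArg (Submodule.subtype F) (u.sum_repr' ⟨embed hφ (Θ a), hmem⟩)
    simp only [map_sum, map_smul, Submodule.subtype_apply, Submodule.coe_inner] at h1
    set w : H := ∑ c, ⟪(u c : Lp ℝ 2 τ), embed hφ (Θ a)⟫ • v c with hw
    have h2 : embed hφ w = embed hφ (Θ a) := by
      rw [← h1, hw]
      simp only [map_sum, map_smul, huv]
    have h3 : ∀ᵐ x ∂τ, ⟪w, φ x⟫ = ⟪Θ a, φ x⟫ := by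
      filter_upwards [coeFn_embed hφ w, coeFn_embed hφ (Θ a)] with x e1 e2
      rw [← e1, ← e2, h2]
    filter_upwards [h3, ae_all_iff.mpr hmk] with x h4 h5
    rw [← h4, hw]
    simp only [sum_inner, real_inner_smul_left, h5]

end Probe

theorem integrable_inner_of_memLp {Ω E : Type*} [MeasurableSpace Ω] [NormedAddCommGroup E]
    [InnerProductSpace ℝ E] {τ : Measure Ω} {f g : Ω → E} (hf : MemLp f 2 τ) (hg : MemLp g 2 τ) :
    Integrable (fun x => ⟪f x, g x⟫) τ := by
  refine (L2.integrable_inner (𝕜 := ℝ) (hf.toLp f) (hg.toLp g)).congr ?_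
  filter_upwards [hf.coeFn_toLp, hg.coeFn_toLp] with x h1 h2
  rw [h1, h2]

/-! ### Conditional expectation given the input, and the excess risk. -/

section Conditional

variable {𝒳 : Type*} [MeasurableSpace 𝒳] {d : ℕ} {ρ : Measure (𝒳 × EuclideanSpace ℝ (Fin d))}
  [IsProbabilityMeasure ρ] {fstar : 𝒳 → EuclideanSpace ℝ (Fin d)}

theorem measurePreserving_fst_fst {ρ : Measure (𝒳 × EuclideanSpace ℝ (Fin d))} :
    MeasurePreserving Prod.fst ρ ρ.fst := ⟨measurable_fst, rfl⟩

theorem integral_fst {ρ : Measure (𝒳 × EuclideanSpace ℝ (Fin d))}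
    {F : Type*} [NormedAddCommGroup F] [NormedSpace ℝ F] {g : 𝒳 → F}
    (hg : AEStronglyMeasurable g ρ.fst) : ∫ z, g z.1 ∂ρ = ∫ x, g x ∂ρ.fst :=
  (integral_map measurable_fst.aemeasurable hg).symm

theorem aestronglyMeasurable_comap_fst {ρ : Measure (𝒳 × EuclideanSpace ℝ (Fin d))}
    {F : Type*} [NormedAddCommGroup F] {g : 𝒳 → F}
    (hg : AEStronglyMeasurable g ρ.fst) :
    AEStronglyMeasurable[MeasurableSpace.comap Prod.fst inferInstance]
      (fun z : 𝒳 × EuclideanSpace ℝ (Fin d) => g z.1) ρ :=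
  ⟨fun z => hg.mk g z.1,
    hg.stronglyMeasurable_mk.comp_measurable (comap_measurable Prod.fst),
    measurePreserving_fst_fst.quasiMeasurePreserving.ae_eq_comp hg.ae_eq_mk⟩

theorem integral_inner_sub_condExp (hY : MemLp (fun z => z.2) 2 ρ) (hfρ : MemLp fstar 2 ρ.fst)
    (hfstar : ρ[(fun z => z.2) | MeasurableSpace.comap Prod.fst inferInstance]
      =ᵐ[ρ] fun z => fstar z.1)
    {g : 𝒳 → EuclideanSpace ℝ (Fin d)} (hg : MemLp g 2 ρ.fst) :
    ∫ z, ⟪g z.1, z.2 - fstar z.1⟫ ∂ρ = 0 := by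
  have hg' : MemLp (fun z => g z.1) 2 ρ := hg.comp_measurePreserving measurePreserving_fst_fst
  have hf' : MemLp (fun z => fstar z.1) 2 ρ :=
    hfρ.comp_measurePreserving measurePreserving_fst_fst
  have h1 := condExp_bilin_of_aestronglyMeasurable_left (innerSL ℝ)
    (aestronglyMeasurable_comap_fst hg.aestronglyMeasurable)
    (integrable_inner_of_memLp hg' hY) (hY.integrable (by norm_num))
  have h2 : ∫ z, ⟪g z.1, z.2⟫ ∂ρ = ∫ z, ⟪g z.1, fstar z.1⟫ ∂ρ := by
    rw [← integral_condExp (measurable_fst.comap_le)]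
    refine integral_congr_ae ?_
    filter_upwards [h1, hfstar] with z e1 e2
    refine e1.trans ?_
    rw [e2]
    rfl
  simp only [inner_sub_right]
  rw [integral_sub (integrable_inner_of_memLp hg' hY) (integrable_inner_of_memLp hg' hf'), h2, sub_self]

/-- `Y - f*(X)` is orthogonal in `L²(ρ)` to square integrable functions of `X`, so the cross term
vanishes. -/
theorem risk_sub_risk (hY : MemLp (fun z => z.2) 2 ρ) (hfρ : MemLp fstar 2 ρ.fst)
    (hfstar : ρ[(fun z => z.2) | MeasurableSpace.comap Prod.fst inferInstance]
      =ᵐ[ρ] fun z => fstar z.1)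
    {g : 𝒳 → EuclideanSpace ℝ (Fin d)} (hg : MemLp g 2 ρ.fst) :
    risk ρ g - risk ρ fstar = ‖hg.toLp g - hfρ.toLp fstar‖ ^ 2 := by
  have hgf := hg.sub hfρ
  have hf' : MemLp (fun z => fstar z.1) 2 ρ :=
    hfρ.comp_measurePreserving measurePreserving_fst_fst
  have hg' : MemLp (fun z => g z.1 - fstar z.1) 2 ρ :=
    hgf.comp_measurePreserving measurePreserving_fst_fst
  have hYf : MemLp (fun z => z.2 - fstar z.1) 2 ρ := hY.sub hf'
  have h1 := integral_inner_sub_condExp hY hfρ hfstar hgf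
  have e : ∀ z : 𝒳 × EuclideanSpace ℝ (Fin d), ‖g z.1 - z.2‖ ^ 2
      = ‖g z.1 - fstar z.1‖ ^ 2 - 2 * ⟪g z.1 - fstar z.1, z.2 - fstar z.1⟫
        + ‖fstar z.1 - z.2‖ ^ 2 := fun z => by
    rw [norm_sub_rev (fstar z.1) z.2, ← norm_sub_sq_real]
    congr 2
    abel
  have hI : Integrable (fun z : 𝒳 × EuclideanSpace ℝ (Fin d) => ‖fstar z.1 - z.2‖ ^ 2) ρ := by
    simpa only [norm_sub_rev] using hYf.integrable_norm_pow two_ne_zero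
  have hI1 := hg'.integrable_norm_pow two_ne_zero
  have hI2 := (integrable_inner_of_memLp hg' hYf).const_mul 2
  have h3 : risk ρ g = ∫ z, ‖g z.1 - fstar z.1‖ ^ 2 ∂ρ + risk ρ fstar := by
    unfold risk
    simp only [e]
    have hI12 : Integrable (fun z : 𝒳 × EuclideanSpace ℝ (Fin d) =>
      ‖g z.1 - fstar z.1‖ ^ 2 - 2 * ⟪g z.1 - fstar z.1, z.2 - fstar z.1⟫) ρ := hI1.sub hI2
    rw [integral_add hI12 hI, integral_sub hI1 hI2, integral_const_mul]
    have : ∫ z, ⟪g z.1 - fstar z.1, z.2 - fstar z.1⟫ ∂ρ = 0 := h1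
    rw [this]
    ring
  rw [h3, add_sub_cancel_right, ← MemLp.toLp_sub, norm_toLp_sq hgf]
  exact integral_fst (g := fun x => ‖g x - fstar x‖ ^ 2) (hgf.aestronglyMeasurable.norm.pow 2)

theorem integral_mul_norm_sq_le (hY : MemLp (fun z => z.2) 2 ρ) (hfρ : MemLp fstar 2 ρ.fst)
    {ε : ℝ} (hnoise : ρ[(fun z => ‖z.2 - fstar z.1‖ ^ 2) |
      MeasurableSpace.comap Prod.fst inferInstance] ≤ᵐ[ρ] fun _ => ε ^ 2)
    {b : 𝒳 → ℝ} (hb : AEStronglyMeasurable b ρ.fst) (hb0 : ∀ x, 0 ≤ b x) {B : ℝ}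
    (hB : ∀ᵐ x ∂ρ.fst, b x ≤ B) :
    ∫ z, b z.1 * ‖z.2 - fstar z.1‖ ^ 2 ∂ρ ≤ ε ^ 2 * ∫ x, b x ∂ρ.fst := by
  have hf' : MemLp (fun z => fstar z.1) 2 ρ :=
    hfρ.comp_measurePreserving measurePreserving_fst_fst
  have hI : Integrable (fun z : 𝒳 × EuclideanSpace ℝ (Fin d) => ‖z.2 - fstar z.1‖ ^ 2) ρ :=
    (hY.sub hf').integrable_norm_pow two_ne_zero
  have hbB : ∀ᵐ z ∂ρ, ‖b z.1‖ ≤ B := by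
    filter_upwards [measurePreserving_fst_fst.quasiMeasurePreserving.ae hB] with z hz
    rwa [Real.norm_of_nonneg (hb0 _)]
  have hbm : AEStronglyMeasurable (fun z : 𝒳 × EuclideanSpace ℝ (Fin d) => b z.1) ρ :=
    hb.comp_measurePreserving measurePreserving_fst_fst
  have hbI : Integrable (fun z : 𝒳 × EuclideanSpace ℝ (Fin d) => b z.1) ρ :=
    Integrable.of_bound hbm B hbB
  have hI2 : Integrable (fun z : 𝒳 × EuclideanSpace ℝ (Fin d) =>
      b z.1 * ‖z.2 - fstar z.1‖ ^ 2) ρ := hI.bdd_mul hbm hbB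
  have h1 := condExp_mul_of_aestronglyMeasurable_left (aestronglyMeasurable_comap_fst hb) hI2 hI
  calc ∫ z, b z.1 * ‖z.2 - fstar z.1‖ ^ 2 ∂ρ
      = ∫ z, (ρ[(fun z : 𝒳 × EuclideanSpace ℝ (Fin d) => b z.1)
          * (fun z => ‖z.2 - fstar z.1‖ ^ 2) |
          MeasurableSpace.comap Prod.fst inferInstance]) z ∂ρ :=
        (integral_condExp (measurable_fst.comap_le)).symm
    _ ≤ ∫ z, b z.1 * ε ^ 2 ∂ρ := by
        refine integral_mono_ae integrable_condExp (hbI.mul_const _) ?_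
        filter_upwards [h1, hnoise] with z e1 e2
        rw [e1, Pi.mul_apply]
        exact mul_le_mul_of_nonneg_left e2 (hb0 _)
    _ = _ := by
        rw [integral_mul_const, integral_fst hb, mul_comm]

end Conditional

/-! ### Ridge regression: first-order condition and closed form. -/

section Ridge

variable {𝒳 H : Type*} [NormedAddCommGroup H] [InnerProductSpace ℝ H]
  {φ : 𝒳 → H} {d k n : ℕ} {Θ : Fin k → H} {γ : ℝ}

/-- The objective at `W + s • V` is a quadratic polynomial in `s`, minimal at `s = 0`. -/
theorem IsRidgeMinimizer.inner_eq_zero {z : Fin n → 𝒳 × EuclideanSpace ℝ (Fin d)}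
    {W : Fin k → EuclideanSpace ℝ (Fin d)} (h : IsRidgeMinimizer φ Θ γ z W)
    (V : Fin k → EuclideanSpace ℝ (Fin d)) :
    (n : ℝ)⁻¹ * ∑ i, ⟪probe φ Θ W (z i).1 - (z i).2, probe φ Θ V (z i).1⟫
      + γ * ∑ a, ⟪W a, V a⟫ = 0 := by
  refine eq_zero_of_forall_quadratic_nonneg
    (c := (n : ℝ)⁻¹ * ∑ i, ‖probe φ Θ V (z i).1‖ ^ 2 + γ * ∑ a, ‖V a‖ ^ 2) fun s => ?_
  have h1 := h (W + s • V)
  have e1 : ∀ i, ‖probe φ Θ (W + s • V) (z i).1 - (z i).2‖ ^ 2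
      = ‖probe φ Θ W (z i).1 - (z i).2‖ ^ 2
        + 2 * s * ⟪probe φ Θ W (z i).1 - (z i).2, probe φ Θ V (z i).1⟫
        + s ^ 2 * ‖probe φ Θ V (z i).1‖ ^ 2 := fun i => by
    rw [probe_add, probe_smul, add_sub_right_comm, norm_add_sq_real, real_inner_smul_right,
      norm_smul, mul_pow, Real.norm_eq_abs, sq_abs]
    ring
  have e2 : ∀ a, ‖(W + s • V) a‖ ^ 2 = ‖W a‖ ^ 2 + 2 * s * ⟪W a, V a⟫ + s ^ 2 * ‖V a‖ ^ 2 :=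
    fun a => by
      rw [Pi.add_apply, Pi.smul_apply, norm_add_sq_real, real_inner_smul_right,
        norm_smul, mul_pow, Real.norm_eq_abs, sq_abs]
      ring
  simp only [e1, e2, Finset.sum_add_distrib, ← Finset.mul_sum] at h1
  linarith

/-- The matrix `Σ̂ + γ I` of the ridge regression problem, with `p i a` the `a`-th feature of the
`i`-th sample. -/
def ridgeMatrix (γ : ℝ) (p : Fin n → Fin k → ℝ) : Matrix (Fin k) (Fin k) ℝ :=
  Matrix.of fun a b => (n : ℝ)⁻¹ * ∑ i, p i a * p i b + if a = b then γ else 0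

/-- The closed form of the ridge regression estimator. -/
def ridgeSolution (γ : ℝ) (q : (Fin n → Fin k → ℝ) × (Fin n → EuclideanSpace ℝ (Fin d)))
    (a : Fin k) : EuclideanSpace ℝ (Fin d) :=
  WithLp.toLp 2 fun j => ∑ b, ((ridgeMatrix γ q.1).det)⁻¹ * (ridgeMatrix γ q.1).adjugate a b
    * ((n : ℝ)⁻¹ * ∑ i, q.1 i b * q.2 i j)

theorem measurable_ridgeSolution (γ : ℝ) :
    Measurable (ridgeSolution (d := d) (k := k) (n := n) γ) := by
  have hM : Continuous fun q : (Fin n → Fin k → ℝ) × (Fin n → EuclideanSpace ℝ (Fin d)) =>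
      ridgeMatrix γ q.1 := by
    refine continuous_matrix fun a b => ?_
    simp only [ridgeMatrix, Matrix.of_apply]
    fun_prop
  refine measurable_pi_lambda _ fun a => ?_
  refine (PiLp.continuous_toLp 2 _).measurable.comp (measurable_pi_lambda _ fun j => ?_)
  refine Finset.measurable_sum _ fun b _ => ?_
  refine (Measurable.mul ?_ ?_).mul ?_
  · exact hM.matrix_det.measurable.inv
  · exact (hM.matrix_adjugate.matrix_elem a b).measurable
  · refine Continuous.measurable ?_
    fun_prop

theorem ridgeMatrix_det_ne_zero (hγ : 0 < γ) (p : Fin n → Fin k → ℝ) :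
    (ridgeMatrix γ p).det ≠ 0 := by
  intro hdet
  obtain ⟨v, hv, hMv⟩ := Matrix.exists_mulVec_eq_zero_iff.mpr hdet
  have h1 : v ⬝ᵥ (ridgeMatrix γ p).mulVec v
      = (n : ℝ)⁻¹ * ∑ i, (∑ a, p i a * v a) ^ 2 + γ * ∑ a, v a ^ 2 := by
    simp only [dotProduct, Matrix.mulVec, ridgeMatrix, Matrix.of_apply, add_mul, ite_mul, zero_mul,
      Finset.sum_add_distrib, Finset.sum_ite_eq, Finset.mem_univ, if_true, mul_add]
    congr 1
    · simp only [pow_two, Finset.mul_sum, Finset.sum_mul]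
      conv_rhs => rw [Finset.sum_comm]
      refine Finset.sum_congr rfl fun a _ => ?_
      conv_rhs => rw [Finset.sum_comm]
      exact Finset.sum_congr rfl fun b _ => Finset.sum_congr rfl fun i _ => by ring
    · rw [Finset.mul_sum]
      exact Finset.sum_congr rfl fun a _ => by ring
  rw [hMv, dotProduct_zero] at h1
  have h2 : 0 ≤ (n : ℝ)⁻¹ * ∑ i, (∑ a, p i a * v a) ^ 2 :=
    mul_nonneg (by positivity) (Finset.sum_nonneg fun _ _ => sq_nonneg _)
  have h3 : 0 < ∑ a, v a ^ 2 := by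
    obtain ⟨a, ha⟩ := Function.ne_iff.mp hv
    exact Finset.sum_pos' (fun _ _ => sq_nonneg _) ⟨a, Finset.mem_univ _, by
      have : v a ≠ 0 := ha
      positivity⟩
  nlinarith [mul_pos hγ h3]

theorem IsRidgeMinimizer.eq_ridgeSolution (hγ : 0 < γ)
    {z : Fin n → 𝒳 × EuclideanSpace ℝ (Fin d)} {W : Fin k → EuclideanSpace ℝ (Fin d)}
    (h : IsRidgeMinimizer φ Θ γ z W) :
    W = ridgeSolution γ (fun i a => ⟪Θ a, φ (z i).1⟫, fun i => (z i).2) := by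
  set p : Fin n → Fin k → ℝ := fun i a => ⟪Θ a, φ (z i).1⟫ with hp
  have hdet := ridgeMatrix_det_ne_zero hγ p
  have hnormal : ∀ (b : Fin k) (j : Fin d), ∑ a, ridgeMatrix γ p b a * W a j
      = (n : ℝ)⁻¹ * ∑ i, p i b * (z i).2 j := by
    intro b j
    have h1 := h.inner_eq_zero (Pi.single b (EuclideanSpace.single j 1))
    have e1 : ∀ x, probe φ Θ (Pi.single b (EuclideanSpace.single j (1 : ℝ))) x
        = ⟪Θ b, φ x⟫ • EuclideanSpace.single j (1 : ℝ) := fun x => by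
      unfold probe
      rw [Finset.sum_eq_single b (fun a _ ha => by simp [Pi.single_eq_of_ne ha]) (by simp),
        Pi.single_eq_same]
    have e2 : ∑ a, ⟪W a, (Pi.single b (EuclideanSpace.single j (1 : ℝ)) :
        Fin k → EuclideanSpace ℝ (Fin d)) a⟫ = W b j := by
      rw [Finset.sum_eq_single b (fun a _ ha => by simp [Pi.single_eq_of_ne ha]) (by simp),
        Pi.single_eq_same, EuclideanSpace.inner_single_right]
      simp
    have e3 : ∀ i, ⟪probe φ Θ W (z i).1 - (z i).2, ⟪Θ b, φ (z i).1⟫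
        • EuclideanSpace.single j (1 : ℝ)⟫ = p i b * (∑ a, p i a * W a j - (z i).2 j) := fun i => by
      rw [real_inner_smul_right, EuclideanSpace.inner_single_right]
      simp [probe, hp]
    simp only [e1, e2, e3] at h1
    have e4 : ∑ a, ridgeMatrix γ p b a * W a j
        = (n : ℝ)⁻¹ * ∑ i, p i b * ∑ a, p i a * W a j + γ * W b j := by
      simp only [ridgeMatrix, Matrix.of_apply, add_mul, ite_mul, zero_mul, Finset.sum_add_distrib,
        Finset.sum_ite_eq, Finset.mem_univ, if_true, add_left_inj]
      simp only [Finset.mul_sum, Finset.sum_mul]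
      rw [Finset.sum_comm]
      exact Finset.sum_congr rfl fun i _ => Finset.sum_congr rfl fun a _ => by ring
    rw [e4]
    simp only [mul_sub, Finset.sum_sub_distrib] at h1
    linarith
  ext a j
  have h2 : (ridgeMatrix γ p).mulVec (fun a => W a j)
      = fun b => (n : ℝ)⁻¹ * ∑ i, p i b * (z i).2 j := funext fun b => hnormal b j
  have h3 := congrArg (fun v => (ridgeMatrix γ p).adjugate.mulVec v a) h2
  simp only [Matrix.mulVec_mulVec, Matrix.adjugate_mul, Matrix.smul_mulVec, Matrix.one_mulVec,
    Pi.smul_apply, smul_eq_mul] at h3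
  simp only [ridgeSolution, mul_assoc]
  rw [← Finset.mul_sum]
  simp only [Matrix.mulVec, dotProduct] at h3
  rw [← h3, inv_mul_cancel_left₀ hdet]

end Ridge

/-! ### The expected excess risk of ridge regression. -/

section ExcessRisk

variable {𝒳 H : Type*} [MeasurableSpace 𝒳] [NormedAddCommGroup H] [InnerProductSpace ℝ H]
  {φ : 𝒳 → H} {d k : ℕ} {ρ : Measure (𝒳 × EuclideanSpace ℝ (Fin d))} [IsProbabilityMeasure ρ]
  {fstar : 𝒳 → EuclideanSpace ℝ (Fin d)}

theorem quasiMeasurePreserving_fst_eval {n : ℕ} (i : Fin n) :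
    Measure.QuasiMeasurePreserving
      (fun z : Fin n → 𝒳 × EuclideanSpace ℝ (Fin d) => (z i).1)
      (Measure.pi fun _ => ρ) ρ.fst :=
  measurePreserving_fst_fst.quasiMeasurePreserving.comp
    (Measure.quasiMeasurePreserving_eval (fun _ : Fin n => ρ) i)

/-- The minimizers are picked sample by sample, with no measurability in the choice. For positive
`γ` the minimizer is unique and equal to `ridgeSolution`, built from determinant and adjugate, hence
measurable in features and responses. -/
theorem aestronglyMeasurable_norm_probeLp_sq (hφρ : MemLp φ 2 ρ.fst) (Θ : Fin k → H) {γ : ℝ}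
    (hγ : 0 < γ) {n : ℕ}
    {W : (Fin n → 𝒳 × EuclideanSpace ℝ (Fin d)) → Fin k → EuclideanSpace ℝ (Fin d)}
    (hW : ∀ z, IsRidgeMinimizer φ Θ γ z (W z)) (Ws : Fin k → EuclideanSpace ℝ (Fin d)) :
    AEStronglyMeasurable (fun z => ‖probeLp hφρ Θ (W z - Ws)‖ ^ 2) (Measure.pi fun _ => ρ) := by
  have hq : AEMeasurable (fun z : Fin n → 𝒳 × EuclideanSpace ℝ (Fin d) =>
      ((fun i a => ⟪Θ a, φ (z i).1⟫ : Fin n → Fin k → ℝ), fun i => (z i).2))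
      (Measure.pi fun _ => ρ) := by
    refine AEMeasurable.prodMk (aemeasurable_pi_iff.mpr fun i => aemeasurable_pi_iff.mpr fun a => ?_)
      (aemeasurable_pi_iff.mpr fun i => ?_)
    · exact (hφρ.const_inner (𝕜 := ℝ) (Θ a)).aestronglyMeasurable.aemeasurable
        |>.comp_quasiMeasurePreserving (quasiMeasurePreserving_fst_eval i)
    · exact (measurable_snd.comp (measurable_pi_apply i)).aemeasurable
  have hWm : AEMeasurable W (Measure.pi fun _ => ρ) := by
    have : W = fun z => ridgeSolution γ (fun i a => ⟪Θ a, φ (z i).1⟫, fun i => (z i).2) :=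
      funext fun z => (hW z).eq_ridgeSolution hγ
    rw [this]
    exact (measurable_ridgeSolution γ).comp_aemeasurable hq
  have hc : Continuous fun V : Fin k → EuclideanSpace ℝ (Fin d) =>
      ‖probeLp hφρ Θ (V - Ws)‖ ^ 2 := by
    have := (probeLp (d := d) hφρ Θ).continuous_of_finiteDimensional
    fun_prop
  exact (hc.measurable.comp_aemeasurable hWm).aestronglyMeasurable

theorem integral_smul_sub_eq_zero (hY : MemLp (fun z => z.2) 2 ρ) (hfρ : MemLp fstar 2 ρ.fst)
    (hfstar : ρ[(fun z => z.2) | MeasurableSpace.comap Prod.fst inferInstance]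
      =ᵐ[ρ] fun z => fstar z.1)
    {b : 𝒳 → ℝ} (hb : AEStronglyMeasurable b ρ.fst) {B : ℝ} (hB : ∀ᵐ x ∂ρ.fst, |b x| ≤ B) :
    ∫ z, b z.1 • (z.2 - fstar z.1) ∂ρ = 0 := by
  have hf' : MemLp (fun z => fstar z.1) 2 ρ :=
    hfρ.comp_measurePreserving measurePreserving_fst_fst
  have hI : Integrable (fun z : 𝒳 × EuclideanSpace ℝ (Fin d) => z.2 - fstar z.1) ρ :=
    (hY.sub hf').integrable (by norm_num)
  have hbm : AEStronglyMeasurable (fun z : 𝒳 × EuclideanSpace ℝ (Fin d) => b z.1) ρ :=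
    hb.comp_measurePreserving measurePreserving_fst_fst
  have hI2 : Integrable (fun z : 𝒳 × EuclideanSpace ℝ (Fin d) => b z.1 • (z.2 - fstar z.1)) ρ :=
    hI.bdd_smul B hbm (measurePreserving_fst_fst.quasiMeasurePreserving.ae hB)
  refine ext_inner_left ℝ fun w => ?_
  rw [inner_zero_right, ← integral_inner hI2]
  have hbw : MemLp (fun x => b x • w) 2 ρ.fst := by
    refine MemLp.of_bound (hb.smul_const w) (B * ‖w‖) ?_
    filter_upwards [hB] with x hx
    rw [norm_smul, Real.norm_eq_abs]
    gcongr
  rw [← integral_inner_sub_condExp hY hfρ hfstar hbw]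
  refine integral_congr_ae (ae_of_all _ fun z => ?_)
  simp only [real_inner_smul_left, real_inner_smul_right]

/-- With a penalty of order `1/n`, the ridge estimator converges at the rate `1/n` to the best
linear probe. -/
theorem exists_integral_norm_probeLp_sq_le (hφρ : MemLp φ 2 ρ.fst)
    (hY : MemLp (fun z => z.2) 2 ρ) (hfρ : MemLp fstar 2 ρ.fst)
    (hfstar : ρ[(fun z => z.2) | MeasurableSpace.comap Prod.fst inferInstance]
      =ᵐ[ρ] fun z => fstar z.1)
    (Θ : Fin k → H) {M : ℝ} (hM : ∀ᵐ x ∂ρ.fst, ‖features φ Θ x‖ ≤ M)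
    {Ws : Fin k → EuclideanSpace ℝ (Fin d)}
    (hWs : probeLp hφρ Θ Ws = probeProj hφρ Θ d (hfρ.toLp fstar)) :
    ∃ C : ℝ, ∀ n : ℕ, 4 ≤ n →
      ∀ W : (Fin n → 𝒳 × EuclideanSpace ℝ (Fin d)) → Fin k → EuclideanSpace ℝ (Fin d),
      (∀ z, IsRidgeMinimizer φ Θ ((n : ℝ) + 1)⁻¹ z (W z)) →
      Integrable (fun z => ‖probeLp hφρ Θ (W z - Ws)‖ ^ 2) (Measure.pi fun _ => ρ) ∧
      ∫ z, ‖probeLp hφρ Θ (W z - Ws)‖ ^ 2 ∂(Measure.pi fun _ => ρ) ≤ C / n := by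
  obtain ⟨r, e, α, l, B, hem, heB, heo, hα, hl⟩ := exists_orthonormal_coordinates hφρ Θ hM
  set u : Fin r → 𝒳 × EuclideanSpace ℝ (Fin d) → ℝ := fun c z => e c z.1 with hu
  have hum : ∀ c, Measurable (u c) := fun c => (hem c).comp measurable_fst
  have huB : ∀ c, ∀ᵐ z ∂ρ, |u c z| ≤ B := fun c =>
    measurePreserving_fst_fst.quasiMeasurePreserving.ae (heB c)
  have huo : ∀ a b, ∫ z, u a z * u b z ∂ρ = if a = b then 1 else 0 := fun a b => by
    rw [← heo a b]
    exact integral_fst (g := fun x => e a x * e b x) ((hem a).mul (hem b)).aestronglyMeasurable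
  set R : 𝒳 × EuclideanSpace ℝ (Fin d) → EuclideanSpace ℝ (Fin d) :=
    fun z => z.2 - probe φ Θ Ws z.1 with hR
  have hPs : MemLp (fun z : 𝒳 × EuclideanSpace ℝ (Fin d) => probe φ Θ Ws z.1) 2 ρ :=
    (memLp_probe hφρ Θ Ws).comp_measurePreserving measurePreserving_fst_fst
  have hRm : MemLp R 2 ρ := hY.sub hPs
  have hf' : MemLp (fun z => fstar z.1) 2 ρ :=
    hfρ.comp_measurePreserving measurePreserving_fst_fst
  have hdiff : MemLp (fun x => fstar x - probe φ Θ Ws x) 2 ρ.fst := hfρ.sub (memLp_probe hφρ Θ Ws)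
  -- `R` is the noise `Y - f*(X)`, conditionally centred, plus the residual of projecting `f*`,
  -- which is orthogonal to all probes and so to `e c`, a combination of features.
  have hRu : ∀ c, ∫ z, u c z • R z ∂ρ = 0 := by
    intro c
    have h1 := integral_smul_sub_eq_zero hY hfρ hfstar (hem c).aestronglyMeasurable (heB c)
    have hI1 : Integrable (fun x => e c x • (fstar x - probe φ Θ Ws x)) ρ.fst :=
      (hdiff.integrable (by norm_num)).bdd_smul B (hem c).aestronglyMeasurable (heB c)
    have h2 : ∫ x, e c x • (fstar x - probe φ Θ Ws x) ∂ρ.fst = 0 := by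
      refine ext_inner_left ℝ fun w => ?_
      rw [inner_zero_right, ← integral_inner hI1]
      have h3 := inner_sub_probeProj hφρ Θ (hfρ.toLp fstar) (fun a => α c a • w)
      rw [← hWs] at h3
      have h4 : ⟪probeLp hφρ Θ (fun a => α c a • w), hfρ.toLp fstar - probeLp hφρ Θ Ws⟫
          = ∫ x, ⟪probe φ Θ (fun a => α c a • w) x, fstar x - probe φ Θ Ws x⟫ ∂ρ.fst := by
        rw [← inner_toLp (memLp_probe hφρ Θ _) hdiff]
        rfl
      rw [h4] at h3
      rw [← h3]
      refine integral_congr_ae ?_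
      filter_upwards [hα c] with x hx
      have : probe φ Θ (fun a => α c a • w) x = e c x • w := by
        rw [hx, Finset.sum_smul]
        exact Finset.sum_congr rfl fun a _ => by rw [smul_smul, mul_comm]
      rw [this, real_inner_smul_left, real_inner_smul_right]
    have h5 : ∫ z, e c z.1 • (fstar z.1 - probe φ Θ Ws z.1) ∂ρ = 0 := by
      rw [← h2]
      exact integral_fst (g := fun x => e c x • (fstar x - probe φ Θ Ws x)) hI1.aestronglyMeasurable
    have hI2 : Integrable (fun z : 𝒳 × EuclideanSpace ℝ (Fin d) =>
        e c z.1 • (z.2 - fstar z.1)) ρ :=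
      ((hY.sub hf').integrable (by norm_num)).bdd_smul B (hum c).aestronglyMeasurable (huB c)
    have hI3 : Integrable (fun z : 𝒳 × EuclideanSpace ℝ (Fin d) =>
        e c z.1 • (fstar z.1 - probe φ Θ Ws z.1)) ρ :=
      ((hf'.sub hPs).integrable (by norm_num)).bdd_smul B (hum c).aestronglyMeasurable (huB c)
    have h6 : ∀ z, u c z • R z
        = e c z.1 • (z.2 - fstar z.1) + e c z.1 • (fstar z.1 - probe φ Θ Ws z.1) := fun z => by
      rw [← smul_add, sub_add_sub_cancel]
    simp only [h6]
    rw [integral_add hI2 hI3, h1, h5, add_zero]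
  set t := (featureCov ρ.fst φ Θ).trace
  have ht : 0 ≤ t := trace_featureCov_nonneg hφρ Θ
  set w := ∑ a, ‖Ws a‖ ^ 2 with hw
  have hw0 : 0 ≤ w := Finset.sum_nonneg fun _ _ => sq_nonneg _
  obtain ⟨C, hC⟩ := exists_integral_le_div hum huB huo hRm hRu ht hw0
  refine ⟨C, fun n hn W hW => ?_⟩
  have hn0 : (0 : ℝ) < n := by exact_mod_cast (by omega : 0 < n)
  set γ : ℝ := ((n : ℝ) + 1)⁻¹ with hγ
  have hγ0 : 0 < γ := by positivity
  refine hC n hn _ (aestronglyMeasurable_norm_probeLp_sq hφρ Θ hγ0 hW Ws) (fun z => sq_nonneg _) ?_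
  have hcoord : ∀ᵐ z ∂(Measure.pi fun _ : Fin n => ρ), ∀ i a,
      ⟪Θ a, φ (z i).1⟫ = ∑ c, l a c * u c (z i) := by
    refine ae_all_iff.mpr fun i => ae_all_iff.mpr fun a => ?_
    exact (quasiMeasurePreserving_fst_eval i).ae (hl a)
  filter_upwards [hcoord] with z hz
  set Δ := W z - Ws with hΔ
  set D : Fin r → EuclideanSpace ℝ (Fin d) := fun c => ∑ a, l a c • Δ a with hD
  have hprobe : ∀ i, probe φ Θ Δ (z i).1 = ∑ c, u c (z i) • D c := by
    intro i
    unfold probe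
    simp only [hz i, hD, Finset.sum_smul, Finset.smul_sum, smul_smul]
    rw [Finset.sum_comm]
    simp only [mul_comm]
  have hnorm : ‖probeLp hφρ Θ Δ‖ ^ 2 = ∑ c, ‖D c‖ ^ 2 := by
    have h1 : ‖probeLp hφρ Θ Δ‖ ^ 2 = ∫ x, ‖probe φ Θ Δ x‖ ^ 2 ∂ρ.fst :=
      norm_toLp_sq (memLp_probe hφρ Θ Δ)
    have h2 : ∀ᵐ x ∂ρ.fst, ‖probe φ Θ Δ x‖ ^ 2 = ∑ a, ∑ b, e a x * e b x * ⟪D a, D b⟫ := by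
      filter_upwards [ae_all_iff.mpr hl] with x hx
      have : probe φ Θ Δ x = ∑ c, e c x • D c := by
        unfold probe
        simp only [hx, hD, Finset.sum_smul, Finset.smul_sum, smul_smul]
        rw [Finset.sum_comm]
        simp only [mul_comm]
      rw [this, ← real_inner_self_eq_norm_sq]
      simp only [sum_inner, inner_sum, real_inner_smul_left, real_inner_smul_right]
      rw [Finset.sum_comm]
      exact Finset.sum_congr rfl fun a _ => Finset.sum_congr rfl fun b _ => by ring
    have hI : ∀ a b, Integrable (fun x => e a x * e b x) ρ.fst := fun a b => by
      refine Integrable.of_bound ((hem a).mul (hem b)).aestronglyMeasurable (B * B) ?_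
      filter_upwards [heB a, heB b] with x h1 h2
      rw [Real.norm_eq_abs, abs_mul]
      exact mul_le_mul h1 h2 (abs_nonneg _) ((abs_nonneg _).trans h1)
    rw [h1, integral_congr_ae h2, integral_finsetSum _ fun a _ =>
      integrable_finsetSum _ fun b _ => (hI a b).mul_const _]
    refine Finset.sum_congr rfl fun a _ => ?_
    rw [integral_finsetSum _ fun b _ => (hI a b).mul_const _]
    simp only [integral_mul_const, heo, ite_mul, one_mul, zero_mul, Finset.sum_ite_eq,
      Finset.mem_univ, if_true, real_inner_self_eq_norm_sq]
  set q := (n : ℝ)⁻¹ * ∑ i, ‖probe φ Θ Δ (z i).1‖ ^ 2 with hq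
  set s := ∑ a, ‖Δ a‖ ^ 2 with hs
  have hs0 : 0 ≤ s := Finset.sum_nonneg fun _ _ => sq_nonneg _
  set I := (n : ℝ)⁻¹ * ∑ i, ⟪R (z i), probe φ Θ Δ (z i).1⟫ with hI
  -- The first-order condition tested on `Δ` itself; the cross term of the penalty with `Ws` is
  -- split by Young's inequality.
  have hbasic : q + γ / 2 * s ≤ I + γ / 2 * w := by
    have h1 := (hW z).inner_eq_zero Δ
    have e1 : ∀ i, ⟪probe φ Θ (W z) (z i).1 - (z i).2, probe φ Θ Δ (z i).1⟫
        = ‖probe φ Θ Δ (z i).1‖ ^ 2 - ⟪R (z i), probe φ Θ Δ (z i).1⟫ := fun i => by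
      rw [← real_inner_self_eq_norm_sq, ← inner_sub_left]
      congr 1
      simp only [hR, hΔ, probe_sub]
      abel
    have e2 : ∀ a, ⟪W z a, Δ a⟫ = ‖Δ a‖ ^ 2 + ⟪Ws a, Δ a⟫ := fun a => by
      rw [← real_inner_self_eq_norm_sq, ← inner_add_left]
      congr 1
      simp [hΔ]
    have e3 : -∑ a, ⟪Ws a, Δ a⟫ ≤ s / 2 + w / 2 := by
      rw [hs, hw, Finset.sum_div, Finset.sum_div, ← Finset.sum_add_distrib,
        ← Finset.sum_neg_distrib]
      refine Finset.sum_le_sum fun a _ => ?_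
      have := norm_add_sq_real (Ws a) (Δ a)
      nlinarith [sq_nonneg ‖Ws a + Δ a‖]
    simp only [e1, e2, Finset.sum_sub_distrib, Finset.sum_add_distrib, mul_sub] at h1
    nlinarith [mul_le_mul_of_nonneg_left e3 hγ0.le]
  -- On a well-conditioned sample `q` is at least half of `∑ ‖D c‖²`, while Young's inequality gives
  -- up only a quarter of it in `I`. In general `q` absorbs the dependence of `I` on `Δ`, and the
  -- penalty alone controls `Δ`; since `1 / n ≤ 2γ`, the resulting bound has no factor growing with
  -- `n`.
  refine ⟨fun hgood => ?_, ?_⟩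
  · have h1 := hgood D
    simp only [← hprobe] at h1
    have h2 : (∑ c, ‖D c‖ ^ 2) / 2 ≤ q := by
      rw [hq, inv_mul_eq_div, le_div_iff₀ hn0]
      linarith
    have h3 : I = ∑ c, ⟪(n : ℝ)⁻¹ • ∑ j, u c (z j) • R (z j), D c⟫ := by
      rw [hI]
      simp only [hprobe, inner_sum, real_inner_smul_left, real_inner_smul_right, sum_inner,
        Finset.mul_sum]
      rw [Finset.sum_comm]
    have h4 : I ≤ ∑ c, ‖(n : ℝ)⁻¹ • ∑ j, u c (z j) • R (z j)‖ ^ 2 + (∑ c, ‖D c‖ ^ 2) / 4 := by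
      rw [h3, Finset.sum_div, ← Finset.sum_add_distrib]
      refine Finset.sum_le_sum fun c _ => ?_
      refine (real_inner_le_norm _ _).trans ?_
      nlinarith [sq_nonneg (‖(n : ℝ)⁻¹ • ∑ j, u c (z j) • R (z j)‖ - ‖D c‖ / 2)]
    have h5 : γ ≤ 1 / n := by
      rw [hγ, ← one_div]
      exact one_div_le_one_div_of_le hn0 (by linarith)
    have h6 : γ * w ≤ w / n :=
      (mul_le_mul_of_nonneg_right h5 hw0).trans_eq (one_div_mul_eq_div _ _)
    have h7 : 2 * w / n = 2 * (w / n) := by ring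
    rw [hnorm, h7]
    nlinarith [mul_nonneg hγ0.le hs0]
  · refine (norm_probeLp_sq_le hφρ Θ Δ).trans (mul_le_mul_of_nonneg_left ?_ ht)
    have h1 : I ≤ q + (n : ℝ)⁻¹ * ∑ i, ‖R (z i)‖ ^ 2 / 4 := by
      rw [hI, hq, ← mul_add, ← Finset.sum_add_distrib]
      refine mul_le_mul_of_nonneg_left (Finset.sum_le_sum fun i _ => ?_) (by positivity)
      refine (real_inner_le_norm _ _).trans ?_
      nlinarith [sq_nonneg (‖R (z i)‖ / 2 - ‖probe φ Θ Δ (z i).1‖)]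
    have h2 : γ / 2 * s ≤ (n : ℝ)⁻¹ * ∑ i, ‖R (z i)‖ ^ 2 / 4 + γ / 2 * w := by linarith
    have h3 : (n : ℝ)⁻¹ ≤ 2 * γ := by
      rw [hγ, ← one_div, ← div_eq_mul_inv, div_le_div_iff₀ hn0 (by positivity)]
      have : (4 : ℝ) ≤ n := by exact_mod_cast hn
      linarith
    have h4 : 0 ≤ ∑ i, ‖R (z i)‖ ^ 2 / 4 := Finset.sum_nonneg fun _ _ => by positivity
    have h5 := mul_le_mul_of_nonneg_right h3 h4
    rw [← Finset.sum_div] at h2 h5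
    have h6 : γ / 2 * s ≤ γ / 2 * (∑ i, ‖R (z i)‖ ^ 2 + w) := by
      refine h2.trans ((add_le_add_left h5 _).trans_eq ?_)
      ring
    exact le_of_mul_le_mul_left h6 (by positivity)

/-- If the regression function vanishes, the excess risk with a constant penalty is at most
the effective dimension term. -/
theorem integral_norm_probeLp_sq_le_effDim (hφρ : MemLp φ 2 ρ.fst)
    (hY : MemLp (fun z => z.2) 2 ρ) (hfρ : MemLp fstar 2 ρ.fst)
    (hfstar : ρ[(fun z => z.2) | MeasurableSpace.comap Prod.fst inferInstance]
      =ᵐ[ρ] fun z => fstar z.1) {ε : ℝ}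
    (hnoise : ρ[(fun z => ‖z.2 - fstar z.1‖ ^ 2) | MeasurableSpace.comap Prod.fst inferInstance]
      ≤ᵐ[ρ] fun _ => ε ^ 2) (hzero : fstar =ᵐ[ρ.fst] 0)
    (Θ : Fin k → H) {M : ℝ} (hM : ∀ᵐ x ∂ρ.fst, ‖features φ Θ x‖ ≤ M) {γ : ℝ}
    (hγ : γ = (featureCov ρ.fst φ Θ).trace + 1) {n : ℕ} (hn : 0 < n)
    {W : (Fin n → 𝒳 × EuclideanSpace ℝ (Fin d)) → Fin k → EuclideanSpace ℝ (Fin d)}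
    (hW : ∀ z, IsRidgeMinimizer φ Θ γ z (W z)) :
    Integrable (fun z => ‖probeLp hφρ Θ (W z)‖ ^ 2) (Measure.pi fun _ => ρ) ∧
    ∫ z, ‖probeLp hφρ Θ (W z)‖ ^ 2 ∂(Measure.pi fun _ => ρ)
      ≤ 2 * effDim ρ.fst φ Θ γ * ε ^ 2 / n := by
  set t := (featureCov ρ.fst φ Θ).trace with ht
  have ht0 : 0 ≤ t := trace_featureCov_nonneg hφρ Θ
  have hγ0 : 0 < γ := by rw [hγ]; positivity
  have hn0 : (0 : ℝ) < n := by exact_mod_cast hn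
  set P : Measure (Fin n → 𝒳 × EuclideanSpace ℝ (Fin d)) := Measure.pi fun _ => ρ with hP
  have hz : ∀ᵐ z ∂ρ, fstar z.1 = 0 := measurePreserving_fst_fst.quasiMeasurePreserving.ae hzero
  have hfeat : ∀ a, ∀ᵐ x ∂ρ.fst, |⟪Θ a, φ x⟫| ≤ M := fun a => by
    filter_upwards [hM] with x hx
    exact (PiLp.norm_apply_le (features φ Θ x) a).trans hx
  have hpm : ∀ a, AEStronglyMeasurable (fun x => ⟪Θ a, φ x⟫) ρ.fst := fun a =>
    (hφρ.const_inner (𝕜 := ℝ) (Θ a)).aestronglyMeasurable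
  set ξ : Fin k → 𝒳 × EuclideanSpace ℝ (Fin d) → EuclideanSpace ℝ (Fin d) :=
    fun a z => ⟪Θ a, φ z.1⟫ • z.2 with hξ
  have hξm : ∀ a, MemLp (ξ a) 2 ρ := fun a => by
    refine MemLp.of_le_mul (c := M) hY (((hpm a).comp_measurePreserving
      measurePreserving_fst_fst).smul hY.aestronglyMeasurable) ?_
    filter_upwards [measurePreserving_fst_fst.quasiMeasurePreserving.ae (hfeat a)] with z h1
    rw [hξ, norm_smul, Real.norm_eq_abs]
    gcongr
  have hξ0 : ∀ a, ∫ z, ξ a z ∂ρ = 0 := fun a => by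
    rw [← integral_smul_sub_eq_zero hY hfρ hfstar (hpm a) (hfeat a)]
    refine integral_congr_ae ?_
    filter_upwards [hz] with z h1
    rw [h1, sub_zero]
  have hξ2 : ∀ a, ∫ z, ‖ξ a z‖ ^ 2 ∂ρ ≤ ε ^ 2 * ∫ x, ⟪Θ a, φ x⟫ ^ 2 ∂ρ.fst := fun a => by
    refine le_trans (le_of_eq ?_) (integral_mul_norm_sq_le hY hfρ hnoise
      (b := fun x => ⟪Θ a, φ x⟫ ^ 2) ((hpm a).pow 2) (fun x => sq_nonneg _) (B := M ^ 2) ?_)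
    · refine integral_congr_ae ?_
      filter_upwards [hz] with z h1
      rw [h1, sub_zero, hξ, norm_smul, mul_pow, Real.norm_eq_abs, sq_abs]
    · filter_upwards [hfeat a] with x hx
      rw [← sq_abs]
      exact pow_le_pow_left₀ (abs_nonneg _) hx 2
  set G : (Fin n → 𝒳 × EuclideanSpace ℝ (Fin d)) → ℝ := fun z =>
    t / γ ^ 2 * ((n : ℝ)⁻¹ ^ 2 * ∑ a, ‖∑ i, ξ a (z i)‖ ^ 2) with hG
  have hGI : Integrable G P := ((integrable_finsetSum _ fun a _ =>
    (integral_norm_sq_sum_pi (hξm a) (hξ0 a)).1).const_mul _).const_mul _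
  -- The penalty alone gives `γ² ∑ ‖W a‖² ≤ ∑ ‖b a‖²`, where `b` is the empirical correlation of
  -- features and responses, which is centred because `f* = 0`.
  have hle : ∀ z, ‖probeLp hφρ Θ (W z)‖ ^ 2 ≤ G z := by
    intro z
    set s := ∑ a, ‖W z a‖ ^ 2 with hs
    have h1 := (hW z).inner_eq_zero (W z)
    set b : Fin k → EuclideanSpace ℝ (Fin d) := fun a => (n : ℝ)⁻¹ • ∑ i, ξ a (z i) with hb
    have h2 : (n : ℝ)⁻¹ * ∑ i, ⟪(z i).2, probe φ Θ (W z) (z i).1⟫ = ∑ a, ⟪b a, W z a⟫ := by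
      simp only [hb, hξ, probe, inner_sum, real_inner_smul_left, real_inner_smul_right, sum_inner,
        Finset.mul_sum]
      rw [Finset.sum_comm]
    have h3 : ∑ a, ⟪b a, W z a⟫ ≤ (∑ a, ‖b a‖ ^ 2) / (2 * γ) + γ / 2 * s := by
      rw [hs, Finset.sum_div, Finset.mul_sum, ← Finset.sum_add_distrib]
      refine Finset.sum_le_sum fun a _ => (real_inner_le_norm _ _).trans ?_
      have e : ‖b a‖ ^ 2 / (2 * γ) + γ / 2 * ‖W z a‖ ^ 2 - ‖b a‖ * ‖W z a‖
          = (‖b a‖ - γ * ‖W z a‖) ^ 2 / (2 * γ) := by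
        field_simp; ring
      have : 0 ≤ (‖b a‖ - γ * ‖W z a‖) ^ 2 / (2 * γ) := by positivity
      linarith
    have h4 : 0 ≤ (n : ℝ)⁻¹ * ∑ i, ‖probe φ Θ (W z) (z i).1‖ ^ 2 :=
      mul_nonneg (by positivity) (Finset.sum_nonneg fun _ _ => sq_nonneg _)
    simp only [inner_sub_left, real_inner_self_eq_norm_sq, Finset.sum_sub_distrib, mul_sub] at h1
    rw [h2] at h1
    have h5 : γ / 2 * s ≤ (∑ a, ‖b a‖ ^ 2) / (2 * γ) := by linarith
    have h6 : s ≤ (∑ a, ‖b a‖ ^ 2) / γ ^ 2 := by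
      rw [le_div_iff₀ (by positivity)] at h5 ⊢
      linarith
    refine (norm_probeLp_sq_le hφρ Θ (W z)).trans ((mul_le_mul_of_nonneg_left h6 ht0).trans_eq ?_)
    simp only [hG, hb, norm_smul, mul_pow, norm_inv, RCLike.norm_natCast, ← Finset.mul_sum]
    ring
  have hm := aestronglyMeasurable_norm_probeLp_sq hφρ Θ hγ0 hW 0
  simp only [sub_zero] at hm
  have hI : Integrable (fun z => ‖probeLp hφρ Θ (W z)‖ ^ 2) P :=
    hGI.mono' hm (ae_of_all _ fun z => by rw [Real.norm_of_nonneg (sq_nonneg _)]; exact hle z)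
  refine ⟨hI, (integral_mono hI hGI hle).trans ?_⟩
  have h1 : ∫ z, G z ∂P = t / γ ^ 2 * ((n : ℝ)⁻¹ * ∑ a, ∫ z, ‖ξ a z‖ ^ 2 ∂ρ) := by
    simp only [hG]
    rw [integral_const_mul, integral_const_mul, integral_finsetSum _ fun a _ =>
      (integral_norm_sq_sum_pi (hξm a) (hξ0 a)).1,
      Finset.sum_congr rfl fun a _ => (integral_norm_sq_sum_pi (hξm a) (hξ0 a)).2,
      ← Finset.mul_sum]
    field_simp
  have h2 : ∑ a, ∫ z, ‖ξ a z‖ ^ 2 ∂ρ ≤ ε ^ 2 * t := by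
    rw [ht, trace_featureCov hφρ, integral_finsetSum _ fun a _ =>
      (hφρ.const_inner (𝕜 := ℝ) (Θ a)).integrable_sq, Finset.mul_sum]
    exact Finset.sum_le_sum fun a _ => hξ2 a
  have h3 := trace_div_le_effDim hφρ Θ hγ0
  rw [← ht] at h3
  -- The penalty exceeds the trace, so `t² / γ² ≤ 2 t / (t + γ)`, and `t / (t + γ)` is a lower bound
  -- for the effective dimension.
  have h4 : t / γ ^ 2 * t ≤ 2 * effDim ρ.fst φ Θ γ := by
    refine le_trans ?_ (mul_le_mul_of_nonneg_left h3 zero_le_two)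
    rw [div_mul_eq_mul_div, mul_div_assoc', div_le_div_iff₀ (by positivity) (by positivity)]
    have h5 : t ≤ γ := by linarith
    nlinarith [mul_nonneg ht0 hγ0.le, mul_nonneg ht0 ht0, mul_nonneg (mul_nonneg ht0 ht0) ht0,
      mul_nonneg ht0 (sub_nonneg.mpr h5), mul_nonneg (mul_nonneg ht0 hγ0.le) (sub_nonneg.mpr h5),
      mul_nonneg (mul_nonneg ht0 ht0) (sub_nonneg.mpr h5)]
  rw [h1]
  calc t / γ ^ 2 * ((n : ℝ)⁻¹ * ∑ a, ∫ z, ‖ξ a z‖ ^ 2 ∂ρ)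
      ≤ t / γ ^ 2 * ((n : ℝ)⁻¹ * (ε ^ 2 * t)) := by gcongr
    _ = (t / γ ^ 2 * t) * ε ^ 2 / n := by ring
    _ ≤ _ := by gcongr

/-- The excess risk bound follows from a bound on the approximation error. -/
theorem excessRiskBound_of_norm_sub_probeProj_le (hφρ : MemLp φ 2 ρ.fst)
    (hY : MemLp (fun z => z.2) 2 ρ) (hfρ : MemLp fstar 2 ρ.fst)
    (hfstar : ρ[(fun z => z.2) | MeasurableSpace.comap Prod.fst inferInstance]
      =ᵐ[ρ] fun z => fstar z.1) {ε : ℝ}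
    (hnoise : ρ[(fun z => ‖z.2 - fstar z.1‖ ^ 2) | MeasurableSpace.comap Prod.fst inferInstance]
      ≤ᵐ[ρ] fun _ => ε ^ 2)
    (Θ : Fin k → H) {M : ℝ} (hM : ∀ᵐ x ∂ρ.fst, ‖features φ Θ x‖ ≤ M)
    {A B C : ℝ} (hA : 0 ≤ A)
    (hA0 : A = 0 → hfρ.toLp fstar = 0 ∨ ∀ᵐ x ∂ρ.fst, features φ Θ x = 0) (hB : 0 ≤ B)
    (hC : ‖hfρ.toLp fstar - probeProj hφρ Θ d (hfρ.toLp fstar)‖ ^ 2 ≤ C) :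
    ExcessRiskBound ρ φ Θ fstar ε A B C := by
  obtain ⟨Ws, hWs⟩ := exists_probeProj_eq hφρ Θ (hfρ.toLp fstar)
  set D0 := ‖hfρ.toLp fstar - probeProj hφρ Θ d (hfρ.toLp fstar)‖ ^ 2 with hD0
  have hexcess : ∀ W, risk ρ (probe φ Θ W) - risk ρ fstar
      = ‖probeLp hφρ Θ (W - Ws)‖ ^ 2 + D0 := fun W => by
    rw [risk_sub_risk hY hfρ hfstar (memLp_probe hφρ Θ W)]
    exact norm_probeLp_sub_sq hφρ Θ _ hWs W
  have hlog : ∀ (n : ℕ) (δ : ℝ), 0 ≤ Real.log n ^ (1 + δ) := fun n δ =>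
    Real.rpow_nonneg (Real.log_natCast_nonneg n) _
  -- With `A = 0` nothing can absorb an unspecified constant over `n`, so this case uses different
  -- penalties, chosen constant in `n`.
  rcases hA.eq_or_lt with hA' | hA'
  · rcases hA0 hA'.symm with h0 | h0
    · have hzero : fstar =ᵐ[ρ.fst] 0 := hfρ.coeFn_toLp.symm.trans (by
        rw [h0]; exact Lp.coeFn_zero _ _ _)
      have ht0 := trace_featureCov_nonneg hφρ Θ
      have hex : ∀ W, risk ρ (probe φ Θ W) - risk ρ fstar
          = ‖probeLp hφρ Θ W‖ ^ 2 := fun W => by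
        rw [risk_sub_risk hY hfρ hfstar (memLp_probe hφρ Θ W), h0, sub_zero]
        rfl
      refine ⟨fun _ => (featureCov ρ.fst φ Θ).trace + 1, fun _ => by positivity,
        fun δ hδ => ⟨0, fun n hn W hW => ?_⟩⟩
      obtain ⟨h1, h2⟩ := integral_norm_probeLp_sq_le_effDim hφρ hY hfρ hfstar hnoise hzero Θ hM
        rfl hn hW
      simp only [hex]
      refine ⟨effDim_le hφρ Θ (by positivity), h1, h2.trans ?_⟩
      have h3 : 0 ≤ A * Real.log n ^ (1 + δ) / n :=
        div_nonneg (mul_nonneg hA (hlog n δ)) n.cast_nonneg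
      have h4 : 0 ≤ B / n := by positivity
      linarith [sq_nonneg ‖hfρ.toLp fstar - probeProj hφρ Θ d (hfρ.toLp fstar)‖]
    · have hex : ∀ W, risk ρ (probe φ Θ W) - risk ρ fstar = D0 := fun W => by
        have : probeLp hφρ Θ (W - Ws) = 0 := by
          refine (Lp.eq_zero_iff_ae_eq_zero).mpr ((memLp_probe hφρ Θ _).coeFn_toLp.trans ?_)
          filter_upwards [h0] with x hx
          refine Finset.sum_eq_zero fun a _ => ?_
          have : ⟪Θ a, φ x⟫ = 0 := congrArg (fun v : EuclideanSpace ℝ (Fin k) => v a) hx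
          rw [this, zero_smul]
        rw [hexcess, this, norm_zero]
        ring
      refine ⟨fun _ => 1, fun _ => one_pos, fun δ hδ => ⟨0, fun n hn W hW => ?_⟩⟩
      simp only [hex]
      refine ⟨effDim_le hφρ Θ one_pos, integrable_const _, ?_⟩
      have h3 : 0 ≤ A * Real.log n ^ (1 + δ) / n :=
        div_nonneg (mul_nonneg hA (hlog n δ)) n.cast_nonneg
      have h4 : 0 ≤ B / n := by positivity
      have h5 : 0 ≤ 2 * effDim ρ.fst φ Θ 1 * ε ^ 2 / n := by
        have := effDim_nonneg hφρ Θ one_pos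
        positivity
      simp only [integral_const, probReal_univ, one_smul]
      linarith
  · obtain ⟨K, hK⟩ := exists_integral_norm_probeLp_sq_le hφρ hY hfρ hfstar Θ hM hWs
    refine ⟨fun n => ((n : ℝ) + 1)⁻¹, fun n => by positivity, fun δ hδ => ?_⟩
    -- For each `δ > 0` the logarithmic factor outgrows the constant `K`. Only the threshold depends
    -- on `δ`; the penalty does not.
    have htend : Tendsto (fun n : ℕ => A * Real.log n ^ (1 + δ)) atTop atTop :=
      ((tendsto_rpow_atTop (by linarith : 0 < 1 + δ)).comp
        (Real.tendsto_log_atTop.comp tendsto_natCast_atTop_atTop)).const_mul_atTop hA'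
    obtain ⟨N, hN⟩ := eventually_atTop.mp (htend.eventually_ge_atTop K)
    refine ⟨max N 4, fun n hn W hW => ?_⟩
    have hn4 : 4 ≤ n := (le_max_right N 4).trans hn.le
    have hγ0 : (0 : ℝ) < ((n : ℝ) + 1)⁻¹ := by positivity
    obtain ⟨h1, h2⟩ := hK n hn4 W hW
    simp only [hexcess]
    refine ⟨effDim_le hφρ Θ hγ0, h1.add (integrable_const _), ?_⟩
    rw [integral_add h1 (integrable_const _)]
    simp only [integral_const, probReal_univ, one_smul]
    have h3 : K / n ≤ A * Real.log n ^ (1 + δ) / n := by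
      gcongr
      exact hN n ((le_max_left N 4).trans hn.le)
    have h4 : 0 ≤ B / n := by positivity
    have h5 : 0 ≤ 2 * effDim ρ.fst φ Θ ((n : ℝ) + 1)⁻¹ * ε ^ 2 / n := by
      have := effDim_nonneg hφρ Θ hγ0
      positivity
    linarith

end ExcessRisk

/-! ### Comparing spans of eigenfunctions with spaces of probes. -/

section Approximation

variable {𝒳 H : Type*} [MeasurableSpace 𝒳] [NormedAddCommGroup H] [InnerProductSpace ℝ H]
  {τ : Measure 𝒳} {φ : 𝒳 → H} {d k m : ℕ}

theorem norm_probeLp_sub_probeLp_sq (hφ : MemLp φ 2 τ) (θ : Fin m → H) (Θ : Fin k → H)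
    (V : Fin m → EuclideanSpace ℝ (Fin d)) (G : Fin k → EuclideanSpace ℝ (Fin d)) :
    ‖probeLp hφ θ V - probeLp hφ Θ G‖ ^ 2
      = ∑ j, ‖embed hφ (∑ i, V i j • θ i - ∑ a, G a j • Θ a)‖ ^ 2 := by
  refine norm_sq_eq_sum_norm_embed_sq hφ ?_
  filter_upwards [Lp.coeFn_sub (probeLp hφ θ V) (probeLp hφ Θ G),
    (memLp_probe hφ θ V).coeFn_toLp, (memLp_probe hφ Θ G).coeFn_toLp] with x h1 h2 h3 j
  rw [h1, Pi.sub_apply]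
  erw [h2, h3]
  rw [PiLp.sub_apply, probe_apply, probe_apply, inner_sub_left]

theorem norm_sub_probeProj_sq_le_norm_sq (hφ : MemLp φ 2 τ) (Θ : Fin k → H)
    (f : Lp (EuclideanSpace ℝ (Fin d)) 2 τ) : ‖f - probeProj hφ Θ d f‖ ^ 2 ≤ ‖f‖ ^ 2 := by
  have := norm_sub_probeProj_le hφ Θ f 0
  rw [map_zero, sub_zero] at this
  gcongr

theorem norm_sum_smul_sq_of_orthonormal {E ι : Type*} [NormedAddCommGroup E]
    [InnerProductSpace ℝ E] {v : ι → E} (hv : Orthonormal ℝ v) (s : Finset ι) (c : ι → ℝ) :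
    ‖∑ i ∈ s, c i • v i‖ ^ 2 = ∑ i ∈ s, c i ^ 2 := by
  rw [← real_inner_self_eq_norm_sq, hv.inner_sum]
  simp [pow_two]

theorem norm_probeLp_sq_of_orthonormal (hφ : MemLp φ 2 τ) {θ : Fin m → H}
    (hθ : Orthonormal ℝ fun i => embed hφ (θ i)) (V : Fin m → EuclideanSpace ℝ (Fin d)) :
    ‖probeLp hφ θ V‖ ^ 2 = ∑ j, ∑ i, V i j ^ 2 := by
  rw [norm_probeLp_sq]
  refine Finset.sum_congr rfl fun j _ => ?_
  rw [map_sum]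
  simp only [map_smul]
  exact norm_sum_smul_sq_of_orthonormal hθ _ _

theorem coeffs_eq_of_ae_eq_probe (hφ : MemLp φ 2 τ) {θ : Fin m → H}
    (hθ : Orthonormal ℝ fun i => embed hφ (θ i)) {f : 𝒳 → EuclideanSpace ℝ (Fin d)}
    {V : Fin m → EuclideanSpace ℝ (Fin d)} (hf : f =ᵐ[τ] probe φ θ V) :
    coeffs τ φ θ f = V := by
  ext1 i
  have h1 : coeffs τ φ θ f i = ∫ x, ∑ j, (⟪θ i, φ x⟫ * ⟪θ j, φ x⟫) • V j ∂τ := by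
    refine integral_congr_ae ?_
    filter_upwards [hf] with x hx
    rw [hx, probe, Finset.smul_sum]
    simp only [smul_smul]
  have hI : ∀ j, Integrable (fun x => ⟪θ i, φ x⟫ * ⟪θ j, φ x⟫) τ := fun j =>
    (hφ.const_inner (𝕜 := ℝ) (θ i)).integrable_mul (hφ.const_inner (𝕜 := ℝ) (θ j))
  rw [h1, integral_finsetSum _ fun j _ => (hI j).smul_const _]
  simp only [integral_smul_const, ← inner_embed hφ, orthonormal_iff_ite.mp hθ, ite_smul, one_smul,
    zero_smul, Finset.sum_ite_eq, Finset.mem_univ, if_true]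

theorem toLp_eq_probeLp_of_ae_eq (hφ : MemLp φ 2 τ) (θ : Fin m → H)
    {f : 𝒳 → EuclideanSpace ℝ (Fin d)} (hf : MemLp f 2 τ)
    {V : Fin m → EuclideanSpace ℝ (Fin d)} (h : f =ᵐ[τ] probe φ θ V) :
    hf.toLp f = probeLp hφ θ V :=
  MemLp.toLp_congr hf (memLp_probe hφ θ V) h

theorem probeProj_probeLp (hφ : MemLp φ 2 τ) (Θ : Fin k → H)
    (V : Fin k → EuclideanSpace ℝ (Fin d)) :
    probeProj hφ Θ d (probeLp hφ Θ V) = probeLp hφ Θ V :=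
  Submodule.starProjection_eq_self_iff.mpr ⟨V, rfl⟩

theorem sum_firstOf {E : Type*} [AddCommMonoid E] {l : ℕ} (hl : l ≤ m) (f : Fin m → E) :
    ∑ i, firstOf f l hl i = ∑ i : Fin m, if (i : ℕ) < l then f i else 0 := by
  rw [← Finset.sum_filter]
  refine Finset.sum_bij (fun i _ => Fin.castLE hl i) (by simp) (by simp [Fin.ext_iff])
    (fun b hb => ⟨⟨b, (Finset.mem_filter.mp hb).2⟩, Finset.mem_univ _, rfl⟩) fun _ _ => rfl

theorem probeLp_firstOf (hφ : MemLp φ 2 τ) (θ : Fin m → H) {l : ℕ} (hl : l ≤ m)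
    (V : Fin m → EuclideanSpace ℝ (Fin d)) :
    probeLp hφ (firstOf θ l hl) (firstOf V l hl)
      = probeLp hφ θ fun i => if (i : ℕ) < l then V i else 0 := by
  refine MemLp.toLp_congr (memLp_probe hφ _ _) (memLp_probe hφ _ _) (ae_of_all _ fun x => ?_)
  refine (sum_firstOf hl fun i => ⟪θ i, φ x⟫ • V i).trans (Finset.sum_congr rfl fun i _ => ?_)
  simp only [smul_ite, smul_zero]

theorem range_probeLp_le_of_eq_sum (hφ : MemLp φ 2 τ) {Θ : Fin k → H} {Θ' : Fin m → H}
    {A : Fin m → Fin k → ℝ} (h : ∀ i, Θ' i = ∑ a, A i a • Θ a) :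
    LinearMap.range (probeLp (d := d) hφ Θ') ≤ LinearMap.range (probeLp (d := d) hφ Θ) := by
  rintro _ ⟨V, rfl⟩
  refine ⟨fun a => ∑ i, A i a • V i, MemLp.toLp_congr (memLp_probe hφ _ _) (memLp_probe hφ _ _)
    (ae_of_all _ fun x => ?_)⟩
  simp only [probe, h, sum_inner, real_inner_smul_left, Finset.smul_sum, Finset.sum_smul, smul_smul]
  rw [Finset.sum_comm]
  simp only [mul_comm]

theorem truncInvNorm_sq (hφ : MemLp φ 2 τ) {θ : Fin m → H}
    (hθ : Orthonormal ℝ fun i => embed hφ (θ i)) (ev : Fin m → ℝ)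
    (k l : ℕ)    (f : 𝒳 → EuclideanSpace ℝ (Fin d)) (j : Fin d) :
    truncInvNorm hφ θ ev k l f j ^ 2
      = ∑ i, ((√(ev i ^ 2 - nextEig ev k ^ 2))⁻¹
          * (if (i : ℕ) < l then coeffs τ φ θ f i else 0) j) ^ 2 := by
  rw [truncInvNorm, norm_sum_smul_sq_of_orthonormal hθ, Finset.sum_filter]
  refine Finset.sum_congr rfl fun i _ => ?_
  split_ifs <;> simp

end Approximation

/-! ### The approximation error under the three sets of assumptions. -/

section PosEigensystem

variable {𝒳 H : Type*} [MeasurableSpace 𝒳] [NormedAddCommGroup H] [InnerProductSpace ℝ H]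
  [CompleteSpace H] {μX : Measure 𝒳} {aug : Kernel 𝒳 𝒳}
  [IsMarkovKernel aug] {φ : 𝒳 → H} {hφ : MemLp φ 2 (augLaw μX aug)} {β lam : ℝ}
  {ρX : Measure 𝒳} {d k m : ℕ} {θ : Fin m → H} {ev : Fin m → ℝ}

theorem IsPosEigensystem.exists_forall_norm_sub_sq_le (hlam : 0 < lam)
    (h : IsPosEigensystem μX aug hφ β lam θ ev)
    (hm : m = Module.finrank ℝ (posEigenspace μX aug hφ β lam)) (Θ Θs : Fin k → H)
    (hΘs : ∀ Θ' : Fin k → H, regLoss μX aug φ β lam Θs ≤ regLoss μX aug φ β lam Θ')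
    (V : Fin m → EuclideanSpace ℝ (Fin d))
    (hV : ∀ i, V i ≠ 0 → (i : ℕ) < k ∧ ev i ≠ nextEig ev k) :
    ∃ G : Fin k → EuclideanSpace ℝ (Fin d), ∀ j,
      ‖embed hφ (∑ i, V i j • θ i - ∑ a, G a j • Θ a)‖ ^ 2 ≤
        (∑ i, ((√(ev i ^ 2 - nextEig ev k ^ 2))⁻¹ * V i j) ^ 2)
          * (regLoss μX aug φ β lam Θ - regLoss μX aug φ β lam Θs) := by
  choose g hg using fun j => h.exists_norm_sub_sq_le hlam hm Θ Θs hΘs (fun i => V i j)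
    fun i hi => hV i fun h0 => hi (by rw [h0]; rfl)
  exact ⟨fun a => WithLp.toLp 2 fun j => g j a, hg⟩

theorem nextEig_of_le (hk : m ≤ k) : nextEig ev k = 0 := by
  rw [nextEig, dif_neg (by omega)]

/-- If the representation has at least as many features as there are positive eigenvalues, then
linear combinations of the eigenfunctions are well approximated by linear probes. -/
theorem IsPosEigensystem.exists_norm_probeLp_sub_sq_le (hlam : 0 < lam)
    (h : IsPosEigensystem μX aug hφ β lam θ ev)
    (hm : m = Module.finrank ℝ (posEigenspace μX aug hφ β lam)) (hk : m ≤ k) (Θ Θs : Fin k → H)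
    (hΘs : ∀ Θ' : Fin k → H, regLoss μX aug φ β lam Θs ≤ regLoss μX aug φ β lam Θ')
    (hρ : MemLp φ 2 ρX) {cr : ℝ} (hcr : 0 < cr) (hexp : LowExpansion hφ hρ cr)
    (f : 𝒳 → EuclideanSpace ℝ (Fin d)) :
    ∃ G : Fin k → EuclideanSpace ℝ (Fin d),
      ‖probeLp hρ θ (coeffs (augLaw μX aug) φ θ f) - probeLp hρ Θ G‖ ^ 2 ≤
        cr * invNormSq hφ θ ev f
          * (regLoss μX aug φ β lam Θ - regLoss μX aug φ β lam Θs) := by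
  set V := coeffs (augLaw μX aug) φ θ f with hV
  obtain ⟨G, hG⟩ := h.exists_forall_norm_sub_sq_le hlam hm Θ Θs hΘs V fun i _ =>
    ⟨i.2.trans_le hk, by rw [nextEig_of_le hk]; exact (h.pos i).ne'⟩
  refine ⟨G, ?_⟩
  rw [norm_probeLp_sub_probeLp_sq, invNormSq, norm_probeLp_sq_of_orthonormal hφ h.orthonormal,
    mul_assoc, Finset.sum_mul, Finset.mul_sum]
  refine Finset.sum_le_sum fun j _ => (hexp _).trans (mul_le_mul_of_nonneg_left ?_ hcr.le)
  refine (hG j).trans_eq ?_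
  simp only [nextEig_of_le hk, ne_eq, OfNat.ofNat_ne_zero, not_false_eq_true, zero_pow, sub_zero,
    Real.sqrt_sq (h.pos _).le, PiLp.smul_apply, smul_eq_mul, hV]

/-- If `k < m`, the last term is at least `‖f‖²` and the zero probe suffices. Otherwise `nextEig` is
0, every eigenfunction is approximated, and the source condition identifies `f` with its expansion
in both `L²` spaces. -/
theorem norm_sub_probeProj_sq_le_of_lowExpansion (hlam : 0 < lam)
    (h : IsPosEigensystem μX aug hφ β lam θ ev)
    (hm : m = Module.finrank ℝ (posEigenspace μX aug hφ β lam)) (Θ Θs : Fin k → H)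
    (hΘs : ∀ Θ' : Fin k → H, regLoss μX aug φ β lam Θs ≤ regLoss μX aug φ β lam Θ')
    (hρ : MemLp φ 2 ρX) {cr : ℝ} (hcr : 0 < cr) (hexp : LowExpansion hφ hρ cr)
    {f : 𝒳 → EuclideanSpace ℝ (Fin d)} (hf : MemLp f 2 ρX)
    (hsource : SourceCondition (augLaw μX aug) ρX φ θ f) :
    ‖hf.toLp f - probeProj hρ Θ d (hf.toLp f)‖ ^ 2 ≤
      cr * invNormSq hφ θ ev f * (regLoss μX aug φ β lam Θ - regLoss μX aug φ β lam Θs)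
        + ((m - k : ℕ) : ℝ) * ‖hf.toLp f‖ ^ 2 := by
  have hgap := sub_nonneg.mpr (hΘs Θ)
  rcases lt_or_ge k m with hk | hk
  · have h1 : (1 : ℝ) ≤ ((m - k : ℕ) : ℝ) := by exact_mod_cast (by omega : 1 ≤ m - k)
    have h2 : 0 ≤ cr * invNormSq hφ θ ev f
        * (regLoss μX aug φ β lam Θ - regLoss μX aug φ β lam Θs) :=
      mul_nonneg (mul_nonneg hcr.le (sq_nonneg _)) hgap
    have h3 := le_mul_of_one_le_left (sq_nonneg ‖hf.toLp f‖) h1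
    linarith [norm_sub_probeProj_sq_le_norm_sq hρ Θ (hf.toLp f)]
  · obtain ⟨V, hVμ, hVρ⟩ := hsource
    obtain ⟨G, hG⟩ := h.exists_norm_probeLp_sub_sq_le hlam hm hk Θ Θs hΘs hρ hcr hexp f
    rw [coeffs_eq_of_ae_eq_probe hφ h.orthonormal hVμ,
      ← toLp_eq_probeLp_of_ae_eq hρ θ hf hVρ] at hG
    have h1 := pow_le_pow_left₀ (norm_nonneg _) (norm_sub_probeProj_le hρ Θ (hf.toLp f) G) 2
    have h2 : 0 ≤ ((m - k : ℕ) : ℝ) * ‖hf.toLp f‖ ^ 2 := by positivity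
    linarith

/-- Triangle inequality through two intermediate functions: the `ρ_𝒳` projection of `f` on the first
`l` eigenfunctions, then its `μ_Ξ` projection (cost `σ`), then a probe (cost `ζ`). Using `(a + b)² ≤
2a² + 2b²` twice produces the constants 2, 4, 4. -/
theorem norm_sub_probeProj_sq_le_of_profiles (hlam : 0 < lam)
    (h : IsPosEigensystem μX aug hφ β lam θ ev)
    (hm : m = Module.finrank ℝ (posEigenspace μX aug hφ β lam)) (Θ Θs : Fin k → H)
    (hΘs : ∀ Θ' : Fin k → H, regLoss μX aug φ β lam Θs ≤ regLoss μX aug φ β lam Θ')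
    (hρ : MemLp φ 2 ρX) {ζ : ℝ → ℝ} (hζ : Monotone ζ) (hexp : LowExpansionProfile hφ hρ ζ)
    {f : 𝒳 → EuclideanSpace ℝ (Fin d)} (hf : MemLp f 2 ρX) {σ : ℕ → ℝ}
    (hσ : RobustProfile (augLaw μX aug) hρ θ hf σ)
    (hsource : SourceCondition (augLaw μX aug) ρX φ θ f) {l : ℕ} (hlk : l ≤ k) (hlm : l ≤ m)
    (hinv : TruncInvertible (augLaw μX aug) φ θ ev k l f) :
    ‖hf.toLp f - probeProj hρ Θ d (hf.toLp f)‖ ^ 2 ≤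
      2 * ‖probeProj hρ θ d (hf.toLp f) - probeProj hρ (firstOf θ l hlm) d (hf.toLp f)‖ ^ 2
        + 4 * σ l ^ 2 * ‖hf.toLp f‖ ^ 2
        + 4 * ∑ j : Fin d, ζ (truncInvNorm hφ θ ev k l f j
            * √(regLoss μX aug φ β lam Θ - regLoss μX aug φ β lam Θs)) ^ 2 := by
  set gap := regLoss μX aug φ β lam Θ - regLoss μX aug φ β lam Θs with hgap
  have hgap0 : 0 ≤ gap := sub_nonneg.mpr (hΘs Θ)
  set V : Fin m → EuclideanSpace ℝ (Fin d) := fun i =>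
    if (i : ℕ) < l then coeffs (augLaw μX aug) φ θ f i else 0 with hV
  have hV0 : ∀ i, V i ≠ 0 → (i : ℕ) < k ∧ ev i ≠ nextEig ev k := by
    intro i hi
    have hil : (i : ℕ) < l := by
      by_contra hil
      exact hi (if_neg hil)
    refine ⟨hil.trans_le hlk, fun he => hi ?_⟩
    simp only [hV, if_pos hil, hinv i hil he]
  obtain ⟨G, hG⟩ := h.exists_forall_norm_sub_sq_le hlam hm Θ Θs hΘs V hV0
  have hz : ‖probeLp hρ θ V - probeLp hρ Θ G‖ ^ 2
      ≤ ∑ j, ζ (truncInvNorm hφ θ ev k l f j * √gap) ^ 2 := by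
    rw [norm_probeLp_sub_probeLp_sq]
    refine Finset.sum_le_sum fun j _ => pow_le_pow_left₀ (norm_nonneg _) ?_ 2
    refine (hexp _).trans (hζ (le_of_sq_le_sq ?_ ?_))
    · rw [mul_pow, Real.sq_sqrt hgap0, truncInvNorm_sq hφ h.orthonormal]
      exact hG j
    · exact mul_nonneg (norm_nonneg _) (Real.sqrt_nonneg _)
  have hy := hσ l hlm
  rw [probeLp_firstOf] at hy
  obtain ⟨W, -, hW⟩ := hsource
  have hP : probeProj hρ θ d (hf.toLp f) = hf.toLp f := by
    rw [toLp_eq_probeLp_of_ae_eq hρ θ hf hW, probeProj_probeLp]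
  rw [hP]
  set F := hf.toLp f
  set P := probeProj hρ (firstOf θ l hlm) d F
  have hsplit : ‖F - probeProj hρ Θ d F‖
      ≤ ‖F - P‖ + (‖P - probeLp hρ θ V‖ + ‖probeLp hρ θ V - probeLp hρ Θ G‖) := by
    refine (norm_sub_probeProj_le hρ Θ F G).trans ?_
    have e : F - probeLp hρ Θ G
        = (F - P) + ((P - probeLp hρ θ V) + (probeLp hρ θ V - probeLp hρ Θ G)) := by abel
    rw [e]
    exact (norm_add_le _ _).trans (add_le_add_right (norm_add_le _ _) _)
  have h1 := pow_le_pow_left₀ (norm_nonneg _) hsplit 2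
  have h2 := add_sq_le (a := ‖F - P‖) (b := ‖P - probeLp hρ θ V‖ + ‖probeLp hρ θ V - probeLp hρ Θ G‖)
  have h3 := add_sq_le (a := ‖P - probeLp hρ θ V‖) (b := ‖probeLp hρ θ V - probeLp hρ Θ G‖)
  have h4 : ‖P - probeLp hρ θ V‖ ^ 2 ≤ σ l ^ 2 * ‖F‖ ^ 2 := by
    rw [← mul_pow]
    exact pow_le_pow_left₀ (norm_nonneg _) hy 2
  linarith

/-- For `k < m` the first term suffices, by comparison with the zero probe. For `k = m` thresholding
is an orthogonal change of features, so every probe on `Θfull` is also one on `Θ`. -/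
theorem norm_sub_probeProj_sq_le_of_isThresholding (hlam : 0 < lam)
    (h : IsPosEigensystem μX aug hφ β lam θ ev)
    (hm : m = Module.finrank ℝ (posEigenspace μX aug hφ β lam)) (hk : k ≤ m)
    (Θfull Θs : Fin m → H) (Θ : Fin k → H) (hΘ : IsThresholding hφ hk Θfull Θ)
    (hΘs : ∀ Θ' : Fin m → H, regLoss μX aug φ β lam Θs ≤ regLoss μX aug φ β lam Θ')
    (hρ : MemLp φ 2 ρX) {cr : ℝ} (hcr : 0 < cr) (hexp : LowExpansion hφ hρ cr)
    {f : 𝒳 → EuclideanSpace ℝ (Fin d)} (hf : MemLp f 2 ρX) :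
    ‖hf.toLp f - probeProj hρ Θ d (hf.toLp f)‖ ^ 2 ≤
      ((m - k : ℕ) : ℝ) * ‖hf.toLp f‖ ^ 2
        + 2 * cr * invNormSq hφ θ ev f
          * (regLoss μX aug φ β lam Θfull - regLoss μX aug φ β lam Θs)
        + 2 * ‖hf.toLp f - probeLp hρ θ (coeffs (augLaw μX aug) φ θ f)‖ ^ 2 := by
  have hgap := sub_nonneg.mpr (hΘs Θfull)
  have h0 : 0 ≤ invNormSq hφ θ ev f := sq_nonneg _
  rcases hk.lt_or_eq with hlt | rfl
  · have h1 : (1 : ℝ) ≤ ((m - k : ℕ) : ℝ) := by exact_mod_cast (by omega : 1 ≤ m - k)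
    have h2 : 0 ≤ 2 * cr * invNormSq hφ θ ev f
        * (regLoss μX aug φ β lam Θfull - regLoss μX aug φ β lam Θs) := by positivity
    have h3 := le_mul_of_one_le_left (sq_nonneg ‖hf.toLp f‖) h1
    linarith [norm_sub_probeProj_sq_le_norm_sq hρ Θ (hf.toLp f),
      sq_nonneg ‖hf.toLp f - probeLp hρ θ (coeffs (augLaw μX aug) φ θ f)‖]
  · obtain ⟨U, hU, -, -, hΘU⟩ := hΘ
    obtain ⟨G, hG⟩ := h.exists_norm_probeLp_sub_sq_le hlam hm le_rfl Θfull Θs hΘs hρ hcr hexp f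
    have hUU : star U * U = 1 := (Matrix.mem_orthogonalGroup_iff' (Fin k) ℝ).mp hU
    have hfull : ∀ i, Θfull i = ∑ a, U a i • Θ a := by
      intro i
      have h1 : ∀ b, ∑ a, U a i * U a b = if i = b then 1 else 0 := fun b => by
        have := congrFun (congrFun hUU i) b
        rw [Matrix.mul_apply, Matrix.one_apply] at this
        simpa using this
      simp only [hΘU, Finset.smul_sum, smul_smul]
      rw [Finset.sum_comm]
      simp only [← Finset.sum_smul, Fin.castLE_rfl, id, h1, ite_smul, one_smul, zero_smul,
        Finset.sum_ite_eq, Finset.mem_univ, if_true]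
    obtain ⟨G', hG'⟩ : probeLp hρ Θfull G ∈ LinearMap.range (probeLp (d := d) hρ Θ) :=
      range_probeLp_le_of_eq_sum hρ (A := fun i a => U a i) hfull ⟨G, rfl⟩
    rw [← hG'] at hG
    set F := hf.toLp f
    set Q := probeLp hρ θ (coeffs (augLaw μX aug) φ θ f)
    have h1 : ‖F - probeProj hρ Θ d F‖ ≤ ‖F - Q‖ + ‖Q - probeLp hρ Θ G'‖ :=
      (norm_sub_probeProj_le hρ Θ F G').trans (norm_sub_le_norm_sub_add_norm_sub _ _ _)
    have h2 := pow_le_pow_left₀ (norm_nonneg _) h1 2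
    have h3 := add_sq_le (a := ‖F - Q‖) (b := ‖Q - probeLp hρ Θ G'‖)
    have h4 : 0 ≤ ((k - k : ℕ) : ℝ) * ‖F‖ ^ 2 := by positivity
    linarith

end PosEigensystem

end

/-! ### The main theorem. -/

theorem mainTheorem1 {𝒳 H : Type*} [MeasurableSpace 𝒳]
    [NormedAddCommGroup H] [InnerProductSpace ℝ H] [CompleteSpace H]
    -- pretraining data: inputs, augmentations, feature map, invariance weight, regularization
    (μX : Measure 𝒳) [IsProbabilityMeasure μX] (aug : Kernel 𝒳 𝒳) [IsMarkovKernel aug]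
    (φ : 𝒳 → H) (hφμ : MemLp φ 2 (augLaw μX aug))
    (β lam : ℝ) (hβ : 0 < β) (hlam : 0 < lam)
    -- downstream task: regression of `Y ∈ ℝᵈ` on `X`, with noise level `ε`
    {d : ℕ} (ρ : Measure (𝒳 × EuclideanSpace ℝ (Fin d))) [IsProbabilityMeasure ρ]
    (hφρ : MemLp φ 2 ρ.fst) (hY : MemLp (fun z => z.2) 2 ρ)
    (fstar : 𝒳 → EuclideanSpace ℝ (Fin d))
    (hfμ : MemLp fstar 2 (augLaw μX aug)) (hfρ : MemLp fstar 2 ρ.fst)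
    (hfstar : ρ[(fun z => z.2) | MeasurableSpace.comap Prod.fst inferInstance]
      =ᵐ[ρ] fun z => fstar z.1)
    (ε : ℝ)
    (hnoise : ρ[(fun z => ‖z.2 - fstar z.1‖ ^ 2) | MeasurableSpace.comap Prod.fst inferInstance]
      ≤ᵐ[ρ] fun _ => ε ^ 2) :
    -- the number `k_λ` of positive eigenvalues of `T_λ` is finite
    FiniteDimensional ℝ (posEigenspace μX aug hφμ β lam) ∧
    ∀ m : ℕ, m = Module.finrank ℝ (posEigenspace μX aug hφμ β lam) →
    ∀ (θ : Fin m → H) (ev : Fin m → ℝ), IsPosEigensystem μX aug hφμ β lam θ ev →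
    -- simplified bound
    (∀ cr : ℝ, 0 < cr → LowExpansion hφμ hφρ cr →
      RobustEigenfunctions (augLaw μX aug) hφρ θ hfρ →
      SourceCondition (augLaw μX aug) ρ.fst φ θ fstar →
      ∀ (k : ℕ) (Θ Θs : Fin k → H) (M : ℝ), (∀ᵐ x ∂ρ.fst, ‖features φ Θ x‖ ≤ M) →
      (∀ Θ' : Fin k → H, regLoss μX aug φ β lam Θs ≤ regLoss μX aug φ β lam Θ') →
      ExcessRiskBound ρ φ Θ fstar ε ‖hfρ.toLp fstar‖ 0
        (cr * invNormSq hφμ θ ev fstar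
            * (regLoss μX aug φ β lam Θ - regLoss μX aug φ β lam Θs)
          + ((m - k : ℕ) : ℝ) * ‖hfρ.toLp fstar‖ ^ 2)) ∧
    -- bound with general expansion and robustness profiles
    (∀ ζ : ℝ → ℝ, Continuous ζ → Monotone ζ → ζ 0 = 0 → LowExpansionProfile hφμ hφρ ζ →
      ∀ σ : ℕ → ℝ, Monotone σ → (∃ b : ℝ, ∀ l, |σ l| ≤ b) →
      RobustProfile (augLaw μX aug) hφρ θ hfρ σ →
      SourceCondition (augLaw μX aug) ρ.fst φ θ fstar →
      ∀ k : ℕ, k ≤ m → ∀ (Θ Θs : Fin k → H) (M : ℝ), (∀ᵐ x ∂ρ.fst, ‖features φ Θ x‖ ≤ M) →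
      (∀ Θ' : Fin k → H, regLoss μX aug φ β lam Θs ≤ regLoss μX aug φ β lam Θ') →
      ∀ (l : ℕ) (_ : l ≤ k) (hlm : l ≤ m),
      TruncInvertible (augLaw μX aug) φ θ ev k l fstar →
      ExcessRiskBound ρ φ Θ fstar ε (8 * M ^ 2 * ‖hfρ.toLp fstar‖)
        (64 * k * (eLpNorm (hfρ.toLp fstar - probeProj hφρ Θ d (hfρ.toLp fstar) :
          Lp (EuclideanSpace ℝ (Fin d)) 2 ρ.fst) ∞ ρ.fst).toReal)
        (2 * ‖probeProj hφρ θ d (hfρ.toLp fstar)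
              - probeProj hφρ (firstOf θ l hlm) d (hfρ.toLp fstar)‖ ^ 2
          + 4 * σ l ^ 2 * ‖hfρ.toLp fstar‖ ^ 2
          + 4 * ∑ j : Fin d, ζ (truncInvNorm hφμ θ ev k l fstar j
              * Real.sqrt (regLoss μX aug φ β lam Θ - regLoss μX aug φ β lam Θs)) ^ 2)) ∧
    -- bound without the source condition, for a pretraining search in dimension `k_λ`
    (∀ cr : ℝ, 0 < cr → LowExpansion hφμ hφρ cr →
      RobustEigenfunctions (augLaw μX aug) hφρ θ hfρ →
      ∀ (k : ℕ) (hk : k ≤ m) (Θfull Θs : Fin m → H) (Θ : Fin k → H) (M : ℝ),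
      IsThresholding hφμ hk Θfull Θ → (∀ᵐ x ∂ρ.fst, ‖features φ Θ x‖ ≤ M) →
      (∀ Θ' : Fin m → H, regLoss μX aug φ β lam Θs ≤ regLoss μX aug φ β lam Θ') →
      ExcessRiskBound ρ φ Θ fstar ε (8 * M ^ 2 * ‖hfρ.toLp fstar‖)
        (64 * k * (eLpNorm (hfρ.toLp fstar - probeProj hφρ Θ d (hfρ.toLp fstar) :
          Lp (EuclideanSpace ℝ (Fin d)) 2 ρ.fst) ∞ ρ.fst).toReal)
        (((m - k : ℕ) : ℝ) * ‖hfρ.toLp fstar‖ ^ 2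
          + 2 * cr * invNormSq hφμ θ ev fstar
            * (regLoss μX aug φ β lam Θfull - regLoss μX aug φ β lam Θs)
          + 2 * ‖hfρ.toLp fstar - probeLp hφρ θ (coeffs (augLaw μX aug) φ θ fstar)‖ ^ 2)) ∧
    -- the bound on the representation
    (∀ (k : ℕ) (Θ : Fin k → H) (κ : ℝ), (∀ x, ‖φ x‖ ≤ κ) →
      regLoss μX aug φ β lam Θ ≤ regLoss μX aug φ β lam (0 : Fin k → H) →
      ∀ x, ‖features φ Θ x‖ ≤ Real.sqrt (k / (2 * lam)) * κ) := by
  -- The coefficient of the logarithmic term can vanish in two ways: `M = 0`, and then the features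
  -- are zero almost everywhere, or `f* = 0`.
  have hAM : ∀ {k : ℕ} (Θ : Fin k → H) (M : ℝ), (∀ᵐ x ∂ρ.fst, ‖features φ Θ x‖ ≤ M) →
      8 * M ^ 2 * ‖hfρ.toLp fstar‖ = 0 →
      hfρ.toLp fstar = 0 ∨ ∀ᵐ x ∂ρ.fst, features φ Θ x = 0 := by
    intro k Θ M hM h0
    rcases mul_eq_zero.mp h0 with h1 | h1
    · have h2 : M = 0 := by simpa using h1
      right
      filter_upwards [hM] with x hx
      exact norm_le_zero_iff.mp (hx.trans_eq h2)
    · exact Or.inl (norm_eq_zero.mp h1)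
  refine ⟨finiteDimensional_posEigenspace hlam, fun m hm θ ev h => ⟨?_, ?_, ?_, ?_⟩⟩
  · intro cr hcr hexp _ hsource k Θ Θs M hM hΘs
    exact excessRiskBound_of_norm_sub_probeProj_le hφρ hY hfρ hfstar hnoise Θ hM (norm_nonneg _)
      (fun h0 => Or.inl (norm_eq_zero.mp h0)) le_rfl
      (norm_sub_probeProj_sq_le_of_lowExpansion hlam h hm Θ Θs hΘs hφρ hcr hexp hfρ hsource)
  · intro ζ _ hζ _ hexp σ _ _ hσ hsource k _ Θ Θs M hM hΘs l hlk hlm hinv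
    exact excessRiskBound_of_norm_sub_probeProj_le hφρ hY hfρ hfstar hnoise Θ hM (by positivity)
      (hAM Θ M hM) (by positivity)
      (norm_sub_probeProj_sq_le_of_profiles hlam h hm Θ Θs hΘs hφρ hζ hexp hfρ hσ hsource hlk hlm
        hinv)
  · intro cr hcr hexp _ k hk Θfull Θs Θ M hΘ hM hΘs
    exact excessRiskBound_of_norm_sub_probeProj_le hφρ hY hfρ hfstar hnoise Θ hM (by positivity)
      (hAM Θ M hM) (by positivity)
      (norm_sub_probeProj_sq_le_of_isThresholding hlam h hm hk Θfull Θs Θ hΘ hΘs hφρ hcr hexp hfρ)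
  · intro k Θ κ hκ hΘ x
    exact norm_features_le μX aug hβ.le hlam hκ hΘ x
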